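/- Let $\Delta\subset\mathbb{R}^d$ be a convex $d$-polytope (with nonempty interior) that is simple in edges, i.e. each edge lies in exactly $d-1$ facets. Call a vertex simple if exactly $d$ facets meet at it. Let $\Sigma$ be a standard resolution of $\Delta$: the simple polytope obtained by cutting off every nonsimple vertex $v$ by a hyperplane that strictly separates $v$ from all other vertices, the pieces cut off being pairwise disjoint. The facets of $\Sigma$ lying in the cutting hyperplanes are called inserted. For each facet $\Gamma$ of $\Sigma$ fix a linear functional $\xi_\Gamma$ whose maximum on $\Sigma$ is attained exactly on $\Gamma$. For $H=(H_\Gamma)$ close to $(\max_\Sigma\xi_\Gamma)_\Gamma$, the volume of $\{x : \xi_\Gamma(x)\le H_\Gamma \text{ for all } \Gamma\}$ is a polynomial $\mathrm{Vol}_\Sigma(H)$. Put $A(\Sigma)=\mathbb{R}[\partial_\Gamma]/J$, where $\partial_\Gamma$ is the differentiation with respect to $H_\Gamma$ and $J$ is the ideal of constant-coefficient operators annihilating $\mathrm{Vol}_\Sigma$, and let $A^k(\Sigma)$ be its homogeneous components. Let $I^k\subset A^k(\Sigma)$ be the linear span of all $\partial_\Gamma\alpha$ with $\Gamma$ inserted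 and $\alpha\in A^{k-1}(\Sigma)$ (so $I^0=0$). Let $\Phi$ and $\Psi$ be the dual (normal) fans of $\Delta$ and $\Sigma$, and let $\Upsilon$ be the collection of all cones of $\Phi$ of dimension at most $d-1$. Then $\Upsilon$ is a subfan of $\Psi$. For a fan $\Theta$, let $O_\Theta$ be the algebra of continuous functions on the union of the cones of $\Theta$ that are polynomial on each cone, let $O_\Theta^+$ be the ideal generated by the global linear functions, and let $\overline{O}_\Theta=O_\Theta/O_\Theta^+$, graded by degree. Let $\overline{N}^k$ be the degree $k$ component of the kernel of the restriction homomorphism $\overline{O}_\Psi\to\overline{O}_\Upsilon$. There is a unique isomorphism of $\mathbb{R}$-algebras $\overline{O}_\Psi\to A(\Sigma)$ that takes, for every facet $\Gamma$ of $\Sigma$, the class of the characteristic function $\chi_\Gamma$ (the piecewise linear function on $\Psi$ with $\chi_\Gamma(\xi_\Gamma)=1$ and $\chi_\Gamma(\xi_{\Gamma'})=0$ for $\Gamma'\ne\Gamma$) to $\partial_\Gamma$. Under this isomorphism the subspace $\overline{N}^k$ corresponds to $I^k$, for every $k$ if $\Delta$ has at least one nonsimple vertex, and for every $k\neq d$ if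 $\Delta$ is simple. -/

import Mathlib

open Set Filter Topology MeasureTheory
open scoped Matrix

noncomputable section

namespace EdgeSimple

/-! ### Convex polytopes.
Points of `ℝ^d` and linear functionals on `ℝ^d` are both coordinate vectors `Fin d → ℝ`; the value
of the functional `ξ` at the point `x` is `ξ ⬝ᵥ x`. -/

/-- A `d`-polytope: a convex polytope in `ℝ^d` with nonempty interior. -/
def IsDPolytope {d : ℕ} (P : Set (Fin d → ℝ)) : Prop :=
  (∃ s : Set (Fin d → ℝ), s.Finite ∧ P = convexHull ℝ s) ∧ (interior P).Nonempty

/-- The set of points of `P` at which the functional `ξ` achieves its maximum on `P`. -/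
def maxFace {d : ℕ} (P : Set (Fin d → ℝ)) (ξ : Fin d → ℝ) : Set (Fin d → ℝ) :=
  {x | x ∈ P ∧ ∀ y ∈ P, ξ ⬝ᵥ y ≤ ξ ⬝ᵥ x}

/-- Nonempty faces of a polytope (the polytope itself is the face where `ξ = 0` is maximal). -/
def IsFace {d : ℕ} (P F : Set (Fin d → ℝ)) : Prop :=
  F.Nonempty ∧ ∃ ξ : Fin d → ℝ, F = maxFace P ξ

/-- The dimension of the affine span of `F`. -/
def affDim {d : ℕ} (F : Set (Fin d → ℝ)) : ℕ := Module.finrank ℝ (vectorSpan ℝ F)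

def IsVertex {d : ℕ} (P : Set (Fin d → ℝ)) (v : Fin d → ℝ) : Prop := IsFace P {v}

def IsEdge {d : ℕ} (P e : Set (Fin d → ℝ)) : Prop := IsFace P e ∧ affDim e = 1

/-- Facets of a `d`-polytope: faces of dimension `d - 1`. -/
def IsFacet {d : ℕ} (P F : Set (Fin d → ℝ)) : Prop := IsFace P F ∧ affDim F + 1 = d

/-- A nonsimple vertex: a vertex at which the number of facets is not exactly `d`. -/
def IsNonsimpleVertex {d : ℕ} (P : Set (Fin d → ℝ)) (v : Fin d → ℝ) : Prop :=
  IsVertex P v ∧ {F | IsFacet P F ∧ v ∈ F}.ncard ≠ d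

/-- Every edge is contained in exactly `d - 1` facets. -/
def SimpleInEdges {d : ℕ} (P : Set (Fin d → ℝ)) : Prop :=
  ∀ e, IsEdge P e → {F | IsFacet P F ∧ e ⊆ F}.ncard + 1 = d

/-- The type of facets of `P`. -/
abbrev Facet {d : ℕ} (P : Set (Fin d → ℝ)) : Type := {F : Set (Fin d → ℝ) // IsFacet P F}

/-! ### Standard resolution -/

/-- Cutting data for all nonsimple vertices: the hyperplane `{x | n v ⬝ᵥ x = c v}` strictly
separates the nonsimple vertex `v` from all other vertices, and the hyperplanes are so close to
their vertices that the pieces cut off are pairwise disjoint (equivalently, when the vertices are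
cut off one after another, in any order, each hyperplane still separates its vertex from all
the other vertices, old and new, of the polytope that is being cut). -/
def IsCut {d : ℕ} (Δ : Set (Fin d → ℝ)) (n : (Fin d → ℝ) → (Fin d → ℝ))
    (c : (Fin d → ℝ) → ℝ) : Prop :=
  (∀ v, IsNonsimpleVertex Δ v →
    c v < n v ⬝ᵥ v ∧ ∀ w, IsVertex Δ w → w ≠ v → n v ⬝ᵥ w < c v) ∧
  ∀ v w, IsNonsimpleVertex Δ v → IsNonsimpleVertex Δ w → v ≠ w →
    ∀ x ∈ Δ, c v ≤ n v ⬝ᵥ x → n w ⬝ᵥ x < c w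

/-- The polytope `Δ` with all nonsimple vertices cut off. -/
def resolution {d : ℕ} (Δ : Set (Fin d → ℝ)) (n : (Fin d → ℝ) → (Fin d → ℝ))
    (c : (Fin d → ℝ) → ℝ) : Set (Fin d → ℝ) :=
  {x | x ∈ Δ ∧ ∀ v, IsNonsimpleVertex Δ v → n v ⬝ᵥ x ≤ c v}

/-- The facets of the resolution that come from the cutting hyperplanes. -/
def IsInserted {d : ℕ} (Δ : Set (Fin d → ℝ)) (n : (Fin d → ℝ) → (Fin d → ℝ))
    (c : (Fin d → ℝ) → ℝ) (Γ : Facet (resolution Δ n c)) : Prop :=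
  ∃ v, IsNonsimpleVertex Δ v ∧ (Γ : Set (Fin d → ℝ)) = {x ∈ resolution Δ n c | n v ⬝ᵥ x = c v}

/-! ### The algebra of differential operators modulo the annihilator of the volume polynomial -/

/-- `ξ` chooses for each facet of `P` a functional that achieves its maximum on `P` exactly on
that facet. -/
def IsNormalSystem {d : ℕ} (P : Set (Fin d → ℝ)) (ξ : Facet P → (Fin d → ℝ)) : Prop :=
  ∀ Γ : Facet P, (Γ : Set (Fin d → ℝ)) = maxFace P (ξ Γ)

/-- The support numbers of `P`: the maxima of the functionals `ξ Γ` on `P`. -/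
def supportNumber {d : ℕ} (P : Set (Fin d → ℝ)) (ξ : Facet P → (Fin d → ℝ)) (Γ : Facet P) : ℝ :=
  sSup ((fun x => ξ Γ ⬝ᵥ x) '' P)

/-- The polytope obtained by moving the facets of `P` parallel to themselves so that the facet
`Γ` gets into the hyperplane `ξ Γ ⬝ᵥ x = H Γ`. -/
def movedPolytope {d : ℕ} (P : Set (Fin d → ℝ)) (ξ : Facet P → (Fin d → ℝ)) (H : Facet P → ℝ) :
    Set (Fin d → ℝ) :=
  {x | ∀ Γ, ξ Γ ⬝ᵥ x ≤ H Γ}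

/-- `p` expresses the volume of the polytopes obtained from `P` by moving slightly the facets of
`P` as a polynomial in the support numbers. -/
def IsVolumePolynomial {d : ℕ} (P : Set (Fin d → ℝ)) (ξ : Facet P → (Fin d → ℝ))
    (p : MvPolynomial (Facet P) ℝ) : Prop :=
  ∀ᶠ H in 𝓝 (supportNumber P ξ), (volume (movedPolytope P ξ H)).toReal = MvPolynomial.eval H p

open Classical in
/-- The volume polynomial (`0` if there were no such polynomial). -/
def volumePolynomial {d : ℕ} (P : Set (Fin d → ℝ)) (ξ : Facet P → (Fin d → ℝ)) :
    MvPolynomial (Facet P) ℝ :=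
  if h : ∃ p, IsVolumePolynomial P ξ p then h.choose else 0

/-- The linear operator `∂ / ∂ X i` on polynomials. -/
abbrev partialOp (σ : Type) (i : σ) : Module.End ℝ (MvPolynomial σ ℝ) :=
  (MvPolynomial.pderiv i : Derivation ℝ (MvPolynomial σ ℝ) (MvPolynomial σ ℝ)).toLinearMap

theorem partialOp_comm (σ : Type) (i j : σ) :
    partialOp σ i * partialOp σ j = partialOp σ j * partialOp σ i := by
  classical
  have h : ⁅(MvPolynomial.pderiv i : Derivation ℝ (MvPolynomial σ ℝ) (MvPolynomial σ ℝ)),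
      (MvPolynomial.pderiv j : Derivation ℝ (MvPolynomial σ ℝ) (MvPolynomial σ ℝ))⁆ = 0 := by
    apply MvPolynomial.derivation_ext
    intro k
    simp only [Derivation.commutator_apply, MvPolynomial.pderiv_X, Pi.single_apply]
    split_ifs <;> simp
  refine LinearMap.ext fun p => ?_
  have h' := congrArg (fun D : Derivation ℝ (MvPolynomial σ ℝ) (MvPolynomial σ ℝ) => D p) h
  simp only [Derivation.commutator_apply, Derivation.coe_zero, Pi.zero_apply] at h'
  exact sub_eq_zero.1 h'

/-- The action of polynomials in the symbols `∂_i` on polynomials as differential operators with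
constant coefficients: the algebra homomorphism that takes the variable `X i` to `∂ / ∂ X i`. -/
def diffOp (σ : Type) : MvPolynomial σ ℝ →ₐ[ℝ] Module.End ℝ (MvPolynomial σ ℝ) :=
  letI : CommSemiring (Algebra.adjoin ℝ (Set.range (partialOp σ))) :=
    { (Algebra.adjoin ℝ (Set.range (partialOp σ))).toSemiring with
      mul_comm := by
        have := Algebra.isMulCommutative_adjoin ℝ (s := Set.range (partialOp σ)) (by
          rintro _ ⟨i, rfl⟩ _ ⟨j, rfl⟩
          exact partialOp_comm σ i j)
        exact fun a b => this.is_comm.comm a b }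
  (Algebra.adjoin ℝ (Set.range (partialOp σ))).val.comp
    (MvPolynomial.aeval fun i => ⟨partialOp σ i, Algebra.subset_adjoin ⟨i, rfl⟩⟩)

theorem diffOp_X (σ : Type) (i : σ) (p : MvPolynomial σ ℝ) :
    diffOp σ (MvPolynomial.X i) p = MvPolynomial.pderiv i p := by
  simp [diffOp]

/-- The ideal of differential operators that annihilate the volume polynomial of `P`. -/
def annVol {d : ℕ} (P : Set (Fin d → ℝ)) (ξ : Facet P → (Fin d → ℝ)) :
    Ideal (MvPolynomial (Facet P) ℝ) where
  carrier := {α | diffOp (Facet P) α (volumePolynomial P ξ) = 0}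
  add_mem' := by
    intro a b ha hb
    simp only [Set.mem_ofPred_eq] at ha hb ⊢
    simp [ha, hb]
  zero_mem' := by simp
  smul_mem' := by
    intro a b hb
    simp only [Set.mem_ofPred_eq] at hb ⊢
    simp [hb]

/-- The algebra `A(P) = Diff / J`. -/
abbrev DiffAlg {d : ℕ} (P : Set (Fin d → ℝ)) (ξ : Facet P → (Fin d → ℝ)) : Type :=
  MvPolynomial (Facet P) ℝ ⧸ annVol P ξ

/-- The class of `∂_Γ` in `A(P)`. -/
def partialClass {d : ℕ} (P : Set (Fin d → ℝ)) (ξ : Facet P → (Fin d → ℝ)) (Γ : Facet P) :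
    DiffAlg P ξ :=
  Ideal.Quotient.mk (annVol P ξ) (MvPolynomial.X Γ)

/-- The homogeneous component `A^k(P)`. -/
def diffAlgDeg {d : ℕ} (P : Set (Fin d → ℝ)) (ξ : Facet P → (Fin d → ℝ)) (k : ℕ) :
    Submodule ℝ (DiffAlg P ξ) :=
  (MvPolynomial.homogeneousSubmodule (Facet P) ℝ k).map
    (Ideal.Quotient.mkₐ ℝ (annVol P ξ)).toLinearMap

/-- The subspace `I^k` of `A^k(Σ)` spanned by all `∂_Γ α` with `Γ` an inserted facet and
`α ∈ A^{k-1}(Σ)`; it is `0` for `k = 0`. -/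
def insertedDeg {d : ℕ} (Δ : Set (Fin d → ℝ)) (n : (Fin d → ℝ) → (Fin d → ℝ))
    (c : (Fin d → ℝ) → ℝ) (ξ : Facet (resolution Δ n c) → (Fin d → ℝ)) (k : ℕ) :
    Submodule ℝ (DiffAlg (resolution Δ n c) ξ) :=
  Submodule.span ℝ {β | ∃ Γ, IsInserted Δ n c Γ ∧ ∃ j, j + 1 = k ∧
    ∃ α ∈ diffAlgDeg (resolution Δ n c) ξ j, β = partialClass (resolution Δ n c) ξ Γ * α}

/-! ### Dual fans and piecewise polynomial functions -/

/-- The normal cone of the face `F` of `P`: the functionals that achieve their maximum on `P` at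
all points of `F`. -/
def normalCone {d : ℕ} (P F : Set (Fin d → ℝ)) : Set (Fin d → ℝ) := {ξ | F ⊆ maxFace P ξ}

/-- The dual fan of `P`, as the collection of its cones. -/
def dualFan {d : ℕ} (P : Set (Fin d → ℝ)) : Set (Set (Fin d → ℝ)) :=
  {C | ∃ F, IsFace P F ∧ C = normalCone P F}

/-- The `(d-1)`-skeleton of a collection of cones: its cones of dimension at most `d - 1`. -/
def skeleton {d : ℕ} (Φ : Set (Set (Fin d → ℝ))) : Set (Set (Fin d → ℝ)) :=
  {C ∈ Φ | Module.finrank ℝ (Submodule.span ℝ C) < d}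

/-- `f` agrees on each cone of `Φ` with a homogeneous polynomial of degree `k`. -/
def IsPiecewiseHomogeneous {d : ℕ} (Φ : Set (Set (Fin d → ℝ))) (k : ℕ) (f : ⋃₀ Φ → ℝ) : Prop :=
  ∀ C ∈ Φ, ∃ p : MvPolynomial (Fin d) ℝ, p.IsHomogeneous k ∧
    ∀ x : ⋃₀ Φ, (x : Fin d → ℝ) ∈ C → f x = MvPolynomial.eval (x : Fin d → ℝ) p

/-- The algebra `O_Φ` of continuous functions on the union of the cones of `Φ` that are polynomial
on each cone of `Φ`. -/
def PP {d : ℕ} (Φ : Set (Set (Fin d → ℝ))) : Subalgebra ℝ (⋃₀ Φ → ℝ) where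
  carrier := {f | Continuous f ∧ ∀ C ∈ Φ, ∃ p : MvPolynomial (Fin d) ℝ,
    ∀ x : ⋃₀ Φ, (x : Fin d → ℝ) ∈ C → f x = MvPolynomial.eval (x : Fin d → ℝ) p}
  mul_mem' := by
    rintro f g ⟨hf, hf'⟩ ⟨hg, hg'⟩
    refine ⟨hf.mul hg, fun C hC => ?_⟩
    obtain ⟨p, hp⟩ := hf' C hC
    obtain ⟨q, hq⟩ := hg' C hC
    exact ⟨p * q, fun x hx => by simp [hp x hx, hq x hx]⟩
  add_mem' := by
    rintro f g ⟨hf, hf'⟩ ⟨hg, hg'⟩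
    refine ⟨hf.add hg, fun C hC => ?_⟩
    obtain ⟨p, hp⟩ := hf' C hC
    obtain ⟨q, hq⟩ := hg' C hC
    exact ⟨p + q, fun x hx => by simp [hp x hx, hq x hx]⟩
  algebraMap_mem' := by
    intro r
    exact ⟨continuous_const, fun C _ => ⟨MvPolynomial.C r, fun x _ => by simp⟩⟩

/-- The ideal `O_Φ^+` of `O_Φ` generated by the global linear functions. -/
def plusIdeal {d : ℕ} (Φ : Set (Set (Fin d → ℝ))) : Ideal (PP Φ) :=
  Ideal.span {f | ∃ a : Fin d → ℝ, ∀ x : ⋃₀ Φ, (f : ⋃₀ Φ → ℝ) x = a ⬝ᵥ (x : Fin d → ℝ)}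

/-- The quotient `O_Φ / O_Φ^+`. -/
abbrev PPbar {d : ℕ} (Φ : Set (Set (Fin d → ℝ))) : Type := PP Φ ⧸ plusIdeal Φ

/-- The degree `k` component of `O_Φ / O_Φ^+`. -/
def ppbarDeg {d : ℕ} (Φ : Set (Set (Fin d → ℝ))) (k : ℕ) : Submodule ℝ (PPbar Φ) :=
  Submodule.map (Ideal.Quotient.mkₐ ℝ (plusIdeal Φ)).toLinearMap
    { carrier := {f : PP Φ | IsPiecewiseHomogeneous Φ k (f : ⋃₀ Φ → ℝ)}
      add_mem' := by
        intro f g hf hg C hC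
        obtain ⟨p, hp, hp'⟩ := hf C hC
        obtain ⟨q, hq, hq'⟩ := hg C hC
        exact ⟨p + q, hp.add hq, fun x hx => by simp [hp' x hx, hq' x hx]⟩
      zero_mem' := fun C _ => ⟨0, MvPolynomial.isHomogeneous_zero _ _ _, fun x _ => by simp⟩
      smul_mem' := by
        intro r f hf C hC
        obtain ⟨p, hp, hp'⟩ := hf C hC
        exact ⟨r • p, (MvPolynomial.homogeneousSubmodule (Fin d) ℝ k).smul_mem r hp,
          fun x hx => by simp [hp' x hx]⟩ }

/-- The restriction `O_Ψ → O_Υ` to a subfan. -/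
def restrict {d : ℕ} {Υ Ψ : Set (Set (Fin d → ℝ))} (h : Υ ⊆ Ψ) : PP Ψ →ₐ[ℝ] PP Υ where
  toFun f := ⟨fun x => (f : ⋃₀ Ψ → ℝ) ⟨x, Set.sUnion_subset_sUnion h x.2⟩, by
    refine ⟨f.2.1.comp (by fun_prop), fun C hC => ?_⟩
    obtain ⟨p, hp⟩ := f.2.2 C (h hC)
    exact ⟨p, fun x hx => hp _ hx⟩⟩
  map_one' := rfl
  map_mul' _ _ := rfl
  map_zero' := rfl
  map_add' _ _ := rfl
  commutes' _ := rfl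

theorem plusIdeal_le_comap {d : ℕ} {Υ Ψ : Set (Set (Fin d → ℝ))} (h : Υ ⊆ Ψ) :
    plusIdeal Ψ ≤ (plusIdeal Υ).comap (restrict h) := by
  refine Ideal.span_le.2 ?_
  rintro f ⟨a, ha⟩
  exact Ideal.subset_span ⟨a, fun x => ha _⟩

/-- The restriction homomorphism `O_Ψ / O_Ψ^+ → O_Υ / O_Υ^+`. -/
def restrictBar {d : ℕ} {Υ Ψ : Set (Set (Fin d → ℝ))} (h : Υ ⊆ Ψ) : PPbar Ψ →ₐ[ℝ] PPbar Υ :=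
  Ideal.quotientMapₐ (plusIdeal Υ) (restrict h) (plusIdeal_le_comap h)

/-- The degree `k` component of the kernel of the restriction homomorphism. -/
def kerDeg {d : ℕ} {Υ Ψ : Set (Set (Fin d → ℝ))} (h : Υ ⊆ Ψ) (k : ℕ) : Submodule ℝ (PPbar Ψ) :=
  LinearMap.ker (restrictBar h).toLinearMap ⊓ ppbarDeg Ψ k

/-! ### The identification -/

/-- `χ` is the characteristic function of the ray of the dual fan of `P` that is spanned by `ξ Γ`:
it is piecewise linear, equal to `1` at `ξ Γ`, and zero on all other rays. -/
def IsCharFun {d : ℕ} (P : Set (Fin d → ℝ)) (ξ : Facet P → (Fin d → ℝ)) (Γ : Facet P)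
    (χ : PP (dualFan P)) : Prop :=
  IsPiecewiseHomogeneous (dualFan P) 1 (χ : ⋃₀ dualFan P → ℝ) ∧
  ∀ x : ⋃₀ dualFan P,
    ((x : Fin d → ℝ) = ξ Γ → (χ : ⋃₀ dualFan P → ℝ) x = 1) ∧
    ∀ Γ' : Facet P, Γ' ≠ Γ → (x : Fin d → ℝ) = ξ Γ' → (χ : ⋃₀ dualFan P → ℝ) x = 0

/-- The algebra isomorphism `φ` takes the class of the characteristic function of the normal ray
of each facet `Γ` to `∂_Γ`. -/
def IsNatural {d : ℕ} (P : Set (Fin d → ℝ)) (ξ : Facet P → (Fin d → ℝ))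
    (φ : PPbar (dualFan P) ≃ₐ[ℝ] DiffAlg P ξ) : Prop :=
  ∀ Γ : Facet P, ∃ χ : PP (dualFan P), IsCharFun P ξ Γ χ ∧
    φ (Ideal.Quotient.mk (plusIdeal (dualFan P)) χ) = partialClass P ξ Γ

end EdgeSimple

end

/-!
The resolution `Σ` of `Δ` is a simple polytope: a vertex of `Σ` in a cutting hyperplane lies on an
edge of `Δ`, which is contained in exactly `d - 1` facets (`isSimplePolytope_resolution`). For a
simple polytope `P`, both algebras in question are quotients of the polynomial ring `ℝ[X_Γ]`, with
one variable per facet, by the same ideal: the Stanley–Reisner ideal `srIdeal` of polynomials that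
vanish on all coordinate subspaces of the maximal cones, plus the ideal `linIdeal` of global linear
functions. The combinatorics of `P` enters only through the structure `SimpleData`.

* Piecewise polynomial functions on a simplicial fan are polynomials in the characteristic functions
  of the rays (`IsSubfan.toPP_surjective`), since compatible polynomials on coordinate subspaces
  glue monomial by monomial (`exists_face_eq`). A polynomial is zero on the fan if and only if it is
  zero on the coordinate subspaces of the cones (`IsSubfan.toPP_eq_zero_iff`).
* For a generic functional `η`, the indicator function of a simple polytope is an alternating sum of
  indicator functions of cones with apices at the vertices, in which `η` decreases
  (`sum_prod_eq_indicator`). Cutting the cones off at a low level of `η` yields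
  `Vol(H) = ∑ weight_v * (η(v(H)) + t) ^ d`, a sum over the vertices `v` (`volume_body`). The term
  of `v` depends only on the support numbers of the facets at `v`; hence the Stanley–Reisner ideal
  annihilates the volume, and the product of `∂_Γ` over the facets at a vertex takes it to a nonzero
  constant. Linear functions annihilate it by translation invariance.
* There are no other relations (`eq_sup_of_prod_notMem`). For each vertex `v`, consider the product
  of the variables over the facets left by the `η`-descending edges at `v`. These products span
  the quotient by `srIdeal ⊔ linIdeal`, by induction along the order of the vertices given by `η`.
  The pairing with the products for `-η` is triangular with nonzero diagonal entries, because the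
  two products of the same vertex multiply to the product over a maximal cone, which does not
  annihilate the volume.

The cones of dimension less than `d` of the dual fan of `Δ` are the cones of the dual fan of `Σ`
that have dimension less than `d` and contain no rays of inserted facets (`mem_skeleton_iff`).
Therefore a homogeneous polynomial of degree `k` is zero on them modulo linear functions if and
only if it is, modulo linear functions, a combination of monomials of degree `k` of three kinds:
divisible by an inserted variable, or supported on no cone, or containing all variables of a
maximal cone and no others. The first represent elements of `I^k`, and the second are in the
Stanley–Reisner ideal. The third occur only for `k ≥ d`. They are zero in the quotient for `k >
d`, and for `k = d` they are proportional to a product over a maximal cone with an inserted ray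
(`exists_prod_sub_mem`), if there is a nonsimple vertex.
-/

namespace EdgeSimple

variable {d : ℕ}

/-! ### Faces of polytopes -/

theorem continuous_dot (ξ : Fin d → ℝ) : Continuous fun x : Fin d → ℝ => ξ ⬝ᵥ x :=
  Continuous.dotProduct continuous_const continuous_id

/-- The coordinate vector `ξ` as a continuous linear functional. -/
noncomputable def dotL (ξ : Fin d → ℝ) : (Fin d → ℝ) →L[ℝ] ℝ :=
  ⟨{ toFun := fun x => ξ ⬝ᵥ x
     map_add' := fun x y => dotProduct_add ξ x y
     map_smul' := fun r x => dotProduct_smul r ξ x }, continuous_dot ξ⟩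

theorem dotL_apply (ξ x : Fin d → ℝ) : dotL ξ x = ξ ⬝ᵥ x := rfl

theorem exists_dot (f : (Fin d → ℝ) →ₗ[ℝ] ℝ) : ∃ ξ : Fin d → ℝ, ∀ x, f x = ξ ⬝ᵥ x := by
  refine ⟨fun i => f (Pi.single i 1), fun x => ?_⟩
  conv_lhs => rw [← Finset.univ_sum_single x]
  rw [map_sum, dotProduct]
  refine Finset.sum_congr rfl fun i _ => ?_
  rw [mul_comm, ← smul_eq_mul, ← map_smul, ← Pi.single_smul, smul_eq_mul, mul_one]

/-- A subspace on which no nonzero functional vanishes is the whole space. -/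
theorem eq_top_of_dot {W : Submodule ℝ (Fin d → ℝ)}
    (h : ∀ u : Fin d → ℝ, (∀ w ∈ W, u ⬝ᵥ w = 0) → u = 0) : W = ⊤ := by
  by_contra hW
  obtain ⟨f, hf, hWf⟩ := Submodule.exists_le_ker_of_lt_top W (lt_top_iff_ne_top.2 hW)
  obtain ⟨u, hu⟩ := exists_dot f
  apply hf
  have hu0 := h u fun w hw => by rw [← hu]; exact hWf hw
  ext x
  simp [hu, hu0]

theorem IsDPolytope.isCompact {P : Set (Fin d → ℝ)} (hP : IsDPolytope P) : IsCompact P := by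
  obtain ⟨⟨s, hs, rfl⟩, -⟩ := hP
  exact hs.isCompact_convexHull ℝ

theorem IsDPolytope.convex {P : Set (Fin d → ℝ)} (hP : IsDPolytope P) : Convex ℝ P := by
  obtain ⟨⟨s, hs, rfl⟩, -⟩ := hP
  exact convex_convexHull ℝ s

theorem IsDPolytope.nonempty {P : Set (Fin d → ℝ)} (hP : IsDPolytope P) : P.Nonempty :=
  hP.2.mono interior_subset

theorem maxFace_nonempty {P : Set (Fin d → ℝ)} (hP : IsCompact P) (hne : P.Nonempty)
    (ξ : Fin d → ℝ) : (maxFace P ξ).Nonempty := by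
  obtain ⟨x, hx, h⟩ := hP.exists_isMaxOn hne (continuous_dot ξ).continuousOn
  exact ⟨x, hx, fun y hy => h hy⟩

theorem isExposed_maxFace (P : Set (Fin d → ℝ)) (ξ : Fin d → ℝ) : IsExposed ℝ P (maxFace P ξ) :=
  fun _ => ⟨dotL ξ, rfl⟩

theorem IsFace.subset {P F : Set (Fin d → ℝ)} (hF : IsFace P F) : F ⊆ P := by
  obtain ⟨-, ξ, rfl⟩ := hF
  exact fun x hx => hx.1

theorem isFace_finite {P : Set (Fin d → ℝ)} (hP : IsDPolytope P) : {F | IsFace P F}.Finite := by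
  obtain ⟨⟨s, hs, hPs⟩, -⟩ := id hP
  refine Set.Finite.of_finite_image (f := fun F => F ∩ s)
    (hs.finite_subsets.subset ?_) ?_
  · rintro _ ⟨F, -, rfl⟩
    exact Set.inter_subset_right
  -- a face is the closed convex hull of the points of `s` in it
  have key : ∀ F G : Set (Fin d → ℝ), IsFace P F → IsFace P G → F ∩ s = G ∩ s → F ⊆ G := by
    rintro _ _ ⟨-, ξ, rfl⟩ ⟨-, ζ, rfl⟩ h
    have hc : IsCompact (maxFace P ξ) := (isExposed_maxFace P ξ).isCompact hP.isCompact
    have hv : Convex ℝ (maxFace P ξ) := (isExposed_maxFace P ξ).convex hP.convex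
    have hG : IsClosed (maxFace P ζ) :=
      ((isExposed_maxFace P ζ).isCompact hP.isCompact).isClosed
    rw [← closure_convexHull_extremePoints hc hv]
    refine closure_minimal (convexHull_min ?_ ((isExposed_maxFace P ζ).convex hP.convex)) hG
    intro x hx
    have hxP : x ∈ P.extremePoints ℝ :=
      (isExposed_maxFace P ξ).isExtreme.extremePoints_subset_extremePoints hx
    rw [hPs] at hxP
    have : x ∈ maxFace P ζ ∩ s := h ▸ ⟨extremePoints_subset hx, extremePoints_convexHull_subset hxP⟩
    exact this.1
  intro F hF G hG h
  exact (key F G hF hG h).antisymm (key G F hG hF h.symm)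

theorem finite_facet {P : Set (Fin d → ℝ)} (hP : IsDPolytope P) : Finite (Facet P) :=
  (isFace_finite hP).subset fun _ hF => hF.1

theorem vectorSpan_eq_top {P : Set (Fin d → ℝ)} (hP : (interior P).Nonempty) :
    vectorSpan ℝ P = ⊤ := by
  have h := IsOpen.affineSpan_eq_top (isOpen_interior (s := P)) hP
  have h2 : affineSpan ℝ P = ⊤ := top_unique (h ▸ affineSpan_mono ℝ interior_subset)
  rw [← direction_affineSpan, h2, AffineSubspace.direction_top]

theorem dot_eq_zero_of_mem_vectorSpan {F : Set (Fin d → ℝ)} {ξ : Fin d → ℝ} {r : ℝ}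
    (h : ∀ x ∈ F, ξ ⬝ᵥ x = r) {w : Fin d → ℝ} (hw : w ∈ vectorSpan ℝ F) : ξ ⬝ᵥ w = 0 := by
  have : vectorSpan ℝ F ≤ LinearMap.ker (dotL ξ).toLinearMap := by
    rw [vectorSpan, Submodule.span_le]
    rintro _ ⟨x, hx, y, hy, rfl⟩
    simp [dotL_apply, h x hx, h y hy]
  exact this hw

theorem IsFacet.ne_zero {P : Set (Fin d → ℝ)} (hP : IsDPolytope P) {ξ : Fin d → ℝ}
    (hF : IsFacet P (maxFace P ξ)) : ξ ≠ 0 := by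
  rintro rfl
  have : maxFace P (0 : Fin d → ℝ) = P := by ext; simp [maxFace]
  have h := hF.2
  rw [this, affDim, vectorSpan_eq_top hP.2, finrank_top, Module.finrank_fin_fun] at h
  omega

theorem maxFace_const {P : Set (Fin d → ℝ)} {ξ x y : Fin d → ℝ} (hx : x ∈ maxFace P ξ)
    (hy : y ∈ maxFace P ξ) : ξ ⬝ᵥ x = ξ ⬝ᵥ y :=
  le_antisymm (hy.2 x hx.1) (hx.2 y hy.1)

/-- Functionals that define the same facet are positively proportional. -/
theorem IsFacet.exists_smul_eq {P : Set (Fin d → ℝ)} (hP : IsDPolytope P) {ξ ζ : Fin d → ℝ}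
    (hF : IsFacet P (maxFace P ξ)) (h : maxFace P ξ = maxFace P ζ) :
    ∃ l : ℝ, 0 < l ∧ ζ = l • ξ := by
  have hζ : IsFacet P (maxFace P ζ) := h ▸ hF
  obtain ⟨f, hf⟩ := hF.1.1
  have hfζ : f ∈ maxFace P ζ := h ▸ hf
  set W := vectorSpan ℝ (maxFace P ξ) with hW
  have hWξ : ∀ w ∈ W, ξ ⬝ᵥ w = 0 := fun w hw =>
    dot_eq_zero_of_mem_vectorSpan (fun x hx => maxFace_const hx hf) hw
  have hWζ : ∀ w ∈ W, ζ ⬝ᵥ w = 0 := fun w hw =>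
    dot_eq_zero_of_mem_vectorSpan (fun x hx => maxFace_const (h ▸ hx) hfζ) hw
  have hξξ : 0 < ξ ⬝ᵥ ξ := by
    have := mt dotProduct_self_eq_zero.1 (IsFacet.ne_zero hP hF)
    exact lt_of_le_of_ne (Finset.sum_nonneg fun i _ => mul_self_nonneg _) (Ne.symm this)
  have hlt : W < W ⊔ Submodule.span ℝ {ξ} := by
    refine lt_of_le_of_ne le_sup_left fun heq => ?_
    have : ξ ∈ W := heq ▸ Submodule.mem_sup_right (Submodule.mem_span_singleton_self ξ)
    exact hξξ.ne' (hWξ ξ this)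
  have htop : W ⊔ Submodule.span ℝ {ξ} = ⊤ := by
    apply Submodule.eq_top_of_finrank_eq
    have h1 := Submodule.finrank_lt_finrank_of_lt hlt
    have h2 := Submodule.finrank_le (W ⊔ Submodule.span ℝ {ξ})
    have h3 : Module.finrank ℝ W + 1 = d := hF.2
    rw [Module.finrank_fin_fun] at h2 ⊢
    omega
  have hprop : ζ = ((ζ ⬝ᵥ ξ) / (ξ ⬝ᵥ ξ)) • ξ := by
    rw [← sub_eq_zero, ← dotProduct_self_eq_zero]
    set u := ζ - ((ζ ⬝ᵥ ξ) / (ξ ⬝ᵥ ξ)) • ξ with hu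
    have : W ⊔ Submodule.span ℝ {ξ} ≤ LinearMap.ker (dotL u).toLinearMap := by
      refine sup_le (fun w hw => ?_) ?_
      · simp [dotL_apply, hu, sub_dotProduct, smul_dotProduct, hWξ w hw, hWζ w hw]
      · rw [Submodule.span_singleton_le_iff_mem]
        simp only [LinearMap.mem_ker, ContinuousLinearMap.coe_coe, dotL_apply, hu, sub_dotProduct,
          smul_dotProduct, smul_eq_mul]
        rw [div_mul_cancel₀ _ hξξ.ne', sub_self]
    rw [htop] at this
    exact this (Submodule.mem_top (x := u))
  refine ⟨_, ?_, hprop⟩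
  set l := (ζ ⬝ᵥ ξ) / (ξ ⬝ᵥ ξ)
  obtain ⟨y, hy, hyF⟩ : ∃ y ∈ P, y ∉ maxFace P ξ := by
    by_contra hcon
    push Not at hcon
    have hPF : maxFace P ξ = P := Set.Subset.antisymm (fun x hx => hx.1) hcon
    have h3 := hF.2
    rw [hPF, affDim, vectorSpan_eq_top hP.2, finrank_top, Module.finrank_fin_fun] at h3
    omega
  have h1 : ξ ⬝ᵥ y < ξ ⬝ᵥ f := by
    by_contra hcon
    exact hyF ⟨hy, fun z hz => (hf.2 z hz).trans (not_lt.1 hcon)⟩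
  have h2 : ζ ⬝ᵥ y < ζ ⬝ᵥ f := by
    by_contra hcon
    exact hyF (h ▸ ⟨hy, fun z hz => (hfζ.2 z hz).trans (not_lt.1 hcon)⟩)
  rw [hprop, smul_dotProduct, smul_dotProduct, smul_eq_mul, smul_eq_mul] at h2
  by_contra hl
  have := mul_le_mul_of_nonpos_left h1.le (not_lt.1 hl)
  linarith

/-! ### Polyhedra given by finitely many inequalities -/

section HPoly

variable {J : Type}

/-- The solution set of the inequalities `a j ⬝ᵥ x ≤ b j`. -/
def hpoly (a : J → Fin d → ℝ) (b : J → ℝ) : Set (Fin d → ℝ) := {x | ∀ j, a j ⬝ᵥ x ≤ b j}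

/-- The functionals `a j` of the inequalities that are equalities at `p` span the dual space. -/
def Pinned (a : J → Fin d → ℝ) (b : J → ℝ) (p : Fin d → ℝ) : Prop :=
  ∀ u : Fin d → ℝ, (∀ j, a j ⬝ᵥ p = b j → a j ⬝ᵥ u = 0) → u = 0

variable {a : J → Fin d → ℝ} {b : J → ℝ}

theorem isClosed_hpoly : IsClosed (hpoly a b) := by
  simp only [hpoly, Set.ofPred_forall]
  exact isClosed_iInter fun j => isClosed_le (continuous_dot _) continuous_const

theorem convex_hpoly : Convex ℝ (hpoly a b) := by
  simp only [hpoly, Set.ofPred_forall]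
  exact convex_iInter fun j => convex_halfSpace_le (dotL (a j)).toLinearMap.isLinear _

theorem eventually_mem_hpoly [Finite J] {p u : Fin d → ℝ} (hp : p ∈ hpoly a b)
    (hu : ∀ j, a j ⬝ᵥ p = b j → a j ⬝ᵥ u ≤ 0) : ∀ᶠ t in 𝓝[>] (0 : ℝ), p + t • u ∈ hpoly a b := by
  simp only [hpoly, Set.mem_ofPred_eq]
  rw [eventually_all]
  intro j
  by_cases hj : a j ⬝ᵥ p = b j
  · filter_upwards [self_mem_nhdsWithin] with t ht
    rw [dotProduct_add, dotProduct_smul, smul_eq_mul, hj]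
    have := mul_nonpos_of_nonneg_of_nonpos (le_of_lt (show (0:ℝ) < t from ht)) (hu j hj)
    linarith
  · have hlt : a j ⬝ᵥ p < b j := lt_of_le_of_ne (hp j) hj
    have hc : ContinuousAt (fun t : ℝ => a j ⬝ᵥ (p + t • u)) 0 := by
      have : Continuous fun t : ℝ => p + t • u := by fun_prop
      exact ((continuous_dot (a j)).comp this).continuousAt
    have := hc.eventually_lt (continuousAt_const (y := b j)) (by simpa using hlt)
    exact (this.filter_mono nhdsWithin_le_nhds).mono fun t ht => ht.le

theorem exists_pos_mem_hpoly [Finite J] {p u : Fin d → ℝ} (hp : p ∈ hpoly a b)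
    (hu : ∀ j, a j ⬝ᵥ p = b j → a j ⬝ᵥ u ≤ 0) : ∃ t : ℝ, 0 < t ∧ p + t • u ∈ hpoly a b := by
  obtain ⟨t, h1, h2⟩ := ((eventually_mem_hpoly hp hu).and self_mem_nhdsWithin).exists
  exact ⟨t, h2, h1⟩

theorem exists_pos_mem_hpoly_both [Finite J] {p u : Fin d → ℝ} (hp : p ∈ hpoly a b)
    (hu : ∀ j, a j ⬝ᵥ p = b j → a j ⬝ᵥ u = 0) :
    ∃ t : ℝ, 0 < t ∧ p + t • u ∈ hpoly a b ∧ p + t • (-u) ∈ hpoly a b := by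
  obtain ⟨t, ⟨h1, h2⟩, h3⟩ := (((eventually_mem_hpoly hp fun j hj => (hu j hj).le).and
    (eventually_mem_hpoly (u := -u) hp fun j hj => by
      rw [dotProduct_neg, hu j hj, neg_zero])).and self_mem_nhdsWithin).exists
  exact ⟨t, h3, h1, h2⟩

/-- Otherwise, one could move from the extreme point in both directions of a line. -/
theorem pinned_of_extreme [Finite J] {p : Fin d → ℝ} (hp : p ∈ (hpoly a b).extremePoints ℝ) :
    Pinned a b p := by
  intro u hu
  obtain ⟨t, ht, h1, h2⟩ := exists_pos_mem_hpoly_both hp.1 hu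
  have := hp.2 h1 h2 ⟨1 / 2, 1 / 2, by norm_num, by norm_num, by norm_num, by module⟩
  simpa [ht.ne'] using this

theorem Pinned.eq_of_forall {p q : Fin d → ℝ} (hp : Pinned a b p)
    (h : ∀ j, a j ⬝ᵥ p = b j → a j ⬝ᵥ q = b j) : q = p := by
  have := hp (q - p) fun j hj => by rw [dotProduct_sub, hj, h j hj, sub_self]
  exact sub_eq_zero.1 this

theorem finite_pinned [Finite J] : {p | Pinned a b p}.Finite := by
  refine Set.Finite.of_finite_image (f := fun p => {j | a j ⬝ᵥ p = b j}) (Set.toFinite _) ?_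
  intro p hp q _ h
  refine (hp.eq_of_forall fun j hj => ?_).symm
  exact (Set.ext_iff.1 h j).1 hj

theorem pinned_of_isVertex [Finite J] {p : Fin d → ℝ} (hp : IsVertex (hpoly a b) p) :
    Pinned a b p := by
  intro u hu
  obtain ⟨-, ζ, hζ⟩ := hp
  have hpm : p ∈ maxFace (hpoly a b) ζ := hζ ▸ Set.mem_singleton p
  obtain ⟨t, ht, h1, h2⟩ := exists_pos_mem_hpoly_both hpm.1 hu
  have h3 := hpm.2 _ h2
  have h4 : p + t • u ∈ maxFace (hpoly a b) ζ := by
    refine ⟨h1, fun y hy => (hpm.2 y hy).trans ?_⟩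
    simp only [dotProduct_add, dotProduct_smul, dotProduct_neg, smul_eq_mul] at h3 ⊢
    nlinarith
  rw [← hζ, Set.mem_singleton_iff] at h4
  simpa [ht.ne'] using h4

/-- The face where all inequalities from a finite set are equalities. -/
theorem maxFace_sum_eq (A : Finset J) {p : Fin d → ℝ} (hp : p ∈ hpoly a b)
    (hA : ∀ j ∈ A, a j ⬝ᵥ p = b j) :
    maxFace (hpoly a b) (∑ j ∈ A, a j) = {x ∈ hpoly a b | ∀ j ∈ A, a j ⬝ᵥ x = b j} := by
  have hle : ∀ x ∈ hpoly a b, (∑ j ∈ A, a j) ⬝ᵥ x ≤ ∑ j ∈ A, b j := fun x hx => by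
    rw [sum_dotProduct]; exact Finset.sum_le_sum fun j _ => hx j
  have heq : (∑ j ∈ A, a j) ⬝ᵥ p = ∑ j ∈ A, b j := by
    rw [sum_dotProduct]; exact Finset.sum_congr rfl hA
  ext x
  constructor
  · rintro ⟨hx, hmax⟩
    refine ⟨hx, ?_⟩
    have h1 : ∑ j ∈ A, a j ⬝ᵥ x = ∑ j ∈ A, b j := by
      rw [← sum_dotProduct]
      exact le_antisymm (hle x hx) (heq ▸ hmax p hp)
    exact (Finset.sum_eq_sum_iff_of_le fun j _ => hx j).1 h1
  · rintro ⟨hx, hx'⟩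
    refine ⟨hx, fun y hy => (hle y hy).trans ?_⟩
    rw [sum_dotProduct]
    exact (Finset.sum_congr rfl hx').ge

theorem isVertex_of_pinned [Finite J] {p : Fin d → ℝ} (hp : p ∈ hpoly a b) (hpin : Pinned a b p) :
    IsVertex (hpoly a b) p := by
  classical
  have := Fintype.ofFinite J
  refine ⟨Set.singleton_nonempty p, ∑ j with a j ⬝ᵥ p = b j, a j, ?_⟩
  rw [maxFace_sum_eq _ hp (fun j hj => (Finset.mem_filter.1 hj).2)]
  ext x
  constructor
  · rintro rfl
    exact ⟨hp, fun j hj => (Finset.mem_filter.1 hj).2⟩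
  · rintro ⟨-, hx⟩
    exact hpin.eq_of_forall fun j hj => hx j (Finset.mem_filter.2 ⟨Finset.mem_univ j, hj⟩)

/-- A functional attains its maximum on a face at a vertex. -/
theorem exists_vertex [Finite J] (hc : IsCompact (hpoly a b)) (hne : (hpoly a b).Nonempty)
    (ζ η : Fin d → ℝ) : ∃ v ∈ maxFace (hpoly a b) ζ, IsVertex (hpoly a b) v ∧
      ∀ x ∈ maxFace (hpoly a b) ζ, η ⬝ᵥ x ≤ η ⬝ᵥ v := by
  set G := maxFace (hpoly a b) ζ with hG
  have hGc : IsCompact G := (isExposed_maxFace _ ζ).isCompact hc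
  have hGne : G.Nonempty := maxFace_nonempty hc hne ζ
  have hG'c : IsCompact (maxFace G η) := (isExposed_maxFace _ η).isCompact hGc
  obtain ⟨v, hv⟩ := hG'c.extremePoints_nonempty (maxFace_nonempty hGc hGne η)
  have hv' : v ∈ maxFace G η := extremePoints_subset hv
  have hvext : v ∈ (hpoly a b).extremePoints ℝ :=
    (isExposed_maxFace _ ζ).isExtreme.extremePoints_subset_extremePoints
      ((isExposed_maxFace _ η).isExtreme.extremePoints_subset_extremePoints hv)
  exact ⟨v, hv'.1, isVertex_of_pinned hvext.1 (pinned_of_extreme hvext), hv'.2⟩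

theorem isDPolytope_hpoly [Finite J] (hc : IsCompact (hpoly a b))
    (hi : (interior (hpoly a b)).Nonempty) : IsDPolytope (hpoly a b) := by
  refine ⟨⟨(hpoly a b).extremePoints ℝ, ?_, ?_⟩, hi⟩
  · exact finite_pinned.subset fun p hp => pinned_of_extreme hp
  · conv_lhs => rw [← closure_convexHull_extremePoints hc convex_hpoly]
    have hfin : ((hpoly a b).extremePoints ℝ).Finite :=
      finite_pinned.subset fun p hp => pinned_of_extreme hp
    exact (hfin.isCompact_convexHull ℝ).isClosed.closure_eq

/-- At most `d` functionals that separate points form a basis; the vectors `u j` are its dual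
basis. -/
theorem exists_dual_basis [DecidableEq J] (a : J → Fin d → ℝ) (A : Finset J)
    (hpin : ∀ u : Fin d → ℝ, (∀ j ∈ A, a j ⬝ᵥ u = 0) → u = 0) (hA : A.card ≤ d) :
    A.card = d ∧ ∃ u : J → Fin d → ℝ, (∀ j ∉ A, u j = 0) ∧
      (∀ i ∈ A, ∀ j ∈ A, a i ⬝ᵥ u j = if i = j then 1 else 0) ∧
      ∀ ζ, ∑ j ∈ A, (u j ⬝ᵥ ζ) • a j = ζ := by
  let f : (Fin d → ℝ) →ₗ[ℝ] (A → ℝ) := LinearMap.pi fun j => (dotL (a j)).toLinearMap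
  have hf : ∀ x (j : A), f x j = a j ⬝ᵥ x := fun x j => rfl
  have hinj : Function.Injective f := by
    rw [← LinearMap.ker_eq_bot, LinearMap.ker_eq_bot']
    intro x hx
    exact hpin x fun j hj => by rw [← hf x ⟨j, hj⟩, hx]; rfl
  have hcard : A.card = d := by
    refine le_antisymm hA ?_
    have := LinearMap.finrank_le_finrank_of_injective hinj
    simpa using this
  have hfr : Module.finrank ℝ (Fin d → ℝ) = Module.finrank ℝ (A → ℝ) := by simp [hcard]
  let e := LinearEquiv.ofInjectiveOfFinrankEq f hinj hfr
  have he : ∀ x, e x = f x := fun x => rfl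
  let u : J → Fin d → ℝ := fun j => if h : j ∈ A then e.symm (Pi.single ⟨j, h⟩ 1) else 0
  have hu : ∀ i (hi : i ∈ A), ∀ j (hj : j ∈ A), a i ⬝ᵥ u j = if i = j then 1 else 0 := by
    intro i hi j hj
    rw [← hf (u j) ⟨i, hi⟩, ← he]
    simp only [u, dif_pos hj, LinearEquiv.apply_symm_apply, Pi.single_apply, Subtype.mk.injEq]
  refine ⟨hcard, u, fun j hj => dif_neg hj, hu, fun ζ => ?_⟩
  -- both functionals agree on the dual basis, hence everywhere
  rw [← sub_eq_zero]
  have hx : ∀ x : Fin d → ℝ, x = ∑ j ∈ A, (a j ⬝ᵥ x) • u j := by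
    intro x
    rw [← sub_eq_zero]
    refine hpin _ fun i hi => ?_
    rw [dotProduct_sub, dotProduct_sum, Finset.sum_eq_single_of_mem i hi]
    · rw [dotProduct_smul, hu i hi i hi]; simp
    · intro j hj hji
      rw [dotProduct_smul, hu i hi j hj, if_neg hji.symm, smul_zero]
  refine dotProduct_eq_zero _ fun x => ?_
  have h1 : (∑ j ∈ A, (u j ⬝ᵥ ζ) • a j) ⬝ᵥ x = ∑ j ∈ A, (u j ⬝ᵥ ζ) * (a j ⬝ᵥ x) := by
    rw [sum_dotProduct]
    exact Finset.sum_congr rfl fun j _ => by rw [smul_dotProduct, smul_eq_mul]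
  have h2 : ζ ⬝ᵥ x = ∑ j ∈ A, (u j ⬝ᵥ ζ) * (a j ⬝ᵥ x) := by
    conv_lhs => rw [hx x]
    rw [dotProduct_sum]
    exact Finset.sum_congr rfl fun j _ => by
      rw [dotProduct_smul, smul_eq_mul, dotProduct_comm ζ, mul_comm]
  rw [sub_dotProduct, h1, h2, sub_self]

end HPoly

/-! ### The facet inequalities of a polytope -/

/-- A polytope is the intersection of the half-spaces of its facets. The extreme points of the
polar body are facet functionals, and the polar body is the closed convex hull of them. -/
theorem IsDPolytope.mem_of_forall_facet {P : Set (Fin d → ℝ)} (hP : IsDPolytope P)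
    {x : Fin d → ℝ} (h : ∀ ξ, IsFacet P (maxFace P ξ) → ∀ y ∈ maxFace P ξ, ξ ⬝ᵥ x ≤ ξ ⬝ᵥ y) :
    x ∈ P := by
  by_contra hx
  obtain ⟨⟨s, hs, hPs⟩, p₀, hp₀⟩ := id hP
  have := hs.to_subtype
  let a : s → Fin d → ℝ := fun p => p - p₀
  let b : s → ℝ := fun _ => 1
  have hp₀P : p₀ ∈ P := interior_subset hp₀
  have hsP : ∀ p ∈ s, p ∈ P := fun p hp => hPs ▸ subset_convexHull ℝ s hp
  have hDP : ∀ ξ ∈ hpoly a b, ∀ y ∈ P, ξ ⬝ᵥ y ≤ 1 + ξ ⬝ᵥ p₀ := by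
    intro ξ hξ y hy
    have hsub : P ⊆ {y | dotL ξ y ≤ 1 + ξ ⬝ᵥ p₀} := by
      rw [hPs]
      refine convexHull_min (fun p hp => ?_) (convex_halfSpace_le (dotL ξ).toLinearMap.isLinear _)
      have := hξ ⟨p, hp⟩
      simp only [a, b, sub_dotProduct] at this
      rw [Set.mem_ofPred_eq, dotL_apply, dotProduct_comm, dotProduct_comm ξ p₀]
      linarith
    exact hsub hy
  have hbdd : Bornology.IsBounded (hpoly a b) := by
    obtain ⟨r, hr, hball⟩ := Metric.isOpen_iff.1 isOpen_interior p₀ hp₀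
    rw [isBounded_iff_forall_norm_le]
    refine ⟨(r / 2)⁻¹, fun ξ hξ => ?_⟩
    rw [pi_norm_le_iff_of_nonneg (by positivity)]
    intro k
    have hkey : ∀ σ : ℝ, |σ| = 1 → σ * ξ k ≤ (r / 2)⁻¹ := by
      intro σ hσ
      have hmem : p₀ + Pi.single k (σ * (r / 2)) ∈ P := by
        refine interior_subset (hball ?_)
        rw [Metric.mem_ball, dist_eq_norm, add_sub_cancel_left, Pi.norm_single, Real.norm_eq_abs,
          abs_mul, hσ, one_mul, abs_of_pos (by positivity)]
        linarith
      have := hDP ξ hξ _ hmem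
      rw [dotProduct_add, dotProduct_single] at this
      rw [← one_div, le_div_iff₀ (by positivity)]
      nlinarith
    rw [Real.norm_eq_abs, abs_le]
    constructor
    · have := hkey (-1) (by norm_num); linarith
    · have := hkey 1 (by norm_num); linarith
  have hcpt : IsCompact (hpoly a b) := Metric.isCompact_of_isClosed_isBounded isClosed_hpoly hbdd
  -- an extreme point of the polar body that separates `x`
  obtain ⟨ξ, hξ, hξx⟩ : ∃ ξ ∈ (hpoly a b).extremePoints ℝ, 1 < ξ ⬝ᵥ (x - p₀) := by
    by_contra hcon
    push Not at hcon
    have hsub : hpoly a b ⊆ {ξ | dotL (x - p₀) ξ ≤ 1} := by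
      rw [← closure_convexHull_extremePoints hcpt convex_hpoly]
      refine closure_minimal (convexHull_min (fun ξ hξ => ?_)
        (convex_halfSpace_le (dotL (x - p₀)).toLinearMap.isLinear _))
        (isClosed_le (dotL (x - p₀)).continuous continuous_const)
      rw [Set.mem_ofPred_eq, dotL_apply, dotProduct_comm]
      exact hcon ξ hξ
    obtain ⟨f, c, hf, hfx⟩ := geometric_hahn_banach_closed_point hP.convex hP.isCompact.isClosed hx
    obtain ⟨ζ, hζ⟩ := exists_dot f.toLinearMap
    have hζ' : ∀ y, f y = ζ ⬝ᵥ y := hζ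
    have hβ : 0 < c - ζ ⬝ᵥ p₀ := by have := hf p₀ hp₀P; rw [hζ'] at this; linarith
    have hmem : (c - ζ ⬝ᵥ p₀)⁻¹ • ζ ∈ hpoly a b := by
      intro p
      have := hf p (hsP p p.2)
      rw [hζ'] at this
      simp only [a, b, dotProduct_smul, smul_eq_mul]
      rw [inv_mul_le_iff₀ hβ, mul_one, dotProduct_comm, dotProduct_sub]
      linarith
    have h1 := hsub hmem
    rw [Set.mem_ofPred_eq, dotL_apply, dotProduct_smul, smul_eq_mul, inv_mul_le_iff₀ hβ, mul_one,
      dotProduct_comm, dotProduct_sub] at h1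
    rw [hζ'] at hfx
    linarith
  have hpin := pinned_of_extreme hξ
  have hξ0 : ξ ≠ 0 := by rintro rfl; simp at hξx; linarith
  have hact : ∀ p : s, a p ⬝ᵥ ξ = b p → (p : Fin d → ℝ) ∈ maxFace P ξ := by
    intro p hp
    refine ⟨hsP p p.2, fun y hy => (hDP ξ hξ.1 y hy).trans ?_⟩
    simp only [a, b, sub_dotProduct] at hp
    rw [dotProduct_comm ξ, dotProduct_comm ξ]
    linarith
  obtain ⟨p₁, hp₁⟩ : ∃ p : s, a p ⬝ᵥ ξ = b p := by
    by_contra hcon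
    push Not at hcon
    exact hξ0 (hpin ξ fun j hj => absurd hj (hcon j))
  have hp₁' := hp₁
  simp only [a, b, sub_dotProduct] at hp₁'
  have hfacet : IsFacet P (maxFace P ξ) := by
    refine ⟨⟨⟨_, hact p₁ hp₁⟩, ξ, rfl⟩, ?_⟩
    set W := vectorSpan ℝ (maxFace P ξ) with hW
    have hWξ : ∀ w ∈ W, ξ ⬝ᵥ w = 0 := fun w hw =>
      dot_eq_zero_of_mem_vectorSpan (fun x hx => maxFace_const hx (hact p₁ hp₁)) hw
    have hlt : W < ⊤ := by
      refine lt_top_iff_ne_top.2 fun htop => hξ0 ?_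
      exact dotProduct_eq_zero ξ fun w => hWξ w (htop ▸ Submodule.mem_top)
    have htop : W ⊔ Submodule.span ℝ {a p₁} = ⊤ := by
      refine eq_top_of_dot fun u hu => hpin u fun p hp => ?_
      have h1 := hu (a p₁) (Submodule.mem_sup_right (Submodule.mem_span_singleton_self _))
      have h2 := hu ((p : Fin d → ℝ) - p₁) (Submodule.mem_sup_left
        (vsub_mem_vectorSpan ℝ (hact p hp) (hact p₁ hp₁)))
      have h3 : a p = ((p : Fin d → ℝ) - p₁) + a p₁ := by simp [a]
      rw [dotProduct_comm, h3, dotProduct_add, h1, h2, add_zero]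
    have h1 := Submodule.finrank_lt_finrank_of_lt hlt
    have h2 := Submodule.finrank_add_le_finrank_add_finrank W (Submodule.span ℝ {a p₁})
    have ha : a p₁ ≠ 0 := fun h0 => by
      rw [h0, zero_dotProduct] at hp₁
      exact zero_ne_one hp₁
    have h3 := finrank_span_singleton (K := ℝ) ha
    rw [htop] at h2
    rw [finrank_top, Module.finrank_fin_fun] at h1 h2
    change Module.finrank ℝ W + 1 = d
    omega
  have := h ξ hfacet p₁ (hact p₁ hp₁)
  rw [dotProduct_sub] at hξx
  rw [dotProduct_comm ξ p₁] at this
  rw [dotProduct_comm ξ p₀] at hξx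
  linarith

theorem exists_isNormalSystem (P : Set (Fin d → ℝ)) :
    ∃ ξ : Facet P → Fin d → ℝ, IsNormalSystem P ξ :=
  ⟨fun Γ => Γ.2.1.2.choose, fun Γ => Γ.2.1.2.choose_spec⟩

section NormalSystem

variable {P : Set (Fin d → ℝ)} {ξ : Facet P → Fin d → ℝ}

theorem supportNumber_eq (hξ : IsNormalSystem P ξ) {Γ : Facet P} {x : Fin d → ℝ}
    (hx : x ∈ (Γ : Set (Fin d → ℝ))) : ξ Γ ⬝ᵥ x = supportNumber P ξ Γ := by
  rw [hξ Γ] at hx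
  rw [supportNumber]
  refine Eq.symm (IsGreatest.csSup_eq ⟨⟨x, hx.1, rfl⟩, ?_⟩)
  rintro _ ⟨y, hy, rfl⟩
  exact hx.2 y hy

theorem dot_le_supportNumber (hξ : IsNormalSystem P ξ) (Γ : Facet P) {x : Fin d → ℝ} (hx : x ∈ P) :
    ξ Γ ⬝ᵥ x ≤ supportNumber P ξ Γ := by
  obtain ⟨y, hy⟩ := Γ.2.1.1
  rw [← supportNumber_eq hξ hy]
  rw [hξ Γ] at hy
  exact hy.2 x hx

theorem mem_facet_iff (hξ : IsNormalSystem P ξ) {Γ : Facet P} {x : Fin d → ℝ} (hx : x ∈ P) :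
    x ∈ (Γ : Set (Fin d → ℝ)) ↔ ξ Γ ⬝ᵥ x = supportNumber P ξ Γ := by
  refine ⟨supportNumber_eq hξ, fun h => ?_⟩
  rw [hξ Γ]
  exact ⟨hx, fun y hy => h ▸ dot_le_supportNumber hξ Γ hy⟩

theorem IsDPolytope.eq_hpoly (hP : IsDPolytope P) (hξ : IsNormalSystem P ξ) :
    P = hpoly ξ (supportNumber P ξ) := by
  refine Set.Subset.antisymm (fun x hx Γ => dot_le_supportNumber hξ Γ hx) fun x hx => ?_
  refine hP.mem_of_forall_facet fun ζ hζ y hy => ?_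
  let Γ : Facet P := ⟨_, hζ⟩
  have hΓ : maxFace P ζ = maxFace P (ξ Γ) := hξ Γ
  obtain ⟨l, hl, h⟩ := IsFacet.exists_smul_eq hP (ξ := ξ Γ) (ζ := ζ) (hΓ ▸ hζ) hΓ.symm
  have h1 := hx Γ
  rw [← supportNumber_eq hξ (Γ := Γ) hy] at h1
  rw [h, smul_dotProduct, smul_dotProduct]
  exact mul_le_mul_of_nonneg_left h1 hl.le

end NormalSystem

/-! ### Facets at a simple vertex -/

section SimpleVertex

variable {J : Type} [Fintype J] [DecidableEq J] {a : J → Fin d → ℝ} {b : J → ℝ}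

/-- In the coordinates dual to the inequalities that are equalities at `v`, a functional maximal at
`v` has nonnegative coordinates, and its face is given by the equalities with nonzero coordinates.
For a facet there is only one of them. -/
theorem facet_eq_of_mem {v : Fin d → ℝ} (hP : IsDPolytope (hpoly a b)) (hv : v ∈ hpoly a b)
    (hpin : Pinned a b v) {A : Finset J} (hA : ∀ j, j ∈ A ↔ a j ⬝ᵥ v = b j) (hcard : A.card ≤ d)
    {G : Set (Fin d → ℝ)} (hG : IsFacet (hpoly a b) G) (hvG : v ∈ G) :
    ∃ j ∈ A, G = {x ∈ hpoly a b | a j ⬝ᵥ x = b j} := by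
  obtain ⟨-, u, -, hu, hexp⟩ := exists_dual_basis a A
    (fun u hu => hpin u fun j hj => hu j ((hA j).2 hj)) hcard
  obtain ⟨⟨-, ζ, rfl⟩, hdim⟩ := id hG
  have hc : ∀ j ∈ A, 0 ≤ u j ⬝ᵥ ζ := by
    intro j hj
    obtain ⟨t, ht, hmem⟩ := exists_pos_mem_hpoly (u := -u j) hv fun i hi => by
      rw [dotProduct_neg, hu i ((hA i).2 hi) j hj]
      split_ifs <;> norm_num
    have := hvG.2 _ hmem
    rw [dotProduct_add, dotProduct_smul, dotProduct_neg, smul_eq_mul,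
      dotProduct_comm ζ (u j)] at this
    nlinarith
  have hsub : ∀ x, ζ ⬝ᵥ v - ζ ⬝ᵥ x = ∑ j ∈ A, (u j ⬝ᵥ ζ) * (b j - a j ⬝ᵥ x) := by
    intro x
    rw [← dotProduct_sub]
    conv_lhs => rw [← hexp ζ]
    rw [sum_dotProduct]
    refine Finset.sum_congr rfl fun j hj => ?_
    rw [smul_dotProduct, smul_eq_mul, dotProduct_sub, (hA j).1 hj]
  have hmem : ∀ x ∈ hpoly a b, x ∈ maxFace (hpoly a b) ζ ↔
      ∀ j ∈ A, u j ⬝ᵥ ζ ≠ 0 → a j ⬝ᵥ x = b j := by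
    intro x hx
    have hnn : ∀ j ∈ A, 0 ≤ (u j ⬝ᵥ ζ) * (b j - a j ⬝ᵥ x) := fun j hj =>
      mul_nonneg (hc j hj) (sub_nonneg.2 (hx j))
    have : x ∈ maxFace (hpoly a b) ζ ↔ ζ ⬝ᵥ v - ζ ⬝ᵥ x = 0 := by
      constructor
      · intro h; rw [maxFace_const hvG h, sub_self]
      · intro h; exact ⟨hx, fun y hy => (hvG.2 y hy).trans (sub_eq_zero.1 h).le⟩
    rw [this, hsub, Finset.sum_eq_zero_iff_of_nonneg hnn]
    refine forall₂_congr fun j hj => ?_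
    rw [mul_eq_zero, sub_eq_zero, or_iff_not_imp_left, eq_comm (a := b j)]
  obtain ⟨j, hj, hcj⟩ : ∃ j ∈ A, u j ⬝ᵥ ζ ≠ 0 := by
    by_contra hcon
    push Not at hcon
    apply IsFacet.ne_zero hP hG
    rw [← hexp ζ]
    exact Finset.sum_eq_zero fun j hj => by rw [hcon j hj, zero_smul]
  refine ⟨j, hj, ?_⟩
  have huniq : ∀ k ∈ A, u k ⬝ᵥ ζ ≠ 0 → k = j := by
    intro k hk hck
    by_contra hkj
    set W := vectorSpan ℝ (maxFace (hpoly a b) ζ) with hW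
    have h1 : ∀ i ∈ A, u i ⬝ᵥ ζ ≠ 0 → ∀ w ∈ W, a i ⬝ᵥ w = 0 := fun i hi hci w hw =>
      dot_eq_zero_of_mem_vectorSpan (r := b i) (fun x hx => (hmem x hx.1).1 hx i hi hci) hw
    have hlt1 : W < W ⊔ Submodule.span ℝ {u j} := by
      refine lt_of_le_of_ne le_sup_left fun heq => ?_
      have : u j ∈ W := heq ▸ Submodule.mem_sup_right (Submodule.mem_span_singleton_self _)
      have := h1 j hj hcj _ this
      rw [hu j hj j hj] at this
      norm_num at this
    have hlt2 : W ⊔ Submodule.span ℝ {u j} < ⊤ := by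
      refine lt_top_iff_ne_top.2 fun htop => ?_
      have hle : W ⊔ Submodule.span ℝ {u j} ≤ LinearMap.ker (dotL (a k)).toLinearMap := by
        refine sup_le (fun w hw => h1 k hk hck w hw) ?_
        rw [Submodule.span_singleton_le_iff_mem]
        change a k ⬝ᵥ u j = 0
        rw [hu k hk j hj, if_neg hkj]
      rw [htop] at hle
      have : a k ⬝ᵥ u k = 0 := hle Submodule.mem_top
      rw [hu k hk k hk] at this
      norm_num at this
    have h2 := Submodule.finrank_lt_finrank_of_lt hlt1
    have h3 := Submodule.finrank_lt_finrank_of_lt hlt2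
    rw [finrank_top, Module.finrank_fin_fun] at h3
    change Module.finrank ℝ W + 1 = d at hdim
    omega
  ext x
  constructor
  · intro hx; exact ⟨hx.1, (hmem x hx.1).1 hx j hj hcj⟩
  · rintro ⟨hx, hxj⟩
    exact (hmem x hx).2 fun k hk hck => huniq k hk hck ▸ hxj

/-- If at most `d` inequalities are equalities at a vertex, then they define exactly `d` facets. -/
theorem facets_at_vertex {v : Fin d → ℝ} (hP : IsDPolytope (hpoly a b)) (hv : v ∈ hpoly a b)
    (hpin : Pinned a b v) {A : Finset J} (hA : ∀ j, j ∈ A ↔ a j ⬝ᵥ v = b j) (hcard : A.card ≤ d) :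
    {F | IsFacet (hpoly a b) F ∧ v ∈ F}.ncard = d ∧
      ∀ j ∈ A, IsFacet (hpoly a b) {x ∈ hpoly a b | a j ⬝ᵥ x = b j} := by
  classical
  set P := hpoly a b with hPdef
  obtain ⟨ξ, hξ⟩ := exists_isNormalSystem P
  have := finite_facet hP
  have := Fintype.ofFinite (Facet P)
  have hPξ := hP.eq_hpoly hξ
  have hvert : IsVertex P v := isVertex_of_pinned hv hpin
  have hvert' : IsVertex (hpoly ξ (supportNumber P ξ)) v := hPξ ▸ hvert
  have hpin' := pinned_of_isVertex hvert'
  let K : Finset (Facet P) := Finset.univ.filter fun Γ => v ∈ (Γ : Set (Fin d → ℝ))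
  have hK : ∀ Γ, Γ ∈ K ↔ ξ Γ ⬝ᵥ v = supportNumber P ξ Γ := fun Γ => by
    rw [← mem_facet_iff hξ hv]; simp [K]
  have hex : ∀ Γ : K, ∃ j : A, ((Γ : Facet P) : Set (Fin d → ℝ)) = {x ∈ P | a j ⬝ᵥ x = b j} := by
    intro Γ
    obtain ⟨j, hj, h⟩ := facet_eq_of_mem hP hv hpin hA hcard Γ.1.2 (Finset.mem_filter.1 Γ.2).2
    exact ⟨⟨j, hj⟩, h⟩
  choose g hgeq using hex
  have hinj : Function.Injective g := fun Γ Γ' h => by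
    apply Subtype.ext
    apply Subtype.ext
    rw [hgeq Γ, hgeq Γ', h]
  have hKA : K.card ≤ A.card := by simpa using Fintype.card_le_of_injective g hinj
  have hKd : K.card = d := (exists_dual_basis ξ K
    (fun u hu => hpin' u fun j hj => hu j ((hK j).2 hj)) (hKA.trans hcard)).1
  constructor
  · have hset : {F | IsFacet P F ∧ v ∈ F} = Subtype.val '' (K : Set (Facet P)) := by
      ext F
      constructor
      · rintro ⟨hF, hvF⟩
        exact ⟨⟨F, hF⟩, by simpa [K] using hvF, rfl⟩
      · rintro ⟨Γ, hΓ, rfl⟩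
        exact ⟨Γ.2, (Finset.mem_filter.1 hΓ).2⟩
    rw [hset, Set.ncard_image_of_injective _ Subtype.val_injective, Set.ncard_coe_finset, hKd]
  · intro j hj
    obtain ⟨Γ, hΓ⟩ := ((Fintype.bijective_iff_injective_and_card g).2
      ⟨hinj, by simp only [Fintype.card_coe]; omega⟩).2 ⟨j, hj⟩
    have h := hgeq Γ
    rw [hΓ] at h
    exact h ▸ Γ.1.2

end SimpleVertex

end EdgeSimple

namespace EdgeSimple

/-! ### Setting variables to zero -/

section Face

variable {ι : Type} [DecidableEq ι]

/-- The endomorphism of the polynomial ring that sets all variables outside of `I` to zero. -/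
noncomputable def face (I : Finset ι) : MvPolynomial ι ℝ →ₐ[ℝ] MvPolynomial ι ℝ :=
  MvPolynomial.aeval fun i => if i ∈ I then MvPolynomial.X i else 0

theorem face_X (I : Finset ι) (i : ι) :
    face I (MvPolynomial.X i) = if i ∈ I then MvPolynomial.X i else 0 := by
  simp [face]

theorem face_face (I K : Finset ι) (q : MvPolynomial ι ℝ) : face K (face I q) = face (I ∩ K) q := by
  have : (face K).comp (face I) = face (I ∩ K) := by
    apply MvPolynomial.algHom_ext
    intro i
    simp only [AlgHom.comp_apply, face_X, Finset.mem_inter]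
    by_cases h1 : i ∈ I <;> simp [h1, face_X]
  exact DFunLike.congr_fun this q

theorem face_monomial (I : Finset ι) (m : ι →₀ ℕ) (a : ℝ) :
    face I (MvPolynomial.monomial m a) =
      if m.support ⊆ I then MvPolynomial.monomial m a else 0 := by
  rw [face, MvPolynomial.aeval_monomial]
  split_ifs with h
  · rw [MvPolynomial.monomial_eq, Finsupp.prod, Finsupp.prod]
    congr 1
    exact Finset.prod_congr rfl fun i hi => by rw [if_pos (h hi)]
  · obtain ⟨i, hi, hI⟩ := Finset.not_subset.1 h
    rw [Finsupp.prod, Finset.prod_eq_zero hi, mul_zero]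
    rw [if_neg hI, zero_pow (Finsupp.mem_support_iff.1 hi)]

theorem coeff_face (I : Finset ι) (q : MvPolynomial ι ℝ) (m : ι →₀ ℕ) :
    (face I q).coeff m = if m.support ⊆ I then q.coeff m else 0 := by
  induction q using MvPolynomial.induction_on' with
  | monomial n a =>
    rw [face_monomial]
    by_cases h : n = m
    · subst h; split_ifs <;> simp
    · split_ifs <;> simp [MvPolynomial.coeff_monomial, h]
  | add p q hp hq =>
    rw [map_add, MvPolynomial.coeff_add, hp, hq, MvPolynomial.coeff_add]
    split_ifs <;> simp

theorem face_eq_zero_iff {I : Finset ι} {q : MvPolynomial ι ℝ} :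
    face I q = 0 ↔ ∀ m ∈ q.support, ¬ m.support ⊆ I := by
  rw [MvPolynomial.ext_iff]
  simp only [coeff_face, MvPolynomial.coeff_zero, MvPolynomial.mem_support_iff]
  refine forall_congr' fun m => ?_
  split_ifs with h <;> simp [h]

theorem eval_face (I : Finset ι) (q : MvPolynomial ι ℝ) (x : ι → ℝ) :
    MvPolynomial.eval x (face I q) = MvPolynomial.eval (fun i => if i ∈ I then x i else 0) q := by
  induction q using MvPolynomial.induction_on with
  | C a => simp [face]
  | add p q hp hq => simp [hp, hq]
  | mul_X p i hp =>
    rw [map_mul, map_mul, hp, map_mul, face_X, MvPolynomial.eval_X]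
    split_ifs <;> simp

theorem face_prod_X (I R : Finset ι) :
    face I (∏ i ∈ R, MvPolynomial.X i) = if R ⊆ I then ∏ i ∈ R, MvPolynomial.X i else 0 := by
  rw [map_prod]
  split_ifs with h
  · exact Finset.prod_congr rfl fun i hi => by rw [face_X, if_pos (h hi)]
  · obtain ⟨i, hi, hI⟩ := Finset.not_subset.1 h
    exact Finset.prod_eq_zero hi (by rw [face_X, if_neg hI])

theorem prod_X_dvd_of_forall_mem_support (R : Finset ι) (q : MvPolynomial ι ℝ)
    (h : ∀ m ∈ q.support, R ⊆ m.support) : (∏ i ∈ R, MvPolynomial.X i) ∣ q := by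
  rw [← MvPolynomial.support_sum_monomial_coeff q]
  refine Finset.dvd_sum fun m hm => ?_
  have : (∏ i ∈ R, (MvPolynomial.X i : MvPolynomial ι ℝ))
      = MvPolynomial.monomial (∑ i ∈ R, Finsupp.single i 1) 1 := by
    rw [MvPolynomial.monomial_sum_one]; rfl
  rw [this, MvPolynomial.monomial_dvd_monomial]
  refine ⟨Or.inr fun i => ?_, one_dvd _⟩
  rw [Finsupp.finsetSum_apply]
  simp only [Finsupp.single_apply, Finset.sum_ite_eq']
  split_ifs with hi
  · exact Nat.one_le_iff_ne_zero.2 (Finsupp.mem_support_iff.1 (h m hm hi))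
  · exact Nat.zero_le _

end Face

/-! ### Simple polytopes as complete simplicial fans with support numbers -/

/-- The combinatorial data of a simple polytope `{x | ∀ i, ray i ⬝ᵥ x ≤ supp i}`: its vertices are
indexed by the sets `I ∈ maxl` of the facets passing through them, and `dualVec I` is the basis
dual to the basis `ray i`, `i ∈ I`, extended by zero. The condition `exists_max` says that every
functional attains its maximum on a face at a vertex of this face. -/
structure SimpleData (d : ℕ) (ι : Type) [Fintype ι] [DecidableEq ι] where
  ray : ι → Fin d → ℝ
  maxl : Finset (Finset ι)
  dualVec : Finset ι → ι → Fin d → ℝ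
  supp : ι → ℝ
  dualVec_off : ∀ I ∈ maxl, ∀ i ∉ I, dualVec I i = 0
  ray_dualVec : ∀ I ∈ maxl, ∀ i ∈ I, ∀ j ∈ I, ray i ⬝ᵥ dualVec I j = if i = j then 1 else 0
  expand : ∀ I ∈ maxl, ∀ x, ∑ i, (dualVec I i ⬝ᵥ x) • ray i = x
  card_eq : ∀ I ∈ maxl, I.card = d
  lt_supp : ∀ I ∈ maxl, ∀ j ∉ I, ray j ⬝ᵥ (∑ i, supp i • dualVec I i) < supp j
  exists_max : ∀ (η : Fin d → ℝ) (K I₀ : Finset ι), I₀ ∈ maxl → K ⊆ I₀ →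
    ∃ I ∈ maxl, K ⊆ I ∧ ∀ j ∈ I \ K, 0 ≤ dualVec I j ⬝ᵥ η

namespace SimpleData

variable {d : ℕ} {ι : Type} [Fintype ι] [DecidableEq ι] (F : SimpleData d ι)

/-- The vertex in which the hyperplanes `ray i ⬝ᵥ x = H i`, `i ∈ I`, meet. -/
def vert (H : ι → ℝ) (I : Finset ι) : Fin d → ℝ := ∑ i, H i • F.dualVec I i

/-- The inequalities `ray i ⬝ᵥ x ≤ H i` define a polytope with the same vertices, combinatorially,
as the original one. -/
def Good (H : ι → ℝ) : Prop := ∀ I ∈ F.maxl, ∀ j ∉ I, F.ray j ⬝ᵥ F.vert H I < H j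

/-- The functional `η` is not constant on any edge. -/
def Generic (η : Fin d → ℝ) : Prop := ∀ I ∈ F.maxl, ∀ i ∈ I, F.dualVec I i ⬝ᵥ η ≠ 0

variable {F}

theorem good_supp : F.Good F.supp := F.lt_supp

theorem dot_vert (H : ι → ℝ) (I : Finset ι) (η : Fin d → ℝ) :
    η ⬝ᵥ F.vert H I = ∑ i, H i * (F.dualVec I i ⬝ᵥ η) := by
  rw [vert, dotProduct_sum]
  exact Finset.sum_congr rfl fun i _ => by rw [dotProduct_smul, smul_eq_mul, dotProduct_comm]

theorem ray_vert {I : Finset ι} (hI : I ∈ F.maxl) (H : ι → ℝ) {i : ι} (hi : i ∈ I) :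
    F.ray i ⬝ᵥ F.vert H I = H i := by
  rw [dot_vert, Finset.sum_eq_single i]
  · rw [dotProduct_comm, F.ray_dualVec I hI i hi i hi, if_pos rfl, mul_one]
  · intro j _ hj
    by_cases hjI : j ∈ I
    · rw [dotProduct_comm, F.ray_dualVec I hI i hi j hjI, if_neg hj.symm, mul_zero]
    · rw [F.dualVec_off I hI j hjI, zero_dotProduct, mul_zero]
  · simp

theorem dot_eq_sum {I : Finset ι} (hI : I ∈ F.maxl) (η x : Fin d → ℝ) :
    η ⬝ᵥ x = ∑ i, (F.dualVec I i ⬝ᵥ η) * (F.ray i ⬝ᵥ x) := by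
  conv_lhs => rw [← F.expand I hI η]
  rw [sum_dotProduct]
  exact Finset.sum_congr rfl fun i _ => by rw [smul_dotProduct, smul_eq_mul]

/-- The coordinates of `η` at a vertex measure how `η` decreases along the edges that leave the
facets at this vertex. -/
theorem dot_vert_sub {I : Finset ι} (hI : I ∈ F.maxl) (H : ι → ℝ) (η x : Fin d → ℝ) :
    η ⬝ᵥ F.vert H I - η ⬝ᵥ x = ∑ i ∈ I, (F.dualVec I i ⬝ᵥ η) * (H i - F.ray i ⬝ᵥ x) := by
  rw [dot_vert, dot_eq_sum hI η x, ← Finset.sum_sub_distrib]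
  rw [← Finset.sum_subset (Finset.subset_univ I)]
  · exact Finset.sum_congr rfl fun i _ => by ring
  · intro i _ hi
    rw [F.dualVec_off I hI i hi]; simp

theorem Good.ray_vert_le {H : ι → ℝ} (hH : F.Good H) {I : Finset ι} (hI : I ∈ F.maxl) (j : ι) :
    F.ray j ⬝ᵥ F.vert H I ≤ H j := by
  by_cases hj : j ∈ I
  · exact (ray_vert hI H hj).le
  · exact (hH I hI j hj).le

/-- If the edges going from the vertex `I` into the face `K` are `η`-descending, then `I` is the
only vertex of this face at which `η` is maximal. -/
theorem Good.dot_vert_lt {H : ι → ℝ} (hH : F.Good H) {I J K : Finset ι} (hI : I ∈ F.maxl)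
    (hJ : J ∈ F.maxl) (hKJ : K ⊆ J) (hne : J ≠ I) {η : Fin d → ℝ}
    (hη : ∀ i ∈ I \ K, 0 < F.dualVec I i ⬝ᵥ η) : η ⬝ᵥ F.vert H J < η ⬝ᵥ F.vert H I := by
  rw [← sub_pos, dot_vert_sub hI]
  have hIJ : ¬ I ⊆ J := fun h => hne
    (Finset.eq_of_subset_of_card_le h (by rw [F.card_eq I hI, F.card_eq J hJ])).symm
  obtain ⟨i, hi, hiJ⟩ := Finset.not_subset.1 hIJ
  refine Finset.sum_pos' (fun j hj => ?_) ⟨i, hi, ?_⟩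
  · by_cases hjK : j ∈ K
    · rw [ray_vert hJ H (hKJ hjK), sub_self, mul_zero]
    · exact mul_nonneg (hη j (Finset.mem_sdiff.2 ⟨hj, hjK⟩)).le
        (sub_nonneg.2 (hH.ray_vert_le hJ j))
  · exact mul_pos (hη i (Finset.mem_sdiff.2 ⟨hi, fun h => hiJ (hKJ h)⟩))
      (sub_pos.2 (hH J hJ i hiJ))

theorem Generic.neg {η : Fin d → ℝ} (hη : F.Generic η) : F.Generic (-η) := fun I hI i hi => by
  rw [dotProduct_neg]; exact neg_ne_zero.2 (hη I hI i hi)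

theorem Generic.existsUnique {η : Fin d → ℝ} (hη : F.Generic η) {K I₀ : Finset ι}
    (hI₀ : I₀ ∈ F.maxl) (hK : K ⊆ I₀) :
    ∃! I, I ∈ F.maxl ∧ K ⊆ I ∧ ∀ j ∈ I \ K, 0 < F.dualVec I j ⬝ᵥ η := by
  obtain ⟨I, hI, hKI, hpos⟩ := F.exists_max η K I₀ hI₀ hK
  have hpos' : ∀ j ∈ I \ K, 0 < F.dualVec I j ⬝ᵥ η := fun j hj =>
    lt_of_le_of_ne (hpos j hj) (hη I hI j (Finset.mem_sdiff.1 hj).1).symm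
  refine ⟨I, ⟨hI, hKI, hpos'⟩, ?_⟩
  rintro J ⟨hJ, hKJ, hJpos⟩
  by_contra hne
  have h1 := good_supp.dot_vert_lt hI hJ hKJ hne hpos'
  have h2 := good_supp.dot_vert_lt hJ hI hKI (Ne.symm hne) hJpos
  exact lt_asymm h1 h2

theorem dense_generic : Dense {η | F.Generic η} := by
  have hset : {η | F.Generic η} = ⋂ p : {p : Finset ι × ι // p.1 ∈ F.maxl ∧ p.2 ∈ p.1},
      {η | F.dualVec p.1.1 p.1.2 ⬝ᵥ η ≠ 0} := by
    ext η
    simp only [Generic, Set.mem_ofPred_eq, Set.mem_iInter, Subtype.forall, Prod.forall]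
    exact ⟨fun h a b hab => h a hab.1 b hab.2, fun h I hI i hi => h I i ⟨hI, hi⟩⟩
  rw [hset]
  refine dense_iInter_of_isOpen (fun p => ?_) fun p => ?_
  · exact isOpen_ne_fun (Continuous.dotProduct continuous_const continuous_id) continuous_const
  · obtain ⟨⟨I, i⟩, hI, hi⟩ := p
    -- moving along `ray i` changes the value of `dualVec I i`
    rw [Metric.dense_iff]
    intro η r hr
    by_cases h0 : F.dualVec I i ⬝ᵥ η = 0
    · have hc : Tendsto (fun t : ℝ => η + t • F.ray i) (𝓝 0) (𝓝 η) := by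
        have : Continuous fun t : ℝ => η + t • F.ray i := by fun_prop
        simpa using this.tendsto 0
      have h1 : ∀ᶠ t in 𝓝[≠] (0:ℝ), η + t • F.ray i ∈ Metric.ball η r :=
        (hc.eventually (Metric.ball_mem_nhds η hr)).filter_mono nhdsWithin_le_nhds
      obtain ⟨t, ht, ht0⟩ := (h1.and self_mem_nhdsWithin).exists
      refine ⟨_, ht, ?_⟩
      simp only [Set.mem_ofPred_eq, dotProduct_add, h0, zero_add, dotProduct_smul, smul_eq_mul]
      rw [dotProduct_comm, F.ray_dualVec I hI i hi i hi, if_pos rfl, mul_one]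
      exact ht0
    · exact ⟨η, Metric.mem_ball_self hr, h0⟩

/-! ### The face ring modulo linear functions -/

variable (F)

/-- The ideal of polynomials that vanish on all coordinate subspaces `I ∈ maxl`
(the Stanley–Reisner ideal). -/
noncomputable def srIdeal : Ideal (MvPolynomial ι ℝ) := ⨅ I ∈ F.maxl, RingHom.ker (face I)

/-- The linear form that corresponds to the global linear function `a`. -/
noncomputable def linForm (a : Fin d → ℝ) : MvPolynomial ι ℝ :=
  ∑ i, MvPolynomial.C (a ⬝ᵥ F.ray i) * MvPolynomial.X i

/-- The ideal generated by the global linear functions. -/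
noncomputable def linIdeal : Ideal (MvPolynomial ι ℝ) := Ideal.span (Set.range F.linForm)

/-- The set of facets at the vertex `I` that are left along `η`-descending edges. -/
noncomputable def desc (η : Fin d → ℝ) (I : Finset ι) : Finset ι :=
  I.filter fun i => 0 < F.dualVec I i ⬝ᵥ η

variable {F}

theorem mem_srIdeal {q : MvPolynomial ι ℝ} : q ∈ F.srIdeal ↔ ∀ I ∈ F.maxl, face I q = 0 := by
  simp [srIdeal, Submodule.mem_iInf, RingHom.mem_ker]

theorem linForm_mem (a : Fin d → ℝ) : F.linForm a ∈ F.linIdeal := Ideal.subset_span ⟨a, rfl⟩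

theorem face_linForm_dualVec {I : Finset ι} (hI : I ∈ F.maxl) (j : ι) :
    face I (F.linForm (F.dualVec I j)) = face I (MvPolynomial.X j) := by
  rw [linForm, map_sum]
  simp only [map_mul, face_X]
  by_cases hj : j ∈ I
  · rw [Finset.sum_eq_single j]
    · rw [dotProduct_comm, F.ray_dualVec I hI j hj j hj]; simp [face]
    · intro i _ hij
      by_cases hi : i ∈ I
      · rw [dotProduct_comm, F.ray_dualVec I hI i hi j hj, if_neg hij]; simp
      · simp [hi]
    · simp
  · rw [F.dualVec_off I hI j hj, if_neg hj]; simp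

/-- Every polynomial on a maximal cone extends to a polynomial that is constant modulo the global
linear functions, because the coordinates on the cone are restrictions of global linear
functions. -/
theorem exists_lift {I : Finset ι} (hI : I ∈ F.maxl) (p : MvPolynomial ι ℝ) :
    ∃ p' : MvPolynomial ι ℝ, ∃ a : ℝ, face I p' = face I p ∧
      p' - MvPolynomial.C a ∈ F.linIdeal := by
  induction p using MvPolynomial.induction_on with
  | C a => exact ⟨MvPolynomial.C a, a, rfl, by simp⟩
  | add p q hp hq =>
    obtain ⟨p', a, h1, h2⟩ := hp
    obtain ⟨q', b, h3, h4⟩ := hq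
    refine ⟨p' + q', a + b, by rw [map_add, map_add, h1, h3], ?_⟩
    have := add_mem h2 h4
    rw [map_add]; convert this using 1; ring
  | mul_X p i hp =>
    obtain ⟨p', a, h1, h2⟩ := hp
    refine ⟨p' * F.linForm (F.dualVec I i), 0, ?_, ?_⟩
    · rw [map_mul, map_mul, h1, face_linForm_dualVec hI]
    · rw [map_zero, sub_zero]; exact Ideal.mul_mem_left _ _ (linForm_mem _)

/-- The product attached to a vertex vanishes on the cones of all vertices that are not above it. -/
theorem face_prod_desc {η : Fin d → ℝ} (hη : F.Generic η) {I J : Finset ι} (hI : I ∈ F.maxl)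
    (hJ : J ∈ F.maxl) (hne : J ≠ I) (hle : η ⬝ᵥ F.vert F.supp J ≤ η ⬝ᵥ F.vert F.supp I) :
    face J (∏ i ∈ F.desc η I, MvPolynomial.X i) = 0 := by
  rw [face_prod_X, if_neg]
  intro hsub
  have := good_supp.dot_vert_lt hI hJ hsub hne (η := -η) (fun i hi => by
    rw [Finset.mem_sdiff, desc, Finset.mem_filter, not_and, not_lt] at hi
    rw [dotProduct_neg]
    exact neg_pos.2 (lt_of_le_of_ne (hi.2 hi.1) (hη I hI i hi.1)))
  rw [neg_dotProduct, neg_dotProduct] at this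
  linarith

/-- The products over the descending facets of the vertices span the face ring modulo linear
functions. The vertices are treated one at a time in the order of growing `η`; the polynomial `q`
already vanishes on the cones of the vertices outside of `U`. -/
theorem mem_span_of_face_eq_zero {η : Fin d → ℝ} (hη : F.Generic η) (U : Finset (Finset ι))
    (hU : U ⊆ F.maxl)
    (hup : ∀ I ∈ U, ∀ J ∈ F.maxl, J ∉ U → η ⬝ᵥ F.vert F.supp J ≤ η ⬝ᵥ F.vert F.supp I)
    (q : MvPolynomial ι ℝ) (hq : ∀ J ∈ F.maxl, J ∉ U → face J q = 0) :
    ∃ a : Finset ι → ℝ, q - ∑ I ∈ F.maxl, MvPolynomial.C (a I) *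
      ∏ i ∈ F.desc η I, MvPolynomial.X i ∈ F.srIdeal ⊔ F.linIdeal := by
  induction hn : U.card generalizing U q with
  | zero =>
    rw [Finset.card_eq_zero] at hn
    subst hn
    refine ⟨0, Ideal.mem_sup_left ?_⟩
    simpa using mem_srIdeal.2 fun J hJ => hq J hJ (by simp)
  | succ n ih =>
    have hne : U.Nonempty := Finset.card_pos.1 (by omega)
    obtain ⟨I, hIU, hmin⟩ := Finset.exists_min_image U (fun I => η ⬝ᵥ F.vert F.supp I) hne
    have hI := hU hIU
    -- on the cone `I`, the function `q` vanishes along the walls shared with earlier cones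
    have hdvd : (∏ i ∈ F.desc η I, MvPolynomial.X i) ∣ face I q := by
      apply prod_X_dvd_of_forall_mem_support
      intro m hm i hi
      by_contra hmi
      rw [desc, Finset.mem_filter] at hi
      obtain ⟨J, hJ, hKJ, hJpos⟩ := F.exists_max (-η) (I.erase i) I hI (Finset.erase_subset _ _)
      have hJpos' : ∀ j ∈ J \ I.erase i, 0 < F.dualVec J j ⬝ᵥ (-η) := fun j hj =>
        lt_of_le_of_ne (hJpos j hj) (hη.neg J hJ j (Finset.mem_sdiff.1 hj).1).symm
      have hJI : I ≠ J := by
        rintro rfl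
        have := hJpos i (by simp [hi.1])
        rw [dotProduct_neg] at this
        linarith
      have hlt := good_supp.dot_vert_lt hJ hI (Finset.erase_subset _ _) hJI hJpos'
      rw [neg_dotProduct, neg_dotProduct] at hlt
      have hJU : J ∉ U := fun h => by have := hmin J h; linarith
      have hJq := hq J hJ hJU
      rw [MvPolynomial.mem_support_iff, coeff_face] at hm
      split_ifs at hm with hmI
      · refine face_eq_zero_iff.1 hJq m (MvPolynomial.mem_support_iff.2 hm) fun j hj => hKJ ?_
        exact Finset.mem_erase.2 ⟨fun h => hmi (h ▸ hj), hmI hj⟩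
      · exact hm rfl
    obtain ⟨p, hp⟩ := hdvd
    obtain ⟨p', c, hp', hc⟩ := exists_lift hI p
    have hdesc : F.desc η I ⊆ I := Finset.filter_subset _ _
    obtain ⟨a, ha⟩ := ih (U.erase I) ((Finset.erase_subset _ _).trans hU) (by
        intro J hJ J' hJ' hJ'U
        rw [Finset.mem_erase] at hJ
        by_cases h : J' = I
        · exact h ▸ hmin J hJ.2
        · exact hup J hJ.2 J' hJ' fun h' => hJ'U (Finset.mem_erase.2 ⟨h, h'⟩))
      (q - p' * ∏ i ∈ F.desc η I, MvPolynomial.X i) (by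
        intro J hJ hJU
        by_cases h : J = I
        · subst h
          have h1 : face J q = face J p' * face J (∏ i ∈ F.desc η J, MvPolynomial.X i) := by
            rw [hp', ← map_mul, mul_comm, ← hp, face_face, Finset.inter_self]
          rw [map_sub, map_mul, h1, sub_self]
        · have hJU' : J ∉ U := fun h' => hJU (Finset.mem_erase.2 ⟨h, h'⟩)
          rw [map_sub, map_mul, hq J hJ hJU', face_prod_desc hη hI hJ h (hup I hIU J hJ hJU')]
          simp)
      (by rw [Finset.card_erase_of_mem hIU]; omega)
    refine ⟨a + (Pi.single I c : Finset ι → ℝ), ?_⟩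
    have hsum : ∑ J ∈ F.maxl, MvPolynomial.C ((a + (Pi.single I c : Finset ι → ℝ)) J) *
        ∏ i ∈ F.desc η J, (MvPolynomial.X i : MvPolynomial ι ℝ)
        = (∑ J ∈ F.maxl, MvPolynomial.C (a J) * ∏ i ∈ F.desc η J, MvPolynomial.X i)
          + MvPolynomial.C c * ∏ i ∈ F.desc η I, MvPolynomial.X i := by
      simp only [Pi.add_apply, map_add, add_mul, Finset.sum_add_distrib]
      congr 1
      rw [Finset.sum_eq_single_of_mem I hI]
      · simp
      · intro J _ hJ; simp [hJ]
    rw [hsum]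
    have h2 := Ideal.mul_mem_right (∏ i ∈ F.desc η I, MvPolynomial.X i) _ hc
    convert add_mem ha (show _ ∈ F.srIdeal ⊔ F.linIdeal from Ideal.mem_sup_right h2) using 1
    ring

/-- An ideal that contains the Stanley–Reisner ideal and the linear functions, but does not contain
the products of variables over maximal cones, is generated by the two: the pairing between the
generators attached to the vertices for `η` and for `-η` is triangular. -/
theorem eq_sup_of_prod_notMem (A : Ideal (MvPolynomial ι ℝ)) (h1 : F.srIdeal ≤ A)
    (h2 : F.linIdeal ≤ A) (h3 : ∀ I ∈ F.maxl, ∏ i ∈ I, (MvPolynomial.X i) ∉ A) :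
    A = F.srIdeal ⊔ F.linIdeal := by
  refine le_antisymm (fun q hq => ?_) (sup_le h1 h2)
  obtain ⟨η, hη⟩ := F.dense_generic.nonempty
  obtain ⟨a, ha⟩ := mem_span_of_face_eq_zero hη F.maxl subset_rfl
    (fun I _ J hJ hJ' => absurd hJ hJ') q fun J hJ hJ' => absurd hJ hJ'
  suffices h : ∀ I ∈ F.maxl, a I = 0 by
    rw [Finset.sum_eq_zero fun I hI => by rw [h I hI, map_zero, zero_mul], sub_zero] at ha
    exact ha
  have hsum : ∑ I ∈ F.maxl, MvPolynomial.C (a I) * ∏ i ∈ F.desc η I, MvPolynomial.X i ∈ A := by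
    have := sub_mem hq (sup_le h1 h2 ha)
    simpa using this
  by_contra hcon
  push Not at hcon
  obtain ⟨I₀, hI₀, haI₀⟩ := hcon
  obtain ⟨I, hI, hmin⟩ := Finset.exists_min_image (F.maxl.filter fun I => a I ≠ 0)
    (fun I => η ⬝ᵥ F.vert F.supp I) ⟨I₀, Finset.mem_filter.2 ⟨hI₀, haI₀⟩⟩
  rw [Finset.mem_filter] at hI
  have hmul := Ideal.mul_mem_right (∏ i ∈ I \ F.desc η I, MvPolynomial.X i) _ hsum
  rw [Finset.sum_mul, ← Finset.add_sum_erase _ _ hI.1] at hmul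
  have hrest : ∑ J ∈ F.maxl.erase I, (MvPolynomial.C (a J) * ∏ i ∈ F.desc η J, MvPolynomial.X i) *
      ∏ i ∈ I \ F.desc η I, MvPolynomial.X i ∈ A := by
    refine sum_mem fun J hJ => ?_
    rw [Finset.mem_erase] at hJ
    by_cases haJ : a J = 0
    · simp [haJ]
    have hle := hmin J (Finset.mem_filter.2 ⟨hJ.2, haJ⟩)
    rw [mul_assoc]
    refine Ideal.mul_mem_left _ _ (h1 (mem_srIdeal.2 fun T hT => ?_))
    rw [map_mul]
    by_contra hne
    rw [mul_eq_zero, not_or, face_prod_X, face_prod_X] at hne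
    have hT1 : F.desc η J ⊆ T := by by_contra h; simp [h] at hne
    have hT2 : I \ F.desc η I ⊆ T := by by_contra h; simp [h] at hne
    have hTI : T ≠ I → η ⬝ᵥ F.vert F.supp T < η ⬝ᵥ F.vert F.supp I := fun h =>
      good_supp.dot_vert_lt hI.1 hT hT2 h (fun i hi => by
        rw [Finset.mem_sdiff, Finset.mem_sdiff, not_and_not_right] at hi
        exact (Finset.mem_filter.1 (hi.2 hi.1)).2)
    have hTJ : T ≠ J → η ⬝ᵥ F.vert F.supp J < η ⬝ᵥ F.vert F.supp T := fun h => by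
      by_contra hcon
      have := face_prod_desc hη hJ.2 hT h (not_lt.1 hcon)
      rw [face_prod_X] at this
      exact hne.1 this
    by_cases hTI' : T = I
    · subst hTI'
      exact absurd (hTJ hJ.1.symm) (not_lt.2 hle)
    · have := hTI hTI'
      by_cases hTJ' : T = J
      · subst hTJ'; linarith
      · have := hTJ hTJ'; linarith
  have hmain := sub_mem hmul hrest
  rw [add_sub_cancel_right, mul_assoc, mul_comm (∏ i ∈ F.desc η I, _),
    Finset.prod_sdiff (show F.desc η I ⊆ I from Finset.filter_subset _ _)] at hmain
  have := Ideal.mul_mem_left _ (MvPolynomial.C (a I)⁻¹) hmain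
  rw [← mul_assoc, ← map_mul, inv_mul_cancel₀ hI.2, map_one, one_mul] at this
  exact h3 I hI.1 this

end SimpleData

end EdgeSimple

namespace EdgeSimple

open scoped Pointwise

namespace SimpleData

variable {d : ℕ} {ι : Type} [Fintype ι] [DecidableEq ι] {F : SimpleData d ι}

/-! ### Decomposition of a simple polytope into cones -/

variable (F) in
/-- The polytope given by the support numbers `H`. -/
def body (H : ι → ℝ) : Set (Fin d → ℝ) := {x | ∀ i, F.ray i ⬝ᵥ x ≤ H i}

/-- For generic `η`, each face has exactly one vertex with `η` maximal, so that the left-hand side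
is the alternating sum over the faces whose facet inequalities are all violated; this does not
depend on `η`. -/
theorem sum_prod_eq_sum_faces {η : Fin d → ℝ} (hη : F.Generic η) (f : ι → ℝ) :
    ∑ I ∈ F.maxl, ∏ i ∈ I, (f i + if 0 < F.dualVec I i ⬝ᵥ η then 1 else 0) =
      ∑ K with ∃ I ∈ F.maxl, K ⊆ I, ∏ i ∈ K, f i := by
  have h1 : ∀ I ∈ F.maxl, ∏ i ∈ I, (f i + if 0 < F.dualVec I i ⬝ᵥ η then 1 else 0) =
      ∑ K, if K ⊆ I ∧ ∀ j ∈ I \ K, 0 < F.dualVec I j ⬝ᵥ η then ∏ i ∈ K, f i else 0 := by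
    intro I hI
    rw [Finset.prod_add, ← Finset.sum_subset (Finset.subset_univ I.powerset)]
    · refine Finset.sum_congr rfl fun K hK => ?_
      rw [Finset.prod_ite_zero, Finset.prod_const_one, mul_ite, mul_one, mul_zero]
      simp [Finset.mem_powerset.1 hK]
    · intro K _ hK
      rw [Finset.mem_powerset] at hK
      simp [hK]
  rw [Finset.sum_congr rfl h1, Finset.sum_comm, Finset.sum_filter]
  refine Finset.sum_congr rfl fun K _ => ?_
  split_ifs with h
  · obtain ⟨I₀, hI₀, hK⟩ := h
    obtain ⟨I, ⟨hI, hIK⟩, huniq⟩ := hη.existsUnique hI₀ hK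
    rw [Finset.sum_eq_single_of_mem I hI, if_pos hIK]
    intro J hJ hne
    exact if_neg fun h => hne (huniq J ⟨hJ, h⟩)
  · exact Finset.sum_eq_zero fun I hI => if_neg fun h' => h ⟨I, hI, h'.1⟩

/-- The indicator function of a simple polytope as an alternating sum of indicator functions of
cones with apices at its vertices. Each factor on the left-hand side is the sign times the indicator
of the half-space that bounds the cone. -/
theorem sum_prod_eq_indicator {H : ι → ℝ} (hH : F.Good H) (hne : F.maxl.Nonempty) {η : Fin d → ℝ}
    (hη : F.Generic η) (x : Fin d → ℝ) :
    ∑ I ∈ F.maxl, ∏ i ∈ I, ((-if H i < F.ray i ⬝ᵥ x then 1 else 0) +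
      if 0 < F.dualVec I i ⬝ᵥ η then 1 else 0) = (F.body H).indicator (1 : (Fin d → ℝ) → ℝ) x := by
  classical
  rw [sum_prod_eq_sum_faces hη]
  by_cases hx : x ∈ F.body H
  · rw [Set.indicator_of_mem hx, Pi.one_apply, Finset.sum_eq_single ∅]
    · simp
    · intro K _ hK
      obtain ⟨i, hi⟩ := Finset.nonempty_iff_ne_empty.2 hK
      exact Finset.prod_eq_zero hi (by rw [if_neg (not_lt.2 (hx i)), neg_zero])
    · intro h
      obtain ⟨I, hI⟩ := hne
      exact absurd (Finset.mem_filter.2 ⟨Finset.mem_univ _, I, hI, Finset.empty_subset _⟩) h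
  · rw [Set.indicator_of_notMem hx]
    simp only [body, Set.mem_ofPred_eq, not_forall, not_le] at hx
    obtain ⟨j, hj⟩ := hx
    -- compute the sum for a generic functional close to `ray j`
    have hopen : IsOpen {ζ : Fin d → ℝ | ∀ I ∈ F.maxl, ζ ⬝ᵥ F.vert H I < ζ ⬝ᵥ x} := by
      simp only [Set.ofPred_forall]
      refine isOpen_biInter_finset fun I _ => isOpen_lt ?_ ?_ <;>
      exact Continuous.dotProduct continuous_id continuous_const
    obtain ⟨ζ, hζ, hζg⟩ := F.dense_generic.inter_open_nonempty _ hopen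
      ⟨F.ray j, fun I hI => (hH.ray_vert_le hI j).trans_lt hj⟩
    rw [← sum_prod_eq_sum_faces hζg]
    refine Finset.sum_eq_zero fun I hI => ?_
    by_contra hcon
    have hfac := Finset.prod_ne_zero_iff.1 hcon
    have hpos : 0 ≤ ζ ⬝ᵥ F.vert H I - ζ ⬝ᵥ x := by
      rw [dot_vert_sub hI]
      refine Finset.sum_nonneg fun i hi => ?_
      have hi' := hfac i hi
      by_cases h1 : 0 < F.dualVec I i ⬝ᵥ ζ
      · rw [if_pos h1] at hi'
        have h2 : ¬ H i < F.ray i ⬝ᵥ x := fun h => hi' (by rw [if_pos h]; ring)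
        exact mul_nonneg h1.le (by linarith)
      · rw [if_neg h1] at hi'
        have h2 : H i < F.ray i ⬝ᵥ x := by
          by_contra h; exact hi' (by rw [if_neg h]; ring)
        exact mul_nonneg_of_nonpos_of_nonpos (not_lt.1 h1) (by linarith)
    have := hζ I hI
    linarith

/-! ### The volume as a polynomial -/

variable (F) in
/-- The cone with apex `0` whose edges are the edges of the polytope at the vertex `I`, reversed so
that `η` decreases along them, cut off at the level `η = -s`. -/
def cutCone (η : Fin d → ℝ) (I : Finset ι) (s : ℝ) : Set (Fin d → ℝ) :=
  {x | (∀ i ∈ I, if 0 < F.dualVec I i ⬝ᵥ η then F.ray i ⬝ᵥ x ≤ 0 else 0 < F.ray i ⬝ᵥ x) ∧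
    -s ≤ η ⬝ᵥ x}

theorem measurableSet_cutCone (η : Fin d → ℝ) (I : Finset ι) (s : ℝ) :
    MeasurableSet (F.cutCone η I s) := by
  have hc : ∀ y : Fin d → ℝ, Measurable fun x : Fin d → ℝ => y ⬝ᵥ x := fun y =>
    (Continuous.dotProduct continuous_const continuous_id).measurable
  refine MeasurableSet.inter (s₁ := {x | ∀ i ∈ I, if 0 < F.dualVec I i ⬝ᵥ η then
    F.ray i ⬝ᵥ x ≤ 0 else 0 < F.ray i ⬝ᵥ x}) ?_ (measurableSet_le measurable_const (hc η))
  simp only [Set.ofPred_forall]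
  refine MeasurableSet.iInter fun i => MeasurableSet.iInter fun _ => ?_
  split_ifs
  · exact measurableSet_le (hc _) measurable_const
  · exact measurableSet_lt measurable_const (hc _)

theorem cutCone_smul (η : Fin d → ℝ) (I : Finset ι) {s : ℝ} (hs : 0 < s) :
    F.cutCone η I s = s • F.cutCone η I 1 := by
  ext x
  rw [Set.mem_smul_set_iff_inv_smul_mem₀ hs.ne']
  simp only [cutCone, Set.mem_ofPred_eq, dotProduct_smul, smul_eq_mul]
  have hs' := inv_pos.2 hs
  refine and_congr (forall₂_congr fun i _ => ?_) ?_
  · split_ifs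
    · constructor <;> intro h
      · exact mul_nonpos_of_nonneg_of_nonpos hs'.le h
      · by_contra h'; exact absurd (mul_pos hs' (not_le.1 h')) (not_lt.2 h)
    · exact (mul_pos_iff_of_pos_left hs').symm
  · rw [inv_mul_eq_div, le_div_iff₀ hs, neg_one_mul]

theorem cutCone_isBounded {η : Fin d → ℝ} (hη : F.Generic η) {I : Finset ι} (hI : I ∈ F.maxl) :
    Bornology.IsBounded (F.cutCone η I 1) := by
  rw [isBounded_iff_forall_norm_le]
  refine ⟨∑ k, ∑ i, |F.dualVec I i k| * |F.dualVec I i ⬝ᵥ η|⁻¹, fun x hx => ?_⟩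
  obtain ⟨h1, h2⟩ := hx
  have hterm : ∀ i ∈ I, 0 ≤ -((F.dualVec I i ⬝ᵥ η) * (F.ray i ⬝ᵥ x)) := by
    intro i hi
    have := h1 i hi
    split_ifs at this with hc
    · nlinarith
    · nlinarith [not_lt.1 hc]
  have hsum : ∑ i ∈ I, -((F.dualVec I i ⬝ᵥ η) * (F.ray i ⬝ᵥ x)) ≤ 1 := by
    rw [dot_eq_sum hI, ← Finset.sum_subset (Finset.subset_univ I)] at h2
    · rw [Finset.sum_neg_distrib]; linarith
    · intro i _ hi; rw [F.dualVec_off I hI i hi]; simp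
  have hle : ∀ i ∈ I, |F.ray i ⬝ᵥ x| ≤ |F.dualVec I i ⬝ᵥ η|⁻¹ := by
    intro i hi
    have h3 := (Finset.single_le_sum hterm hi).trans hsum
    have hpos : 0 < |F.dualVec I i ⬝ᵥ η| := abs_pos.2 (hη I hI i hi)
    rw [← one_div, le_div_iff₀ hpos, mul_comm, ← abs_mul, abs_of_nonpos (by linarith [hterm i hi])]
    exact h3
  have hpt : ∀ k, |x k| ≤ ∑ i, |F.dualVec I i k| * |F.dualVec I i ⬝ᵥ η|⁻¹ := by
    intro k
    have : x k = ∑ i, F.dualVec I i k * (F.ray i ⬝ᵥ x) := by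
      have := dot_eq_sum hI (Pi.single k 1) x
      simpa using this
    rw [this]
    refine (Finset.abs_sum_le_sum_abs _ _).trans (Finset.sum_le_sum fun i _ => ?_)
    rw [abs_mul]
    by_cases hi : i ∈ I
    · exact mul_le_mul_of_nonneg_left (hle i hi) (abs_nonneg _)
    · rw [F.dualVec_off I hI i hi]; simp
  have hnn : ∀ k, 0 ≤ ∑ i, |F.dualVec I i k| * |F.dualVec I i ⬝ᵥ η|⁻¹ := fun k =>
    Finset.sum_nonneg fun i _ => by positivity
  rw [pi_norm_le_iff_of_nonneg (Finset.sum_nonneg fun k _ => hnn k)]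
  intro k
  rw [Real.norm_eq_abs]
  exact (hpt k).trans (Finset.single_le_sum (fun k _ => hnn k) (Finset.mem_univ k))

theorem volume_cutCone_pos {η : Fin d → ℝ} (hη : F.Generic η) {I : Finset ι} (hI : I ∈ F.maxl) :
    0 < volume.real (F.cutCone η I 1) := by
  have hfin : volume (F.cutCone η I 1) ≠ ⊤ := (cutCone_isBounded hη hI).measure_lt_top.ne
  refine ENNReal.toReal_pos (ne_of_gt ?_) hfin
  let O : Set (Fin d → ℝ) := {x | (∀ i ∈ I, (F.dualVec I i ⬝ᵥ η) * (F.ray i ⬝ᵥ x) < 0) ∧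
    -1 < η ⬝ᵥ x}
  have hc : ∀ y : Fin d → ℝ, Continuous fun x : Fin d → ℝ => y ⬝ᵥ x := fun y =>
    Continuous.dotProduct continuous_const continuous_id
  have hO : IsOpen O := by
    refine IsOpen.inter (s := {x | ∀ i ∈ I, (F.dualVec I i ⬝ᵥ η) * (F.ray i ⬝ᵥ x) < 0}) ?_
      (isOpen_lt continuous_const (hc η))
    simp only [Set.ofPred_forall]
    exact isOpen_biInter_finset fun i _ => isOpen_lt (continuous_const.mul (hc _)) continuous_const
  have hsub : O ⊆ F.cutCone η I 1 := by
    rintro x ⟨h1, h2⟩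
    refine ⟨fun i hi => ?_, h2.le⟩
    have := h1 i hi
    split_ifs with hpos
    · exact (neg_of_mul_neg_right this hpos.le).le
    · exact pos_of_mul_neg_right this (not_lt.1 hpos)
  refine lt_of_lt_of_le (hO.measure_pos volume ?_) (measure_mono hsub)
  set S : ℝ := ∑ i, (F.dualVec I i ⬝ᵥ η) * (F.dualVec I i ⬝ᵥ η) with hS
  have hS0 : 0 ≤ S := Finset.sum_nonneg fun i _ => mul_self_nonneg _
  set H : ι → ℝ := fun i => -(1 + S)⁻¹ * (F.dualVec I i ⬝ᵥ η) with hHdef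
  have hpos : 0 < (1 + S)⁻¹ := by positivity
  refine ⟨F.vert H I, fun i hi => ?_, ?_⟩
  · rw [ray_vert hI H hi]
    have := mul_self_pos.2 (hη I hI i hi)
    simp only [hHdef]
    nlinarith
  · rw [dot_vert]
    have : ∑ i, H i * (F.dualVec I i ⬝ᵥ η) = -((1 + S)⁻¹ * S) := by
      simp only [hHdef, hS, Finset.mul_sum, ← Finset.sum_neg_distrib]
      exact Finset.sum_congr rfl fun i _ => by ring
    rw [this, neg_lt_neg_iff, inv_mul_lt_iff₀ (by positivity)]
    linarith

variable (F) in
/-- The contribution of the vertex `I` to the volume. -/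
noncomputable def weight (η : Fin d → ℝ) (I : Finset ι) : ℝ :=
  (∏ i ∈ I, if 0 < F.dualVec I i ⬝ᵥ η then (1 : ℝ) else -1) * volume.real (F.cutCone η I 1)

theorem weight_ne_zero {η : Fin d → ℝ} (hη : F.Generic η) {I : Finset ι} (hI : I ∈ F.maxl) :
    F.weight η I ≠ 0 := by
  refine mul_ne_zero (Finset.prod_ne_zero_iff.2 fun i _ => ?_) (volume_cutCone_pos hη hI).ne'
  split_ifs <;> norm_num

theorem prod_eq_indicator_cutCone {H : ι → ℝ} {η : Fin d → ℝ} {I : Finset ι} (hI : I ∈ F.maxl)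
    {x : Fin d → ℝ} {t : ℝ} (hx : -t ≤ η ⬝ᵥ x) :
    ∏ i ∈ I, ((-if H i < F.ray i ⬝ᵥ x then 1 else 0) +
      if 0 < F.dualVec I i ⬝ᵥ η then 1 else 0) =
    (∏ i ∈ I, if 0 < F.dualVec I i ⬝ᵥ η then (1 : ℝ) else -1) *
      (F.cutCone η I (η ⬝ᵥ F.vert H I + t)).indicator 1 (x + -F.vert H I) := by
  classical
  have hfac : ∀ i ∈ I, ((-if H i < F.ray i ⬝ᵥ x then 1 else 0) +
      if 0 < F.dualVec I i ⬝ᵥ η then (1 : ℝ) else 0) =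
      (if 0 < F.dualVec I i ⬝ᵥ η then (1 : ℝ) else -1) *
      if (if 0 < F.dualVec I i ⬝ᵥ η then F.ray i ⬝ᵥ (x + -F.vert H I) ≤ 0 else
        0 < F.ray i ⬝ᵥ (x + -F.vert H I)) then 1 else 0 := by
    intro i hi
    rw [dotProduct_add, dotProduct_neg, ray_vert hI H hi]
    by_cases h1 : 0 < F.dualVec I i ⬝ᵥ η
    · simp only [h1, if_true]
      by_cases h2 : H i < F.ray i ⬝ᵥ x
      · rw [if_pos h2, if_neg (by linarith)]; norm_num
      · rw [if_neg h2, if_pos (by linarith)]; norm_num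
    · simp only [h1, if_false]
      by_cases h2 : H i < F.ray i ⬝ᵥ x
      · rw [if_pos h2, if_pos (by linarith)]; norm_num
      · rw [if_neg h2, if_neg (by linarith)]; norm_num
  rw [Finset.prod_congr rfl hfac, Finset.prod_mul_distrib, Finset.prod_ite_zero,
    Finset.prod_const_one]
  congr 1
  have hlevel : -(η ⬝ᵥ F.vert H I + t) ≤ η ⬝ᵥ (x + -F.vert H I) := by
    rw [dotProduct_add, dotProduct_neg]
    linarith
  by_cases h : x + -F.vert H I ∈ F.cutCone η I (η ⬝ᵥ F.vert H I + t)
  · rw [Set.indicator_of_mem h, if_pos h.1, Pi.one_apply]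
  · rw [Set.indicator_of_notMem h, if_neg fun h' => h ⟨h', hlevel⟩]

theorem dot_le_of_mem_body {H : ι → ℝ} (hne : F.maxl.Nonempty) {x : Fin d → ℝ} (hx : x ∈ F.body H)
    (η : Fin d → ℝ) : ∃ I ∈ F.maxl, η ⬝ᵥ x ≤ η ⬝ᵥ F.vert H I := by
  obtain ⟨I₀, hI₀⟩ := hne
  obtain ⟨I, hI, -, hpos⟩ := F.exists_max η ∅ I₀ hI₀ (Finset.empty_subset _)
  refine ⟨I, hI, sub_nonneg.1 ?_⟩
  rw [dot_vert_sub hI]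
  exact Finset.sum_nonneg fun i hi => mul_nonneg (hpos i (by simpa using hi))
    (sub_nonneg.2 (hx i))

/-- The volume as a sum over the vertices: below the level `η = -t`, where the polytope has no
points, all cones are cut off. -/
theorem volume_body {H : ι → ℝ} (hH : F.Good H) (hne : F.maxl.Nonempty) {η : Fin d → ℝ}
    (hη : F.Generic η) {t : ℝ} (ht : ∀ I ∈ F.maxl, 0 < η ⬝ᵥ F.vert H I + t) :
    (volume (F.body H)).toReal = ∑ I ∈ F.maxl, F.weight η I * (η ⬝ᵥ F.vert H I + t) ^ d := by
  set C : Finset ι → Set (Fin d → ℝ) := fun I =>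
    (fun x => x + -F.vert H I) ⁻¹' F.cutCone η I (η ⬝ᵥ F.vert H I + t) with hC
  have hCm : ∀ I, MeasurableSet (C I) := fun I =>
    (measurableSet_cutCone η I _).preimage (measurable_id.add_const _)
  have hCv : ∀ I ∈ F.maxl, volume (C I) =
      ENNReal.ofReal ((η ⬝ᵥ F.vert H I + t) ^ d) * volume (F.cutCone η I 1) := by
    intro I hI
    rw [hC, measure_preimage_add_right, cutCone_smul η I (ht I hI), Measure.addHaar_smul,
      Module.finrank_fin_fun, abs_of_nonneg (pow_nonneg (ht I hI).le _)]
  have hCfin : ∀ I ∈ F.maxl, volume (C I) ≠ ⊤ := fun I hI => by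
    rw [hCv I hI]
    exact ENNReal.mul_ne_top ENNReal.ofReal_ne_top (cutCone_isBounded hη hI).measure_lt_top.ne
  have hbody : MeasurableSet (F.body H) := by
    rw [body]
    simp only [Set.ofPred_forall]
    exact MeasurableSet.iInter fun i => measurableSet_le
      (Continuous.dotProduct continuous_const continuous_id).measurable measurable_const
  have hpt : ∀ x, (F.body H).indicator (1 : (Fin d → ℝ) → ℝ) x = ∑ I ∈ F.maxl,
      (∏ i ∈ I, if 0 < F.dualVec I i ⬝ᵥ η then (1 : ℝ) else -1) *
        (C I).indicator (1 : (Fin d → ℝ) → ℝ) x := by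
    intro x
    by_cases hx : -t ≤ η ⬝ᵥ x
    · rw [← sum_prod_eq_indicator hH hne hη x]
      exact Finset.sum_congr rfl fun I hI => prod_eq_indicator_cutCone hI hx
    · rw [Set.indicator_of_notMem, Finset.sum_eq_zero]
      · intro I _
        rw [Set.indicator_of_notMem, mul_zero]
        rintro ⟨-, h⟩
        simp only [dotProduct_add, dotProduct_neg] at h
        linarith
      · intro hxb
        obtain ⟨I, hI, h⟩ := dot_le_of_mem_body hne hxb (-η)
        have := ht I hI
        rw [neg_dotProduct, neg_dotProduct] at h
        linarith
  have hint : volume.real (F.body H) = ∫ x, (F.body H).indicator (1 : (Fin d → ℝ) → ℝ) x :=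
    (integral_indicator_one hbody).symm
  rw [← measureReal_def, hint]
  simp_rw [hpt]
  rw [integral_finsetSum]
  · refine Finset.sum_congr rfl fun I hI => ?_
    rw [integral_const_mul, integral_indicator_one (hCm I), measureReal_def, hCv I hI,
      ENNReal.toReal_mul, ENNReal.toReal_ofReal (pow_nonneg (ht I hI).le _), weight,
      measureReal_def]
    ring
  · intro I hI
    exact ((integrable_indicator_iff (hCm I)).2
      (integrableOn_const (hs := hCfin I hI) (by simp))).const_mul _

theorem eventually_good : ∀ᶠ H in 𝓝 F.supp, F.Good H := by
  simp only [Good]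
  rw [Finset.eventually_all]
  intro I hI
  rw [eventually_all]
  intro j
  by_cases hj : j ∈ I
  · simp [hj]
  · have h1 : Continuous fun H : ι → ℝ => F.ray j ⬝ᵥ F.vert H I := by
      simp only [dot_vert]; fun_prop
    have := h1.continuousAt.eventually_lt (continuous_apply j).continuousAt (F.lt_supp I hI j hj)
    filter_upwards [this] with H hH _ using hH

variable (F) in
/-- The affine form `η + t` at the vertex `I`, as a polynomial in the support numbers. -/
noncomputable def vertForm (η : Fin d → ℝ) (t : ℝ) (I : Finset ι) : MvPolynomial ι ℝ :=
  MvPolynomial.C t + ∑ i, MvPolynomial.C (F.dualVec I i ⬝ᵥ η) * MvPolynomial.X i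

variable (F) in
/-- The volume as a polynomial in the support numbers. -/
noncomputable def volPoly (η : Fin d → ℝ) (t : ℝ) : MvPolynomial ι ℝ :=
  ∑ I ∈ F.maxl, MvPolynomial.C (F.weight η I) * F.vertForm η t I ^ d

theorem eval_volPoly (η : Fin d → ℝ) (t : ℝ) (H : ι → ℝ) :
    MvPolynomial.eval H (F.volPoly η t) =
      ∑ I ∈ F.maxl, F.weight η I * (η ⬝ᵥ F.vert H I + t) ^ d := by
  simp only [volPoly, vertForm, map_sum, map_mul, map_pow, map_add, MvPolynomial.eval_C,
    MvPolynomial.eval_X, dot_vert]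
  refine Finset.sum_congr rfl fun I _ => ?_
  rw [add_comm]
  simp only [mul_comm]

theorem exists_volPoly (hne : F.maxl.Nonempty) {η : Fin d → ℝ} (hη : F.Generic η) :
    ∃ t, ∀ᶠ H in 𝓝 F.supp, (volume (F.body H)).toReal = MvPolynomial.eval H (F.volPoly η t) := by
  obtain ⟨I₀, hI₀, hmin⟩ := Finset.exists_min_image F.maxl (fun I => η ⬝ᵥ F.vert F.supp I) hne
  refine ⟨1 - η ⬝ᵥ F.vert F.supp I₀, ?_⟩
  have hpos : ∀ᶠ H in 𝓝 F.supp, ∀ I ∈ F.maxl,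
      0 < η ⬝ᵥ F.vert H I + (1 - η ⬝ᵥ F.vert F.supp I₀) := by
    rw [Finset.eventually_all]
    intro I hI
    have h1 : Continuous fun H : ι → ℝ =>
        η ⬝ᵥ F.vert H I + (1 - η ⬝ᵥ F.vert F.supp I₀) := by
      simp only [dot_vert]; fun_prop
    exact continuousAt_const.eventually_lt h1.continuousAt (by have := hmin I hI; linarith)
  filter_upwards [eventually_good, hpos] with H hH ht
  rw [volume_body hH hne hη ht, eval_volPoly]

end SimpleData

end EdgeSimple

namespace EdgeSimple

/-! ### Differential operators on the volume polynomial -/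

theorem eq_of_eventually_eval_eq {ι : Type} [Fintype ι] {p q : MvPolynomial ι ℝ}
    {x : ι → ℝ} (h : ∀ᶠ y in 𝓝 x, MvPolynomial.eval y p = MvPolynomial.eval y q) : p = q := by
  obtain ⟨ε, hε, hball⟩ := Metric.eventually_nhds_iff_ball.1 h
  refine MvPolynomial.funext_set (s := fun i => Metric.ball (x i) ε) (fun i => ?_) fun y hy => ?_
  · rw [Real.ball_eq_Ioo]; exact Set.Ioo_infinite (by linarith)
  · rw [← ball_pi x hε] at hy
    exact hball y hy

theorem diffOp_mul_apply (σ : Type) (p q f : MvPolynomial σ ℝ) :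
    diffOp σ (p * q) f = diffOp σ p (diffOp σ q f) := by
  rw [map_mul]; rfl

theorem diffOp_C (σ : Type) (a : ℝ) (f : MvPolynomial σ ℝ) :
    diffOp σ (MvPolynomial.C a) f = a • f := by
  rw [← MvPolynomial.algebraMap_eq, AlgHom.commutes]; rfl

theorem totalDegree_diffOp_X_le {σ : Type} (i : σ) (f : MvPolynomial σ ℝ) :
    (diffOp σ (MvPolynomial.X i) f).totalDegree ≤ f.totalDegree - 1 := by
  classical
  rw [diffOp_X]
  rw [← MvPolynomial.support_sum_monomial_coeff f, map_sum]
  refine MvPolynomial.totalDegree_finsetSum_le fun m hm => ?_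
  rw [MvPolynomial.pderiv_monomial]
  by_cases hi : m i = 0
  · simp [hi]
  refine (MvPolynomial.totalDegree_monomial_le _ _).trans ?_
  rw [MvPolynomial.support_sum_monomial_coeff]
  have h1 := MvPolynomial.le_totalDegree hm
  have h2 : (m - Finsupp.single i 1) + Finsupp.single i 1 = m :=
    tsub_add_cancel_of_le (Finsupp.single_le_iff.2 (Nat.one_le_iff_ne_zero.2 hi))
  have h3 : (m - Finsupp.single i 1).degree + 1 = m.degree := by
    conv_rhs => rw [← h2]
    rw [map_add, Finsupp.degree_single]
  change (m - Finsupp.single i 1).degree ≤ _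
  change m.degree ≤ _ at h1
  omega

/-- An operator of order greater than the degree of a polynomial annihilates it. -/
theorem diffOp_eq_zero_of_totalDegree_lt {σ : Type} {q f : MvPolynomial σ ℝ} {k : ℕ}
    (hq : q.IsHomogeneous k) (hf : f.totalDegree < k) : diffOp σ q f = 0 := by
  classical
  have hmon : ∀ (n : ℕ) (m : σ →₀ ℕ) (f : MvPolynomial σ ℝ), m.degree = n → f.totalDegree < n →
      diffOp σ (MvPolynomial.monomial m 1) f = 0 := by
    intro n
    induction n with
    | zero => intro m f _ h; exact absurd h (Nat.not_lt_zero _)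
    | succ n ih =>
      intro m f hm hf
      obtain ⟨i, hi⟩ : ∃ i, m i ≠ 0 := by
        by_contra h
        push Not at h
        have : m = 0 := Finsupp.ext h
        rw [this, map_zero] at hm
        omega
      have h2 : (m - Finsupp.single i 1) + Finsupp.single i 1 = m :=
        tsub_add_cancel_of_le (Finsupp.single_le_iff.2 (Nat.one_le_iff_ne_zero.2 hi))
      have hdeg : (m - Finsupp.single i 1).degree = n := by
        have := congrArg Finsupp.degree h2
        rw [map_add, Finsupp.degree_single, hm] at this
        omega
      have hX : MvPolynomial.monomial m (1 : ℝ) =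
          MvPolynomial.monomial (m - Finsupp.single i 1) 1 * MvPolynomial.X i := by
        rw [MvPolynomial.X, MvPolynomial.monomial_mul, h2, one_mul]
      rw [hX, diffOp_mul_apply]
      rcases Nat.eq_zero_or_pos n with h0 | hpos
      · have h1 : f.totalDegree = 0 := by omega
        rw [MvPolynomial.totalDegree_eq_zero_iff_eq_C.1 h1, diffOp_X, MvPolynomial.pderiv_C,
          map_zero]
      · refine ih _ _ hdeg ?_
        have := totalDegree_diffOp_X_le i f
        omega
  rw [← MvPolynomial.support_sum_monomial_coeff q, map_sum, LinearMap.sum_apply]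
  refine Finset.sum_eq_zero fun m hm => ?_
  have : MvPolynomial.monomial m (q.coeff m) =
      MvPolynomial.C (q.coeff m) * MvPolynomial.monomial m 1 := by
    rw [MvPolynomial.C_mul_monomial, mul_one]
  rw [this, diffOp_mul_apply, hmon k m f ?_ hf, map_zero]
  have := hq (MvPolynomial.mem_support_iff.1 hm)
  rw [Finsupp.degree_eq_weight_one]
  exact this

theorem hasDerivAt_eval_line {ι : Type} [Fintype ι] (p : MvPolynomial ι ℝ) (x w : ι → ℝ) (s : ℝ) :
    HasDerivAt (fun s : ℝ => MvPolynomial.eval (x + s • w) p)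
      (∑ i, w i * MvPolynomial.eval (x + s • w) (MvPolynomial.pderiv i p)) s := by
  classical
  induction p using MvPolynomial.induction_on with
  | C a => simpa using hasDerivAt_const s a
  | add p q hp hq =>
    simp only [map_add, mul_add, Finset.sum_add_distrib]
    exact hp.add hq
  | mul_X p j hp =>
    have h1 : HasDerivAt (fun s : ℝ => x j + s * w j) (w j) s := by
      simpa using ((hasDerivAt_id s).mul_const (w j)).const_add (x j)
    simp only [map_mul, MvPolynomial.eval_X, Pi.add_apply, Pi.smul_apply, smul_eq_mul]
    refine (hp.mul h1).congr_deriv ?_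
    simp only [Derivation.leibniz, MvPolynomial.pderiv_X, smul_eq_mul, map_add, map_mul,
      MvPolynomial.eval_X, mul_add, Finset.sum_add_distrib, Pi.add_apply, Pi.smul_apply]
    rw [add_comm]
    congr 1
    · rw [Finset.sum_eq_single j]
      · simp [mul_comm]
      · intro i _ hi; simp [hi.symm]
      · simp
    · rw [← mul_add, Finset.sum_mul]
      exact Finset.sum_congr rfl fun i _ => by ring

namespace SimpleData

variable {d : ℕ} {ι : Type} [Fintype ι] [DecidableEq ι] {F : SimpleData d ι}

theorem pderiv_vertForm_pow (η : Fin d → ℝ) (t : ℝ) (I : Finset ι) (j : ι) (m : ℕ) :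
    MvPolynomial.pderiv j (F.vertForm η t I ^ m) =
      MvPolynomial.C (m * (F.dualVec I j ⬝ᵥ η)) * F.vertForm η t I ^ (m - 1) := by
  have h : MvPolynomial.pderiv j (F.vertForm η t I) = MvPolynomial.C (F.dualVec I j ⬝ᵥ η) := by
    rw [vertForm, map_add, MvPolynomial.pderiv_C, zero_add, map_sum, Finset.sum_eq_single j]
    · simp
    · intro i _ hi; simp [hi]
    · simp
  rw [Derivation.leibniz_pow, h]
  simp only [nsmul_eq_mul, smul_eq_mul, map_mul, map_natCast]
  ring

theorem diffOp_vertForm_eq_zero {I : Finset ι} (hI : I ∈ F.maxl) {q : MvPolynomial ι ℝ}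
    (hq : face I q = 0) (η : Fin d → ℝ) (t : ℝ) (m : ℕ) :
    diffOp ι q (F.vertForm η t I ^ m) = 0 := by
  rw [face_eq_zero_iff] at hq
  rw [← MvPolynomial.support_sum_monomial_coeff q, map_sum, LinearMap.sum_apply]
  refine Finset.sum_eq_zero fun n hn => ?_
  obtain ⟨j, hj, hjI⟩ := Finset.not_subset.1 (hq n hn)
  obtain ⟨r, hr⟩ : MvPolynomial.X j ∣ MvPolynomial.monomial n (q.coeff n) :=
    MvPolynomial.X_dvd_monomial.2 (Or.inr (Finsupp.mem_support_iff.1 hj))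
  rw [hr, mul_comm, diffOp_mul_apply, diffOp_X, pderiv_vertForm_pow, F.dualVec_off I hI j hjI]
  simp

theorem diffOp_prod_vertForm (η : Fin d → ℝ) (t : ℝ) (I s : Finset ι) (m : ℕ) :
    diffOp ι (∏ i ∈ s, MvPolynomial.X i) (F.vertForm η t I ^ m) =
      MvPolynomial.C (m.descFactorial s.card * ∏ i ∈ s, (F.dualVec I i ⬝ᵥ η)) *
        F.vertForm η t I ^ (m - s.card) := by
  induction s using Finset.induction_on with
  | empty => simp [map_one]
  | insert j s hj ih =>
    rw [Finset.prod_insert hj, diffOp_mul_apply, ih, diffOp_X, Derivation.leibniz,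
      MvPolynomial.pderiv_C, pderiv_vertForm_pow, Finset.card_insert_of_notMem hj,
      Finset.prod_insert hj, Nat.descFactorial_succ, Nat.sub_sub]
    simp only [smul_eq_mul, mul_zero, add_zero, ← mul_assoc, ← map_mul]
    congr 2
    push_cast
    ring

theorem diffOp_volPoly (q : MvPolynomial ι ℝ) (η : Fin d → ℝ) (t : ℝ) :
    diffOp ι q (F.volPoly η t) =
      ∑ I ∈ F.maxl, MvPolynomial.C (F.weight η I) * diffOp ι q (F.vertForm η t I ^ d) := by
  rw [volPoly, map_sum]
  refine Finset.sum_congr rfl fun I _ => ?_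
  rw [← MvPolynomial.smul_eq_C_mul, map_smul, MvPolynomial.smul_eq_C_mul]

theorem diffOp_volPoly_of_mem_srIdeal {q : MvPolynomial ι ℝ} (hq : q ∈ F.srIdeal) (η : Fin d → ℝ)
    (t : ℝ) : diffOp ι q (F.volPoly η t) = 0 := by
  rw [diffOp_volPoly]
  refine Finset.sum_eq_zero fun I hI => ?_
  rw [diffOp_vertForm_eq_zero hI (mem_srIdeal.1 hq I hI), mul_zero]

theorem diffOp_prod_volPoly {I : Finset ι} (hI : I ∈ F.maxl) {η : Fin d → ℝ} (hη : F.Generic η)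
    (t : ℝ) : ∃ a : ℝ, a ≠ 0 ∧
      diffOp ι (∏ i ∈ I, MvPolynomial.X i) (F.volPoly η t) = MvPolynomial.C a := by
  refine ⟨F.weight η I * (d.factorial * ∏ i ∈ I, (F.dualVec I i ⬝ᵥ η)), ?_, ?_⟩
  · refine mul_ne_zero (weight_ne_zero hη hI) (mul_ne_zero (by positivity) ?_)
    exact Finset.prod_ne_zero_iff.2 fun i hi => hη I hI i hi
  · rw [diffOp_volPoly, Finset.sum_eq_single_of_mem I hI]
    · rw [diffOp_prod_vertForm, F.card_eq I hI, Nat.sub_self, pow_zero, mul_one,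
        Nat.descFactorial_self, ← map_mul]
    · intro J hJ hne
      rw [diffOp_vertForm_eq_zero hJ, mul_zero]
      rw [face_prod_X, if_neg]
      exact fun h => hne (Finset.eq_of_subset_of_card_le h
        (by rw [F.card_eq I hI, F.card_eq J hJ])).symm

theorem totalDegree_volPoly_le (η : Fin d → ℝ) (t : ℝ) : (F.volPoly η t).totalDegree ≤ d := by
  refine MvPolynomial.totalDegree_finsetSum_le fun I _ => ?_
  refine (MvPolynomial.totalDegree_mul _ _).trans ?_
  rw [MvPolynomial.totalDegree_C, zero_add]
  refine (MvPolynomial.totalDegree_pow _ _).trans ?_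
  have h : (F.vertForm η t I).totalDegree ≤ 1 := by
    refine (MvPolynomial.totalDegree_add _ _).trans (max_le (by simp) ?_)
    refine MvPolynomial.totalDegree_finsetSum_le fun i _ => ?_
    refine (MvPolynomial.totalDegree_mul _ _).trans ?_
    simp
  calc d * _ ≤ d * 1 := Nat.mul_le_mul_left d h
    _ = d := mul_one d

theorem body_translate (H : ι → ℝ) (a : Fin d → ℝ) :
    volume (F.body (H + fun i => a ⬝ᵥ F.ray i)) = volume (F.body H) := by
  have : F.body (H + fun i => a ⬝ᵥ F.ray i) = (fun x => x + -a) ⁻¹' F.body H := by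
    ext x
    simp only [body, Set.mem_ofPred_eq, Set.mem_preimage, Pi.add_apply, dotProduct_add,
      dotProduct_neg]
    refine forall_congr' fun i => ?_
    rw [dotProduct_comm a]
    constructor <;> intro h <;> linarith
  rw [this, measure_preimage_add_right]

/-- The global linear functions annihilate the volume, because it is translation invariant. -/
theorem diffOp_linForm_eq_zero {p : MvPolynomial ι ℝ}
    (hp : ∀ᶠ H in 𝓝 F.supp, (volume (F.body H)).toReal = MvPolynomial.eval H p)
    (a : Fin d → ℝ) : diffOp ι (F.linForm a) p = 0 := by
  set w : ι → ℝ := fun i => a ⬝ᵥ F.ray i with hw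
  have h1 : diffOp ι (F.linForm a) p = ∑ i, MvPolynomial.C (w i) * MvPolynomial.pderiv i p := by
    rw [linForm, map_sum, LinearMap.sum_apply]
    refine Finset.sum_congr rfl fun i _ => ?_
    rw [diffOp_mul_apply, diffOp_X, diffOp_C, MvPolynomial.smul_eq_C_mul]
  refine eq_of_eventually_eval_eq (x := F.supp) ?_
  filter_upwards [eventually_eventually_nhds.2 hp] with H hH
  have hd := hasDerivAt_eval_line p H w 0
  have hline : Tendsto (fun s : ℝ => H + s • w) (𝓝 0) (𝓝 H) := by
    have : Continuous fun s : ℝ => H + s • w := by fun_prop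
    simpa using this.tendsto 0
  have hconst : (fun s : ℝ => MvPolynomial.eval (H + s • w) p) =ᶠ[𝓝 0]
      fun _ => MvPolynomial.eval H p := by
    filter_upwards [hline.eventually hH] with s hs
    rw [← hs, ← hH.self_of_nhds]
    have := body_translate (F := F) H (s • a)
    have hs' : (fun i => (s • a) ⬝ᵥ F.ray i) = s • w := by
      ext i; simp [hw, smul_dotProduct]
    rw [hs'] at this
    rw [this]
  have h0 := hd.unique
    ((hasDerivAt_const (0:ℝ) (MvPolynomial.eval H p)).congr_of_eventuallyEq hconst)
  rw [h1, map_zero, map_sum]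
  simpa using h0

/-- The annihilator of the volume polynomial is the Stanley–Reisner ideal plus the ideal of global
linear functions. -/
theorem diffOp_eq_zero_iff {p : MvPolynomial ι ℝ} (hne : F.maxl.Nonempty)
    (hp : ∀ᶠ H in 𝓝 F.supp, (volume (F.body H)).toReal = MvPolynomial.eval H p)
    (q : MvPolynomial ι ℝ) : diffOp ι q p = 0 ↔ q ∈ F.srIdeal ⊔ F.linIdeal := by
  obtain ⟨η, hη⟩ := F.dense_generic.nonempty
  obtain ⟨t, ht⟩ := exists_volPoly hne hη
  have hpv : p = F.volPoly η t := by
    refine eq_of_eventually_eval_eq (x := F.supp) ?_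
    filter_upwards [hp, ht] with H h1 h2 using h1.symm.trans h2
  let A : Ideal (MvPolynomial ι ℝ) :=
    { carrier := {q | diffOp ι q p = 0}
      add_mem' := by
        intro a b ha hb
        simp only [Set.mem_ofPred_eq] at ha hb ⊢
        simp [ha, hb]
      zero_mem' := by simp
      smul_mem' := by
        intro a b hb
        simp only [Set.mem_ofPred_eq] at hb ⊢
        rw [smul_eq_mul, diffOp_mul_apply, hb, map_zero] }
  have hA : A = F.srIdeal ⊔ F.linIdeal := by
    refine eq_sup_of_prod_notMem A (fun q hq => ?_) (Ideal.span_le.2 ?_) fun I hI hmem => ?_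
    · change diffOp ι q p = 0
      rw [hpv]; exact diffOp_volPoly_of_mem_srIdeal hq η t
    · rintro _ ⟨a, rfl⟩
      exact diffOp_linForm_eq_zero hp a
    · obtain ⟨a, ha, h⟩ := diffOp_prod_volPoly hI hη t
      change diffOp ι _ p = 0 at hmem
      rw [hpv, h, MvPolynomial.C_eq_zero] at hmem
      exact ha hmem
  rw [← hA]; rfl

/-- The volume polynomial has degree at most `d`, so that operators of order greater than `d`
annihilate it. -/
theorem mem_sup_of_isHomogeneous {k : ℕ} (hne : F.maxl.Nonempty) {q : MvPolynomial ι ℝ}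
    (hq : q.IsHomogeneous k) (hk : d < k) : q ∈ F.srIdeal ⊔ F.linIdeal := by
  obtain ⟨η, hη⟩ := F.dense_generic.nonempty
  obtain ⟨t, ht⟩ := exists_volPoly hne hη
  rw [← diffOp_eq_zero_iff hne ht]
  exact diffOp_eq_zero_of_totalDegree_lt hq ((totalDegree_volPoly_le η t).trans_lt hk)

/-- The top degree component of the face ring modulo linear functions is one-dimensional: the
products of variables over any two maximal cones are proportional. -/
theorem exists_prod_sub_mem (I J : Finset ι) (hI : I ∈ F.maxl) (hJ : J ∈ F.maxl) :
    ∃ a : ℝ, (∏ i ∈ I, MvPolynomial.X i) - MvPolynomial.C a * (∏ i ∈ J, MvPolynomial.X i) ∈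
      F.srIdeal ⊔ F.linIdeal := by
  obtain ⟨η, hη⟩ := F.dense_generic.nonempty
  obtain ⟨t, ht⟩ := exists_volPoly ⟨I, hI⟩ hη
  obtain ⟨a, ha, h1⟩ := diffOp_prod_volPoly hI hη t
  obtain ⟨b, hb, h2⟩ := diffOp_prod_volPoly hJ hη t
  refine ⟨a / b, ?_⟩
  rw [← diffOp_eq_zero_iff ⟨I, hI⟩ ht, map_sub, LinearMap.sub_apply, diffOp_mul_apply, h1, h2,
    diffOp_C, MvPolynomial.smul_eq_C_mul, ← map_mul, div_mul_cancel₀ _ hb, sub_self]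

end SimpleData

end EdgeSimple

namespace EdgeSimple

variable {d : ℕ}

/-! ### The data of a simple polytope -/

/-- A polytope with exactly `d` facets at each vertex. -/
def IsSimplePolytope (P : Set (Fin d → ℝ)) : Prop :=
  IsDPolytope P ∧ ∀ v, IsVertex P v → {F | IsFacet P F ∧ v ∈ F}.ncard = d

theorem finite_isVertex {P : Set (Fin d → ℝ)} (hP : IsDPolytope P) : {v | IsVertex P v}.Finite :=
  Set.Finite.of_finite_image (f := fun v => ({v} : Set (Fin d → ℝ)))
    ((isFace_finite hP).subset (by rintro _ ⟨v, hv, rfl⟩; exact hv))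
    (fun _ _ _ _ h => Set.singleton_injective h)

theorem IsDPolytope.exists_vertex {P : Set (Fin d → ℝ)} (hP : IsDPolytope P) (ζ η : Fin d → ℝ) :
    ∃ v ∈ maxFace P ζ, IsVertex P v ∧ ∀ x ∈ maxFace P ζ, η ⬝ᵥ x ≤ η ⬝ᵥ v := by
  obtain ⟨ξ, hξ⟩ := exists_isNormalSystem P
  have h := hP.eq_hpoly hξ
  have := finite_facet hP
  have := EdgeSimple.exists_vertex (a := ξ) (b := supportNumber P ξ) (h ▸ hP.isCompact)
    (h ▸ hP.nonempty) ζ η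
  rwa [← h] at this

section SimplePolytope

variable {P : Set (Fin d → ℝ)} [Fintype (Facet P)]
  {ξ : Facet P → Fin d → ℝ}

open Classical in
/-- The facets that contain the point `v`. -/
noncomputable def facetsAt (v : Fin d → ℝ) : Finset (Facet P) :=
  Finset.univ.filter fun Γ => v ∈ (Γ : Set (Fin d → ℝ))

theorem mem_facetsAt {v : Fin d → ℝ} {Γ : Facet P} :
    Γ ∈ facetsAt v ↔ v ∈ (Γ : Set (Fin d → ℝ)) := by
  simp [facetsAt]

theorem card_facetsAt (v : Fin d → ℝ) :
    (facetsAt v : Finset (Facet P)).card = {F | IsFacet P F ∧ v ∈ F}.ncard := by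
  have hset : {F | IsFacet P F ∧ v ∈ F} =
      Subtype.val '' ((facetsAt v : Finset (Facet P)) : Set (Facet P)) := by
    ext F
    constructor
    · rintro ⟨hF, hvF⟩
      exact ⟨⟨F, hF⟩, mem_facetsAt.2 hvF, rfl⟩
    · rintro ⟨Γ, hΓ, rfl⟩
      exact ⟨Γ.2, mem_facetsAt.1 hΓ⟩
  rw [hset, Set.ncard_image_of_injective _ Subtype.val_injective, Set.ncard_coe_finset]

theorem IsDPolytope.pinned (hP : IsDPolytope P) (hξ : IsNormalSystem P ξ) {v : Fin d → ℝ}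
    (hv : IsVertex P v) (u : Fin d → ℝ) (hu : ∀ Γ ∈ facetsAt v, ξ Γ ⬝ᵥ u = 0) : u = 0 := by
  have hvP : v ∈ P := IsFace.subset hv (Set.mem_singleton v)
  have hv' : IsVertex (hpoly ξ (supportNumber P ξ)) v := hP.eq_hpoly hξ ▸ hv
  exact pinned_of_isVertex hv' u fun Γ hΓ =>
    hu Γ (mem_facetsAt.2 ((mem_facet_iff hξ hvP).2 hΓ))

theorem IsDPolytope.maxFace_sum_eq (hP : IsDPolytope P) (hξ : IsNormalSystem P ξ)
    {v : Fin d → ℝ} (hv : v ∈ P) {K : Finset (Facet P)} (hK : K ⊆ facetsAt v) :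
    maxFace P (∑ i ∈ K, ξ i) = {x ∈ P | ∀ i ∈ K, ξ i ⬝ᵥ x = supportNumber P ξ i} := by
  have h := hP.eq_hpoly hξ
  have h2 := EdgeSimple.maxFace_sum_eq (a := ξ) (b := supportNumber P ξ) K (h ▸ hv)
    (fun j hj => supportNumber_eq hξ (mem_facetsAt.1 (hK hj)))
  rwa [← h] at h2

/-- Moving from a vertex along the edges that leave the facets from `S`. -/
theorem IsDPolytope.eventually_mem (hP : IsDPolytope P) (hξ : IsNormalSystem P ξ)
    {v : Fin d → ℝ} (hv : v ∈ P) {w : Fin d → ℝ} (hw : ∀ i ∈ facetsAt v, ξ i ⬝ᵥ w ≤ 0) :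
    ∀ᶠ t in 𝓝[>] (0 : ℝ), v + t • w ∈ P := by
  have h := hP.eq_hpoly hξ
  have := eventually_mem_hpoly (a := ξ) (b := supportNumber P ξ) (p := v) (u := w) (h ▸ hv)
    fun i hi => hw i (mem_facetsAt.2 ((mem_facet_iff hξ hv).2 hi))
  rwa [← h] at this

variable [DecidableEq (Facet P)]

theorem IsSimplePolytope.exists_dualVec (hP : IsSimplePolytope P) (hξ : IsNormalSystem P ξ)
    {v : Fin d → ℝ} (hv : IsVertex P v) : ∃ u : Facet P → Fin d → ℝ,
      (∀ i ∉ facetsAt v, u i = 0) ∧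
      (∀ i ∈ facetsAt v, ∀ j ∈ facetsAt v, ξ i ⬝ᵥ u j = if i = j then 1 else 0) ∧
      ∀ x, ∑ i, (u i ⬝ᵥ x) • ξ i = x := by
  obtain ⟨-, u, hoff, hdual, hexp⟩ := exists_dual_basis ξ (facetsAt v)
    (hP.1.pinned hξ hv) (by rw [card_facetsAt, hP.2 v hv])
  refine ⟨u, hoff, hdual, fun x => ?_⟩
  conv_rhs => rw [← hexp x]
  refine (Finset.sum_subset (Finset.subset_univ _) fun i _ hi => ?_).symm
  rw [hoff i hi, zero_dotProduct, zero_smul]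

variable (ξ) in
open Classical in
/-- The vectors dual to the functionals of the facets at the vertex with the facets `I`. -/
noncomputable def dualVecAt (I : Finset (Facet P)) : Facet P → Fin d → ℝ :=
  if h : ∃ u : Facet P → Fin d → ℝ, (∀ i ∉ I, u i = 0) ∧
      (∀ i ∈ I, ∀ j ∈ I, ξ i ⬝ᵥ u j = if i = j then 1 else 0) ∧
      ∀ x, ∑ i, (u i ⬝ᵥ x) • ξ i = x then h.choose else 0

theorem IsSimplePolytope.dualVecAt_spec (hP : IsSimplePolytope P) (hξ : IsNormalSystem P ξ)
    {v : Fin d → ℝ} (hv : IsVertex P v) :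
    (∀ i ∉ facetsAt v, dualVecAt ξ (facetsAt v) i = 0) ∧
      (∀ i ∈ facetsAt v, ∀ j ∈ facetsAt v,
        ξ i ⬝ᵥ dualVecAt ξ (facetsAt v) j = if i = j then 1 else 0) ∧
      ∀ x, ∑ i, (dualVecAt ξ (facetsAt v) i ⬝ᵥ x) • ξ i = x := by
  have h := hP.exists_dualVec hξ hv
  rw [dualVecAt, dif_pos h]
  exact h.choose_spec

theorem IsSimplePolytope.sum_dualVecAt (hP : IsSimplePolytope P) (hξ : IsNormalSystem P ξ)
    {v : Fin d → ℝ} (hv : IsVertex P v) :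
    ∑ i, supportNumber P ξ i • dualVecAt ξ (facetsAt v) i = v := by
  obtain ⟨hoff, hdual, hexp⟩ := hP.dualVecAt_spec hξ hv
  rw [← sub_eq_zero]
  refine hP.1.pinned hξ hv _ fun i hi => ?_
  rw [dotProduct_sub, dotProduct_sum, Finset.sum_eq_single i]
  · rw [dotProduct_smul, hdual i hi i hi, if_pos rfl, smul_eq_mul, mul_one,
      supportNumber_eq hξ (mem_facetsAt.1 hi), sub_self]
  · intro j _ hji
    by_cases hj : j ∈ facetsAt v
    · rw [dotProduct_smul, hdual i hi j hj, if_neg hji.symm, smul_zero]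
    · rw [hoff j hj, smul_zero, dotProduct_zero]
  · simp

/-- The combinatorial data of a simple polytope. -/
noncomputable def IsSimplePolytope.data (hP : IsSimplePolytope P) (hξ : IsNormalSystem P ξ) :
    SimpleData d (Facet P) where
  ray := ξ
  maxl := (finite_isVertex hP.1).toFinset.image facetsAt
  dualVec := dualVecAt ξ
  supp := supportNumber P ξ
  dualVec_off := by
    simp only [Finset.mem_image, Set.Finite.mem_toFinset, Set.mem_ofPred_eq]
    rintro _ ⟨v, hv, rfl⟩
    exact (hP.dualVecAt_spec hξ hv).1
  ray_dualVec := by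
    simp only [Finset.mem_image, Set.Finite.mem_toFinset, Set.mem_ofPred_eq]
    rintro _ ⟨v, hv, rfl⟩
    exact (hP.dualVecAt_spec hξ hv).2.1
  expand := by
    simp only [Finset.mem_image, Set.Finite.mem_toFinset, Set.mem_ofPred_eq]
    rintro _ ⟨v, hv, rfl⟩
    exact (hP.dualVecAt_spec hξ hv).2.2
  card_eq := by
    simp only [Finset.mem_image, Set.Finite.mem_toFinset, Set.mem_ofPred_eq]
    rintro _ ⟨v, hv, rfl⟩
    rw [card_facetsAt, hP.2 v hv]
  lt_supp := by
    simp only [Finset.mem_image, Set.Finite.mem_toFinset, Set.mem_ofPred_eq]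
    rintro _ ⟨v, hv, rfl⟩ j hj
    rw [hP.sum_dualVecAt hξ hv]
    have hvP : v ∈ P := IsFace.subset hv (Set.mem_singleton v)
    refine lt_of_le_of_ne (dot_le_supportNumber hξ j hvP) fun h => hj ?_
    exact mem_facetsAt.2 ((mem_facet_iff hξ hvP).2 h)
  exists_max := by
    simp only [Finset.mem_image, Set.Finite.mem_toFinset, Set.mem_ofPred_eq]
    rintro η K _ ⟨v₀, hv₀, rfl⟩ hK
    have hv₀P : v₀ ∈ P := IsFace.subset hv₀ (Set.mem_singleton v₀)
    obtain ⟨v, hvK, hv, hmax⟩ := hP.1.exists_vertex (∑ i ∈ K, ξ i) η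
    rw [hP.1.maxFace_sum_eq hξ hv₀P hK] at hvK hmax
    have hKv : K ⊆ facetsAt v := fun i hi =>
      mem_facetsAt.2 ((mem_facet_iff hξ hvK.1).2 (hvK.2 i hi))
    refine ⟨_, ⟨v, hv, rfl⟩, hKv, fun j hj => ?_⟩
    rw [Finset.mem_sdiff] at hj
    obtain ⟨-, hdual, -⟩ := hP.dualVecAt_spec hξ hv
    obtain ⟨t, hmem, ht⟩ := ((hP.1.eventually_mem hξ hvK.1
      (w := -dualVecAt ξ (facetsAt v) j) fun i hi => by
        rw [dotProduct_neg, hdual i hi j hj.1]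
        split_ifs <;> norm_num).and self_mem_nhdsWithin).exists
    have hx := hmax _ ⟨hmem, fun i hi => by
      have hij : i ≠ j := fun h => hj.2 (h ▸ hi)
      rw [dotProduct_add, dotProduct_smul, dotProduct_neg, hdual i (hKv hi) j hj.1, if_neg hij,
        neg_zero, smul_zero, add_zero, hvK.2 i hi]⟩
    rw [dotProduct_add, dotProduct_smul, dotProduct_neg, smul_eq_mul, dotProduct_comm η] at hx
    have ht' : (0:ℝ) < t := ht
    rw [dotProduct_comm η] at hx
    nlinarith

theorem IsSimplePolytope.mem_maxl (hP : IsSimplePolytope P) (hξ : IsNormalSystem P ξ)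
    {I : Finset (Facet P)} : I ∈ (hP.data hξ).maxl ↔ ∃ v, IsVertex P v ∧ facetsAt v = I := by
  simp [IsSimplePolytope.data]

theorem IsSimplePolytope.maxl_nonempty (hP : IsSimplePolytope P) (hξ : IsNormalSystem P ξ) :
    (hP.data hξ).maxl.Nonempty := by
  obtain ⟨v, -, hv, -⟩ := hP.1.exists_vertex 0 0
  exact ⟨_, (hP.mem_maxl hξ).2 ⟨v, hv, rfl⟩⟩

end SimplePolytope

namespace SimpleData

variable {ι : Type} [Fintype ι] [DecidableEq ι] (F : SimpleData d ι)

/-- The cone spanned by the rays from `K`. -/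
def cone (K : Finset ι) : Set (Fin d → ℝ) :=
  {x | ∃ c : ι → ℝ, (∀ i, 0 ≤ c i) ∧ (∀ i ∉ K, c i = 0) ∧ ∑ i, c i • F.ray i = x}

/-- The sets of rays that span cones of the fan. -/
def IsCone (K : Finset ι) : Prop := ∃ I ∈ F.maxl, K ⊆ I

variable {F}

theorem ray_mem_cone {K : Finset ι} {i : ι} (hi : i ∈ K) : F.ray i ∈ F.cone K := by
  refine ⟨Pi.single i 1, fun j => ?_, fun j hj => ?_, ?_⟩
  · by_cases h : j = i
    · subst h; simp
    · simp [h]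
  · have : j ≠ i := fun h => hj (h ▸ hi)
    simp [this]
  · rw [Finset.sum_eq_single i] <;> simp +contextual

theorem dualVec_sum {I : Finset ι} (hI : I ∈ F.maxl) {c : ι → ℝ} (hc : ∀ i ∉ I, c i = 0) (j : ι) :
    F.dualVec I j ⬝ᵥ (∑ i, c i • F.ray i) = c j := by
  by_cases hj : j ∈ I
  · rw [dotProduct_sum, Finset.sum_eq_single j]
    · rw [dotProduct_smul, dotProduct_comm, F.ray_dualVec I hI j hj j hj, if_pos rfl, smul_eq_mul,
        mul_one]
    · intro i _ hij
      by_cases hi : i ∈ I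
      · rw [dotProduct_smul, dotProduct_comm, F.ray_dualVec I hI i hi j hj, if_neg hij, smul_zero]
      · rw [hc i hi, zero_smul, dotProduct_zero]
    · simp
  · rw [F.dualVec_off I hI j hj, zero_dotProduct, hc j hj]

theorem finrank_span_cone {K : Finset ι} (hK : F.IsCone K) :
    Module.finrank ℝ (Submodule.span ℝ (F.cone K)) = K.card := by
  obtain ⟨I, hI, hKI⟩ := hK
  have hspan : Submodule.span ℝ (F.cone K) = Submodule.span ℝ (Set.range fun i : K => F.ray i) := by
    refine le_antisymm (Submodule.span_le.2 ?_) (Submodule.span_mono ?_)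
    · rintro _ ⟨c, -, hc, rfl⟩
      refine sum_mem fun i _ => ?_
      by_cases hi : i ∈ K
      · exact Submodule.smul_mem _ _ (Submodule.subset_span ⟨⟨i, hi⟩, rfl⟩)
      · rw [hc i hi, zero_smul]; exact zero_mem _
    · rintro _ ⟨i, rfl⟩
      exact ray_mem_cone i.2
  rw [hspan, finrank_span_eq_card, Fintype.card_coe]
  rw [Fintype.linearIndependent_iff]
  intro g hg j
  have := congrArg (fun x => F.dualVec I j ⬝ᵥ x) hg
  simp only [dotProduct_sum, dotProduct_smul, dotProduct_zero] at this
  rw [Finset.sum_eq_single j] at this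
  · rwa [dotProduct_comm, F.ray_dualVec I hI _ (hKI j.2) _ (hKI j.2), if_pos rfl, smul_eq_mul,
      mul_one] at this
  · intro i _ hij
    rw [dotProduct_comm, F.ray_dualVec I hI _ (hKI i.2) _ (hKI j.2),
      if_neg fun h => hij (Subtype.ext h), smul_zero]
  · simp

end SimpleData

section NormalCone

variable {P : Set (Fin d → ℝ)} [Fintype (Facet P)] [DecidableEq (Facet P)]
  {ξ : Facet P → Fin d → ℝ}

/-- A functional that is maximal at a vertex has nonnegative coordinates with respect to the
functionals of the facets at this vertex. -/
theorem IsSimplePolytope.coord_nonneg (hP : IsSimplePolytope P) (hξ : IsNormalSystem P ξ)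
    {v ζ : Fin d → ℝ} (hv : IsVertex P v) (hζ : v ∈ maxFace P ζ) (i : Facet P) :
    0 ≤ dualVecAt ξ (facetsAt v) i ⬝ᵥ ζ := by
  obtain ⟨hoff, hdual, -⟩ := hP.dualVecAt_spec hξ hv
  by_cases hi : i ∈ facetsAt v
  · obtain ⟨t, hmem, ht⟩ := ((hP.1.eventually_mem hξ hζ.1
      (w := -dualVecAt ξ (facetsAt v) i) fun j hj => by
        rw [dotProduct_neg, hdual j hj i hi]
        split_ifs <;> norm_num).and self_mem_nhdsWithin).exists
    have hx := hζ.2 _ hmem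
    rw [dotProduct_add, dotProduct_smul, dotProduct_neg, smul_eq_mul] at hx
    have ht' : (0:ℝ) < t := ht
    rw [dotProduct_comm]
    nlinarith
  · rw [hoff i hi, zero_dotProduct]

/-- If a functional is maximal at a vertex, then its face lies in the facets that have nonzero
coordinates. -/
theorem IsSimplePolytope.subset_facet (hP : IsSimplePolytope P) (hξ : IsNormalSystem P ξ)
    {v ζ x : Fin d → ℝ} (hv : IsVertex P v) (hζ : v ∈ maxFace P ζ) (hx : x ∈ maxFace P ζ)
    {i : Facet P} (hi : dualVecAt ξ (facetsAt v) i ⬝ᵥ ζ ≠ 0) : x ∈ (i : Set (Fin d → ℝ)) := by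
  have hI : facetsAt v ∈ (hP.data hξ).maxl := (hP.mem_maxl hξ).2 ⟨v, hv, rfl⟩
  have h := SimpleData.dot_vert_sub hI (supportNumber P ξ) ζ x
  have hvert : (hP.data hξ).vert (supportNumber P ξ) (facetsAt v) = v := hP.sum_dualVecAt hξ hv
  rw [hvert, maxFace_const hζ hx, sub_self] at h
  have hnn : ∀ j ∈ facetsAt v, 0 ≤ ((hP.data hξ).dualVec (facetsAt v) j ⬝ᵥ ζ) *
      (supportNumber P ξ j - (hP.data hξ).ray j ⬝ᵥ x) := fun j _ =>
    mul_nonneg (hP.coord_nonneg hξ hv hζ j) (sub_nonneg.2 (dot_le_supportNumber hξ j hx.1))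
  have hiI : i ∈ facetsAt v := by
    by_contra hcon
    rw [(hP.dualVecAt_spec hξ hv).1 i hcon, zero_dotProduct] at hi
    exact hi rfl
  have h0 := (Finset.sum_eq_zero_iff_of_nonneg hnn).1 h.symm i hiI
  rcases mul_eq_zero.1 h0 with h1 | h1
  · exact absurd h1 hi
  · exact (mem_facet_iff hξ hx.1).2 (sub_eq_zero.1 h1).symm

theorem IsSimplePolytope.normalCone_eq_cone (hP : IsSimplePolytope P) (hξ : IsNormalSystem P ξ)
    {G : Set (Fin d → ℝ)} {v : Fin d → ℝ} (hv : IsVertex P v) (hvG : v ∈ G) (hG : G ⊆ P)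
    {K : Finset (Facet P)} (hK : ∀ i, i ∈ K ↔ G ⊆ (i : Set (Fin d → ℝ))) :
    normalCone P G = (hP.data hξ).cone K := by
  ext ζ
  constructor
  · intro hζ
    refine ⟨fun i => dualVecAt ξ (facetsAt v) i ⬝ᵥ ζ, hP.coord_nonneg hξ hv (hζ hvG),
      fun i hi => ?_, (hP.dualVecAt_spec hξ hv).2.2 ζ⟩
    by_contra hne
    exact hi ((hK i).2 fun x hx => hP.subset_facet hξ hv (hζ hvG) (hζ hx) hne)
  · rintro ⟨c, hc, hcK, rfl⟩ x hx
    refine ⟨hG hx, fun y hy => ?_⟩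
    rw [sum_dotProduct, sum_dotProduct]
    refine Finset.sum_le_sum fun i _ => ?_
    rw [smul_dotProduct, smul_dotProduct]
    by_cases hi : i ∈ K
    · refine mul_le_mul_of_nonneg_left ?_ (hc i)
      change ξ i ⬝ᵥ y ≤ ξ i ⬝ᵥ x
      rw [supportNumber_eq hξ ((hK i).1 hi hx)]
      exact dot_le_supportNumber hξ i hy
    · rw [hcK i hi]; simp

/-- Near the vertex `v`, the face of the facets from `K ⊆ facetsAt v` contains a point that belongs
to no other facet. -/
theorem IsSimplePolytope.exists_mem_face (hP : IsSimplePolytope P) (hξ : IsNormalSystem P ξ)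
    {v : Fin d → ℝ} (hv : IsVertex P v) {K : Finset (Facet P)} (hK : K ⊆ facetsAt v) :
    ∃ p ∈ maxFace P (∑ i ∈ K, ξ i), ∀ i : Facet P, p ∈ (i : Set (Fin d → ℝ)) → i ∈ K := by
  have hvP : v ∈ P := IsFace.subset hv (Set.mem_singleton v)
  obtain ⟨hoff, hdual, -⟩ := hP.dualVecAt_spec hξ hv
  set w : Fin d → ℝ := -∑ j ∈ facetsAt v \ K, dualVecAt ξ (facetsAt v) j with hw
  have hξw : ∀ i ∈ facetsAt v, ξ i ⬝ᵥ w = if i ∈ K then 0 else -1 := by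
    intro i hi
    rw [hw, dotProduct_neg, dotProduct_sum]
    have h1 : ∀ j ∈ facetsAt v \ K, ξ i ⬝ᵥ dualVecAt ξ (facetsAt v) j = if i = j then 1 else 0 :=
      fun j hj => hdual i hi j (Finset.mem_sdiff.1 hj).1
    rw [Finset.sum_congr rfl h1, Finset.sum_ite_eq]
    by_cases hiK : i ∈ K
    · simp [hiK]
    · simp [hiK, hi]
  have hstrict : ∀ᶠ t in 𝓝[>] (0 : ℝ), ∀ i ∉ facetsAt v, ξ i ⬝ᵥ (v + t • w) <
      supportNumber P ξ i := by
    rw [eventually_all]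
    intro i
    by_cases hi : i ∈ facetsAt v
    · simp [hi]
    have hlt : ξ i ⬝ᵥ v < supportNumber P ξ i :=
      lt_of_le_of_ne (dot_le_supportNumber hξ i hvP) fun h =>
        hi (mem_facetsAt.2 ((mem_facet_iff hξ hvP).2 h))
    have hc : ContinuousAt (fun t : ℝ => ξ i ⬝ᵥ (v + t • w)) 0 := by
      have : Continuous fun t : ℝ => v + t • w := by fun_prop
      exact ((continuous_dot (ξ i)).comp this).continuousAt
    have := hc.eventually_lt (continuousAt_const (y := supportNumber P ξ i)) (by simpa using hlt)
    exact (this.filter_mono nhdsWithin_le_nhds).mono fun t ht _ => ht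
  obtain ⟨t, ⟨hmem, hst⟩, ht⟩ := (((hP.1.eventually_mem hξ hvP (w := w) fun i hi => by
    rw [hξw i hi]; split_ifs <;> norm_num).and hstrict).and self_mem_nhdsWithin).exists
  have ht' : (0:ℝ) < t := ht
  have hval : ∀ i ∈ facetsAt v, ξ i ⬝ᵥ (v + t • w) =
      supportNumber P ξ i + t * if i ∈ K then 0 else -1 := fun i hi => by
    rw [dotProduct_add, dotProduct_smul, smul_eq_mul, hξw i hi,
      supportNumber_eq hξ (mem_facetsAt.1 hi)]
  refine ⟨v + t • w, ?_, fun i hi => ?_⟩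
  · rw [hP.1.maxFace_sum_eq hξ hvP hK]
    refine ⟨hmem, fun i hi => ?_⟩
    rw [hval i (hK hi), if_pos hi, mul_zero, add_zero]
  · rw [mem_facet_iff hξ hmem] at hi
    by_contra hiK
    by_cases hiv : i ∈ facetsAt v
    · rw [hval i hiv, if_neg hiK] at hi
      linarith
    · exact (hst i hiv).ne hi

theorem IsSimplePolytope.normalCone_maxFace_sum (hP : IsSimplePolytope P)
    (hξ : IsNormalSystem P ξ) {v : Fin d → ℝ} (hv : IsVertex P v) {K : Finset (Facet P)}
    (hK : K ⊆ facetsAt v) :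
    normalCone P (maxFace P (∑ i ∈ K, ξ i)) = (hP.data hξ).cone K := by
  have hvP : v ∈ P := IsFace.subset hv (Set.mem_singleton v)
  obtain ⟨p, hp, hpK⟩ := hP.exists_mem_face hξ hv hK
  refine hP.normalCone_eq_cone hξ hv ?_ (fun x hx => hx.1) fun i =>
    ⟨fun hi x hx => ?_, fun h => hpK i (h hp)⟩
  · rw [hP.1.maxFace_sum_eq hξ hvP hK]
    exact ⟨hvP, fun i hi => supportNumber_eq hξ (mem_facetsAt.1 (hK hi))⟩
  · rw [hP.1.maxFace_sum_eq hξ hvP hK] at hx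
    exact (mem_facet_iff hξ hx.1).2 (hx.2 i hi)

/-- The cones of the dual fan of a simple polytope. -/
theorem IsSimplePolytope.mem_dualFan (hP : IsSimplePolytope P) (hξ : IsNormalSystem P ξ)
    {C : Set (Fin d → ℝ)} :
    C ∈ dualFan P ↔ ∃ K, (hP.data hξ).IsCone K ∧ C = (hP.data hξ).cone K := by
  classical
  constructor
  · rintro ⟨G, hG, rfl⟩
    obtain ⟨-, ζ, rfl⟩ := id hG
    obtain ⟨v, hvG, hv, -⟩ := hP.1.exists_vertex ζ 0
    refine ⟨Finset.univ.filter fun i : Facet P => maxFace P ζ ⊆ i, ⟨facetsAt v,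
      (hP.mem_maxl hξ).2 ⟨v, hv, rfl⟩, fun i hi => ?_⟩,
      hP.normalCone_eq_cone hξ hv hvG (fun x hx => hx.1) (by simp)⟩
    exact mem_facetsAt.2 ((Finset.mem_filter.1 hi).2 hvG)
  · rintro ⟨K, ⟨I, hI, hK⟩, rfl⟩
    obtain ⟨v, hv, rfl⟩ := (hP.mem_maxl hξ).1 hI
    refine ⟨_, ⟨?_, _, rfl⟩, (hP.normalCone_maxFace_sum hξ hv hK).symm⟩
    exact maxFace_nonempty hP.1.isCompact hP.1.nonempty _

end NormalCone

end EdgeSimple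

namespace EdgeSimple

/-! ### The geometry of the resolution -/

section Resolution

variable {d : ℕ} {Δ : Set (Fin d → ℝ)} {n : (Fin d → ℝ) → (Fin d → ℝ)} {c : (Fin d → ℝ) → ℝ}

theorem finite_isNonsimpleVertex (hΔ : IsDPolytope Δ) : Finite {v // IsNonsimpleVertex Δ v} :=
  (finite_isVertex hΔ).subset fun _ hv => hv.1

theorem IsVertex.mem {P : Set (Fin d → ℝ)} {v : Fin d → ℝ} (hv : IsVertex P v) : v ∈ P :=
  IsFace.subset hv (Set.mem_singleton v)

/-- The functionals of the inequalities that define the resolution. -/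
def resNormal (ξ : Facet Δ → Fin d → ℝ) (n : (Fin d → ℝ) → (Fin d → ℝ)) :
    Facet Δ ⊕ {v // IsNonsimpleVertex Δ v} → Fin d → ℝ := Sum.elim ξ fun v => n v

/-- The right-hand sides of the inequalities that define the resolution. -/
noncomputable def resBound (ξ : Facet Δ → Fin d → ℝ) (c : (Fin d → ℝ) → ℝ) :
    Facet Δ ⊕ {v // IsNonsimpleVertex Δ v} → ℝ := Sum.elim (supportNumber Δ ξ) fun v => c v

theorem resolution_eq_hpoly (hΔ : IsDPolytope Δ) {ξ : Facet Δ → Fin d → ℝ}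
    (hξ : IsNormalSystem Δ ξ) :
    resolution Δ n c = hpoly (resNormal ξ n) (resBound ξ c) := by
  ext x
  have h := Set.ext_iff.1 (hΔ.eq_hpoly hξ) x
  simp only [resolution, hpoly, Set.mem_ofPred_eq, Sum.forall, resNormal, resBound, Sum.elim_inl,
    Sum.elim_inr, Subtype.forall] at h ⊢
  rw [h]

/-- A face of positive dimension contains a point that lies in no closed cut off part. It can be
found on the segment between two vertices of the face, because the parts cut off at its ends are
disjoint and closed. -/
theorem exists_mem_face_lt (hΔ : IsDPolytope Δ) (hcut : IsCut Δ n c) {ζ : Fin d → ℝ}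
    (hne : ∀ v, maxFace Δ ζ ≠ {v}) :
    ∃ p ∈ maxFace Δ ζ, ∀ v, IsNonsimpleVertex Δ v → n v ⬝ᵥ p < c v := by
  obtain ⟨w₁, hw₁, hv₁, -⟩ := hΔ.exists_vertex ζ 0
  obtain ⟨x, hx, hxw⟩ : ∃ x ∈ maxFace Δ ζ, x ≠ w₁ := by
    by_contra hcon
    push Not at hcon
    exact hne w₁ (Set.eq_singleton_iff_unique_mem.2 ⟨hw₁, hcon⟩)
  obtain ⟨w₂, hw₂, hv₂, hmax⟩ := hΔ.exists_vertex ζ (x - w₁)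
  have hw : w₂ ≠ w₁ := by
    rintro rfl
    have h1 := hmax x hx
    have h2 : (x - w₂) ⬝ᵥ (x - w₂) ≤ 0 := by rw [dotProduct_sub]; linarith
    have h3 : (x - w₂) ⬝ᵥ (x - w₂) = 0 :=
      le_antisymm h2 (Finset.sum_nonneg fun i _ => mul_self_nonneg _)
    exact hxw (sub_eq_zero.1 (dotProduct_self_eq_zero.1 h3))
  by_cases h1 : IsNonsimpleVertex Δ w₁
  swap
  · exact ⟨w₁, hw₁, fun v hv => (hcut.1 v hv).2 w₁ hv₁ fun h => h1 (h ▸ hv)⟩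
  by_cases h2 : IsNonsimpleVertex Δ w₂
  swap
  · exact ⟨w₂, hw₂, fun v hv => (hcut.1 v hv).2 w₂ hv₂ fun h => h2 (h ▸ hv)⟩
  -- the point of the segment on the hyperplane of `w₁`, moved slightly towards `w₂`
  set α := n w₁ ⬝ᵥ w₁ - c w₁ with hα
  set β := c w₁ - n w₁ ⬝ᵥ w₂ with hβ
  have hα0 : 0 < α := sub_pos.2 (hcut.1 w₁ h1).1
  have hβ0 : 0 < β := sub_pos.2 ((hcut.1 w₁ h1).2 w₂ hv₂ hw)
  have hconv : Convex ℝ (maxFace Δ ζ) := (isExposed_maxFace Δ ζ).convex hΔ.convex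
  set t₀ := α / (α + β) with ht₀
  have ht₀0 : 0 < t₀ := by positivity
  have ht₀1 : t₀ < 1 := by rw [ht₀, div_lt_one (by positivity)]; linarith
  have hseg : ∀ t : ℝ, 0 ≤ t → t ≤ 1 → (1 - t) • w₁ + t • w₂ ∈ maxFace Δ ζ := fun t h0 h1 =>
    hconv hw₁ hw₂ (by linarith) h0 (by ring)
  have hval : ∀ (v : Fin d → ℝ) (t : ℝ), n v ⬝ᵥ ((1 - t) • w₁ + t • w₂) =
      (1 - t) * (n v ⬝ᵥ w₁) + t * (n v ⬝ᵥ w₂) := fun v t => by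
    rw [dotProduct_add, dotProduct_smul, dotProduct_smul, smul_eq_mul, smul_eq_mul]
  have hon : n w₁ ⬝ᵥ ((1 - t₀) • w₁ + t₀ • w₂) = c w₁ := by
    have e1 : n w₁ ⬝ᵥ w₁ = c w₁ + α := by rw [hα]; ring
    have e2 : n w₁ ⬝ᵥ w₂ = c w₁ - β := by rw [hβ]; ring
    rw [hval, e1, e2, ht₀]
    field_simp
    ring
  have hw₂lt : n w₂ ⬝ᵥ ((1 - t₀) • w₁ + t₀ • w₂) < c w₂ :=
    hcut.2 w₁ w₂ h1 h2 hw.symm _ (hseg t₀ ht₀0.le ht₀1.le).1 hon.ge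
  have hcont : ContinuousAt (fun t : ℝ => n w₂ ⬝ᵥ ((1 - t) • w₁ + t • w₂)) t₀ := by
    have : Continuous fun t : ℝ => (1 - t) • w₁ + t • w₂ := by fun_prop
    exact ((continuous_dot (n w₂)).comp this).continuousAt
  have hev1 := (hcont.eventually_lt (continuousAt_const (y := c w₂)) hw₂lt).filter_mono
    (nhdsWithin_le_nhds (s := Set.Ioi t₀))
  have hev2 : ∀ᶠ t in 𝓝[>] t₀, t < 1 := (Iio_mem_nhds ht₀1 |> mem_nhdsWithin_of_mem_nhds)
  obtain ⟨t, ⟨ht2, ht1⟩, htt⟩ := ((hev1.and hev2).and self_mem_nhdsWithin).exists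
  have htt' : t₀ < t := htt
  refine ⟨_, hseg t (by linarith) ht1.le, fun v hv => ?_⟩
  by_cases hvw₁ : v = w₁
  · subst hvw₁
    have : n v ⬝ᵥ ((1 - t) • v + t • w₂) = n v ⬝ᵥ ((1 - t₀) • v + t₀ • w₂) -
        (t - t₀) * (α + β) := by
      rw [hval, hval, hα, hβ]; ring
    rw [this, hon]
    have : 0 < (t - t₀) * (α + β) := mul_pos (by linarith) (by linarith)
    linarith
  by_cases hvw₂ : v = w₂
  · subst hvw₂; exact ht2
  · rw [hval]
    have e1 := (hcut.1 v hv).2 w₁ hv₁ (Ne.symm hvw₁)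
    have e2 := (hcut.1 v hv).2 w₂ hv₂ (Ne.symm hvw₂)
    have : (1 - t) * (n v ⬝ᵥ w₁) < (1 - t) * c v := mul_lt_mul_of_pos_left e1 (by linarith)
    have : t * (n v ⬝ᵥ w₂) < t * c v := mul_lt_mul_of_pos_left e2 (by linarith)
    linarith

theorem ne_singleton_of_isNonsimpleVertex (hΔ : IsDPolytope Δ) {v : Fin d → ℝ}
    (hv : IsNonsimpleVertex Δ v) (w : Fin d → ℝ) : Δ ≠ {w} := by
  rintro rfl
  have h1 := vectorSpan_eq_top hΔ.2
  rw [vectorSpan_singleton] at h1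
  have h2 : Module.finrank ℝ (⊥ : Submodule ℝ (Fin d → ℝ)) = d := by
    rw [h1, finrank_top, Module.finrank_fin_fun]
  rw [finrank_bot] at h2
  apply hv.2
  have : {F | IsFacet {w} F ∧ v ∈ F} = ∅ := by
    ext F
    simp only [Set.mem_ofPred_eq, Set.mem_empty_iff_false, iff_false]
    rintro ⟨⟨-, h⟩, -⟩
    omega
  rw [this, Set.ncard_empty, h2]

theorem exists_mem_lt (hΔ : IsDPolytope Δ) (hcut : IsCut Δ n c) :
    ∃ p ∈ Δ, ∀ v, IsNonsimpleVertex Δ v → n v ⬝ᵥ p < c v := by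
  by_cases h : ∃ v, IsNonsimpleVertex Δ v
  · obtain ⟨v, hv⟩ := h
    have h0 : maxFace Δ (0 : Fin d → ℝ) = Δ := by ext; simp [maxFace]
    have := exists_mem_face_lt hΔ hcut (ζ := 0)
      (by rw [h0]; exact ne_singleton_of_isNonsimpleVertex hΔ hv)
    rwa [h0] at this
  · obtain ⟨p, hp⟩ := hΔ.nonempty
    exact ⟨p, hp, fun v hv => absurd ⟨v, hv⟩ h⟩

theorem eventually_lt_cut (hΔ : IsDPolytope Δ) {p : Fin d → ℝ}
    (hlt : ∀ v, IsNonsimpleVertex Δ v → n v ⬝ᵥ p < c v) (u : Fin d → ℝ) :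
    ∀ᶠ t in 𝓝[>] (0 : ℝ), ∀ v, IsNonsimpleVertex Δ v → n v ⬝ᵥ (p + t • u) < c v := by
  have := finite_isNonsimpleVertex hΔ
  have h : ∀ᶠ t in 𝓝[>] (0 : ℝ), ∀ v : {v // IsNonsimpleVertex Δ v}, n v ⬝ᵥ (p + t • u) < c v := by
    rw [eventually_all]
    rintro ⟨v, hv⟩
    have hc : ContinuousAt (fun t : ℝ => n v ⬝ᵥ (p + t • u)) 0 := by
      have : Continuous fun t : ℝ => p + t • u := by fun_prop
      exact ((continuous_dot (n v)).comp this).continuousAt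
    exact (hc.eventually_lt (continuousAt_const (y := c v)) (by simpa using hlt v hv)).filter_mono
      nhdsWithin_le_nhds
  exact h.mono fun t ht v hv => ht ⟨v, hv⟩

/-- Near a point that lies in no cutting hyperplane, the resolution coincides with the polytope. -/
theorem exists_mem_resolution (hΔ : IsDPolytope Δ) {p y : Fin d → ℝ} (hp : p ∈ Δ) (hy : y ∈ Δ)
    (hlt : ∀ v, IsNonsimpleVertex Δ v → n v ⬝ᵥ p < c v) :
    ∃ t : ℝ, 0 < t ∧ t ≤ 1 ∧ p + t • (y - p) ∈ resolution Δ n c := by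
  have h1 : ∀ᶠ t in 𝓝[>] (0 : ℝ), t < 1 := mem_nhdsWithin_of_mem_nhds (Iio_mem_nhds one_pos)
  obtain ⟨t, ⟨h2, h3⟩, h4⟩ := (((eventually_lt_cut hΔ hlt (y - p)).and h1).and
    self_mem_nhdsWithin).exists
  have h4' : (0:ℝ) < t := h4
  exact ⟨t, h4', h3.le, hΔ.convex.add_smul_sub_mem hp hy ⟨h4'.le, h3.le⟩,
    fun v hv => (h2 v hv).le⟩

theorem resolution_subset : resolution Δ n c ⊆ Δ := fun _ hx => hx.1

theorem isDPolytope_resolution (hΔ : IsDPolytope Δ) (hcut : IsCut Δ n c) :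
    IsDPolytope (resolution Δ n c) := by
  obtain ⟨ξ, hξ⟩ := exists_isNormalSystem Δ
  have := finite_facet hΔ
  have := finite_isNonsimpleVertex hΔ
  have heq := resolution_eq_hpoly (n := n) (c := c) hΔ hξ
  rw [heq]
  refine isDPolytope_hpoly ?_ ?_
  · rw [← heq]
    refine hΔ.isCompact.of_isClosed_subset ?_ resolution_subset
    rw [heq]; exact isClosed_hpoly
  · rw [← heq]
    obtain ⟨p, hp, hlt⟩ := exists_mem_lt hΔ hcut
    obtain ⟨y, hy⟩ := hΔ.2
    have h1 : ∀ᶠ t in 𝓝[>] (0 : ℝ), t < 1 := mem_nhdsWithin_of_mem_nhds (Iio_mem_nhds one_pos)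
    obtain ⟨t, ⟨h2, h3⟩, h4⟩ := (((eventually_lt_cut hΔ hlt (y - p)).and h1).and
      self_mem_nhdsWithin).exists
    have h4' : (0:ℝ) < t := h4
    have hint : p + t • (y - p) ∈ interior Δ :=
      hΔ.convex.add_smul_sub_mem_interior hp hy ⟨h4', h3.le⟩
    refine ⟨p + t • (y - p), mem_interior.2 ⟨interior Δ ∩
      {x | ∀ v : {v // IsNonsimpleVertex Δ v}, n v ⬝ᵥ x < c v}, ?_, ?_, hint, fun v => h2 v v.2⟩⟩
    · exact fun x hx => ⟨interior_subset hx.1, fun v hv => (hx.2 ⟨v, hv⟩).le⟩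
    · refine isOpen_interior.inter ?_
      simp only [Set.ofPred_forall]
      exact isOpen_iInter_of_finite fun v => isOpen_lt (continuous_dot _) continuous_const

/-- The functional `ζ` has the same normal cone for its faces of `Δ` and of the resolution, provided
that the face of `Δ` contains a point that lies in no cutting hyperplane. -/
theorem normalCone_resolution (hΔ : IsDPolytope Δ) {ζ p : Fin d → ℝ} (hp : p ∈ maxFace Δ ζ)
    (hlt : ∀ v, IsNonsimpleVertex Δ v → n v ⬝ᵥ p < c v) :
    p ∈ maxFace (resolution Δ n c) ζ ∧
    normalCone (resolution Δ n c) (maxFace (resolution Δ n c) ζ) = normalCone Δ (maxFace Δ ζ) := by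
  have hpS : p ∈ resolution Δ n c := ⟨hp.1, fun v hv => (hlt v hv).le⟩
  have hpm : p ∈ maxFace (resolution Δ n c) ζ := ⟨hpS, fun y hy => hp.2 y hy.1⟩
  refine ⟨hpm, ?_⟩
  ext η
  constructor
  · intro hη
    have hpη : ∀ y ∈ Δ, η ⬝ᵥ y ≤ η ⬝ᵥ p := by
      intro y hy
      obtain ⟨t, ht, -, hmem⟩ := exists_mem_resolution hΔ hp.1 hy hlt
      have h1 := (hη hpm).2 _ hmem
      rw [dotProduct_add, dotProduct_smul, smul_eq_mul, dotProduct_sub] at h1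
      nlinarith
    intro y hy
    refine ⟨hy.1, fun z hz => (hpη z hz).trans ?_⟩
    obtain ⟨t, ht, -, hmem⟩ := exists_mem_resolution hΔ hp.1 hy.1 hlt
    have hyp : ζ ⬝ᵥ y = ζ ⬝ᵥ p := maxFace_const hy hp
    have hm : p + t • (y - p) ∈ maxFace (resolution Δ n c) ζ := by
      refine ⟨hmem, fun z hz => ?_⟩
      rw [dotProduct_add, dotProduct_smul, dotProduct_sub, hyp, sub_self, smul_zero, add_zero]
      exact hp.2 z hz.1
    have h1 := (hη hm).2 _ hpS
    rw [dotProduct_add, dotProduct_smul, smul_eq_mul, dotProduct_sub] at h1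
    nlinarith
  · intro hη x hx
    have hxΔ : x ∈ maxFace Δ ζ := ⟨hx.1.1, fun y hy => by
      rw [maxFace_const hx hpm]; exact hp.2 y hy⟩
    exact ⟨hx.1, fun y hy => (hη hxΔ).2 y hy.1⟩

/-- The normal cone of a vertex is full-dimensional. -/
theorem span_normalCone_singleton (hΔ : IsDPolytope Δ) {v : Fin d → ℝ} (hv : IsVertex Δ v) :
    Submodule.span ℝ (normalCone Δ {v}) = ⊤ := by
  obtain ⟨ξ, hξ⟩ := exists_isNormalSystem Δ
  have := finite_facet hΔ
  have := Fintype.ofFinite (Facet Δ)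
  refine eq_top_of_dot fun u hu => hΔ.pinned hξ hv u fun Γ hΓ => ?_
  rw [dotProduct_comm]
  refine hu _ (Submodule.subset_span ?_)
  rintro x rfl
  rw [← hξ Γ]
  exact mem_facetsAt.1 hΓ

theorem skeleton_subset (hΔ : IsDPolytope Δ) (hcut : IsCut Δ n c) {C : Set (Fin d → ℝ)}
    (hC : C ∈ skeleton (dualFan Δ)) : ∃ ζ p, p ∈ maxFace (resolution Δ n c) ζ ∧
      (∀ v, IsNonsimpleVertex Δ v → n v ⬝ᵥ p < c v) ∧
      C = normalCone (resolution Δ n c) (maxFace (resolution Δ n c) ζ) := by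
  obtain ⟨⟨F, hF, rfl⟩, hdim⟩ := hC
  obtain ⟨-, ζ, rfl⟩ := id hF
  have hne : ∀ v, maxFace Δ ζ ≠ {v} := by
    intro v hv
    rw [hv] at hF hdim
    rw [span_normalCone_singleton hΔ hF, finrank_top, Module.finrank_fin_fun] at hdim
    exact lt_irrefl _ hdim
  obtain ⟨p, hp, hlt⟩ := exists_mem_face_lt hΔ hcut hne
  obtain ⟨h1, h2⟩ := normalCone_resolution hΔ hp hlt
  exact ⟨ζ, p, h1, hlt, h2.symm⟩

/-- The `d-1`-skeleton of the dual fan of the polytope is a part of the dual fan of the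
resolution. -/
theorem skeleton_subset_dualFan (hΔ : IsDPolytope Δ) (hcut : IsCut Δ n c) :
    skeleton (dualFan Δ) ⊆ dualFan (resolution Δ n c) := by
  intro C hC
  obtain ⟨ζ, p, hp, -, rfl⟩ := skeleton_subset hΔ hcut hC
  exact ⟨_, ⟨⟨p, hp⟩, ζ, rfl⟩, rfl⟩

/-- At most `d` of the inequalities of the resolution are equalities at a vertex. On a cutting
hyperplane, the remaining ones define an edge of the polytope. -/
theorem card_active_le (hΔ : IsDPolytope Δ) (hedge : SimpleInEdges Δ) (hcut : IsCut Δ n c)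
    {ξ : Facet Δ → Fin d → ℝ} (hξ : IsNormalSystem Δ ξ) [Fintype (Facet Δ)]
    [Fintype {v // IsNonsimpleVertex Δ v}] {v : Fin d → ℝ}
    (hv : IsVertex (resolution Δ n c) v) :
    ∃ A : Finset (Facet Δ ⊕ {v // IsNonsimpleVertex Δ v}),
      (∀ j, j ∈ A ↔ resNormal ξ n j ⬝ᵥ v = resBound ξ c j) ∧ A.card ≤ d := by
  classical
  have heq := resolution_eq_hpoly (n := n) (c := c) hΔ hξ
  have hpin : Pinned (resNormal ξ n) (resBound ξ c) v := pinned_of_isVertex (heq ▸ hv)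
  have hvS := hv.mem
  have hvΔ : v ∈ Δ := hvS.1
  let L : Finset (Facet Δ) := facetsAt v
  let R : Finset {v // IsNonsimpleVertex Δ v} := Finset.univ.filter fun w => n w ⬝ᵥ v = c w
  have hLcard : L.card = {F | IsFacet Δ F ∧ v ∈ F}.ncard := card_facetsAt v
  have hL : ∀ Γ, Γ ∈ L ↔ ξ Γ ⬝ᵥ v = supportNumber Δ ξ Γ := fun Γ =>
    mem_facetsAt.trans (mem_facet_iff hξ hvΔ)
  have hR : ∀ w : {v // IsNonsimpleVertex Δ v}, w ∈ R ↔ n w ⬝ᵥ v = c w := fun w => by simp [R]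
  have hA : ∀ j, j ∈ L.disjSum R ↔ resNormal ξ n j ⬝ᵥ v = resBound ξ c j := by
    rintro (j | j)
    · rw [Finset.inl_mem_disjSum, hL]; rfl
    · rw [Finset.inr_mem_disjSum, hR]; rfl
  refine ⟨L.disjSum R, hA, ?_⟩
  rw [Finset.card_disjSum]
  have hR1 : R.card ≤ 1 := by
    rw [Finset.card_le_one]
    intro w hw w' hw'
    by_contra hne
    have := hcut.2 w w' w.2 w'.2 (fun h => hne (Subtype.ext h)) v hvΔ ((hR w).1 hw).ge
    exact this.ne ((hR w').1 hw')
  have hΔeq := hΔ.eq_hpoly hξ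
  -- a vertex of `Δ` in the resolution is simple and lies in no cutting hyperplane
  have hvert : IsVertex Δ v → L.card = d ∧ R = ∅ := by
    intro hvert
    have hns : ¬ IsNonsimpleVertex Δ v := fun h => by
      have h1 := (hcut.1 v h).1
      have h2 := hvS.2 v h
      linarith
    refine ⟨?_, ?_⟩
    · rw [hLcard]
      by_contra h
      exact hns ⟨hvert, h⟩
    · rw [Finset.eq_empty_iff_forall_notMem]
      intro w hw
      have hvw : v ≠ w := by rintro rfl; exact hns w.2
      exact ((hcut.1 w w.2).2 v hvert hvw).ne ((hR w).1 hw)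
  by_cases hR0 : R = ∅
  · have : IsVertex Δ v := by
      rw [hΔeq]
      refine isVertex_of_pinned (hΔeq ▸ hvΔ) fun u hu => hpin u ?_
      rintro (j | j) hj
      · exact hu j hj
      · have := (hR j).2 hj
        rw [hR0] at this
        exact absurd this (Finset.notMem_empty _)
    rw [(hvert this).1, hR0, Finset.card_empty]
    exact le_refl d
  · obtain ⟨w, hw⟩ := Finset.nonempty_iff_ne_empty.2 hR0
    have hnv : ¬ Pinned ξ (supportNumber Δ ξ) v := fun h => hR0 (hvert (by
      rw [hΔeq]; exact isVertex_of_pinned (hΔeq ▸ hvΔ) h)).2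
    simp only [Pinned, not_forall] at hnv
    obtain ⟨u, hu, hu0⟩ := hnv
    set e : Set (Fin d → ℝ) := maxFace Δ (∑ Γ ∈ L, ξ Γ) with he
    have hemem : e = {x ∈ Δ | ∀ Γ ∈ L, ξ Γ ⬝ᵥ x = supportNumber Δ ξ Γ} :=
      hΔ.maxFace_sum_eq hξ hvΔ (subset_refl L)
    have hve : v ∈ e := by rw [hemem]; exact ⟨hvΔ, fun Γ hΓ => (hL Γ).1 hΓ⟩
    have hpin' : ∀ x : Fin d → ℝ, (∀ Γ ∈ L, ξ Γ ⬝ᵥ x = 0) → n w ⬝ᵥ x = 0 → x = 0 := by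
      intro x hx hwx
      refine hpin x ?_
      rintro (j | j) hj
      · exact hx j ((hL j).2 hj)
      · have : j = w := Finset.card_le_one.1 hR1 j ((hR j).2 hj) w hw
        rw [this]; exact hwx
    have hue : u ∈ vectorSpan ℝ e := by
      obtain ⟨t, hmem, ht⟩ := ((hΔ.eventually_mem hξ hvΔ (w := u) fun i hi =>
        (hu i ((hL i).1 hi)).le).and self_mem_nhdsWithin).exists
      have ht' : (0:ℝ) < t := ht
      have hxe : v + t • u ∈ e := by
        rw [hemem]
        refine ⟨hmem, fun Γ hΓ => ?_⟩
        rw [dotProduct_add, dotProduct_smul, hu Γ ((hL Γ).1 hΓ), smul_zero, add_zero,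
          (hL Γ).1 hΓ]
      have h1 := vsub_mem_vectorSpan ℝ hxe hve
      rw [vsub_eq_sub, add_sub_cancel_left] at h1
      have := Submodule.smul_mem _ t⁻¹ h1
      rwa [smul_smul, inv_mul_cancel₀ ht'.ne', one_smul] at this
    have hnu : n w ⬝ᵥ u ≠ 0 := fun h =>
      hu0 (hpin' u (fun Γ hΓ => hu Γ ((hL Γ).1 hΓ)) h)
    have hspan : vectorSpan ℝ e = Submodule.span ℝ {u} := by
      refine le_antisymm (fun x hx => ?_) ((Submodule.span_singleton_le_iff_mem u _).2 hue)
      have hx0 : ∀ Γ ∈ L, ξ Γ ⬝ᵥ x = 0 := fun Γ hΓ =>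
        dot_eq_zero_of_mem_vectorSpan (r := supportNumber Δ ξ Γ)
          (fun y hy => by rw [hemem] at hy; exact hy.2 Γ hΓ) hx
      rw [Submodule.mem_span_singleton]
      refine ⟨(n w ⬝ᵥ x) / (n w ⬝ᵥ u), ?_⟩
      refine (sub_eq_zero.1 (hpin' _ (fun Γ hΓ => ?_) ?_)).symm
      · rw [dotProduct_sub, dotProduct_smul, hx0 Γ hΓ, hu Γ ((hL Γ).1 hΓ), smul_zero, sub_zero]
      · rw [dotProduct_sub, dotProduct_smul, smul_eq_mul, div_mul_cancel₀ _ hnu, sub_self]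
    have hEdge : IsEdge Δ e := by
      refine ⟨⟨⟨v, hve⟩, _, rfl⟩, ?_⟩
      rw [affDim, hspan, finrank_span_singleton hu0]
    have hcount := hedge e hEdge
    have hset : {F | IsFacet Δ F ∧ e ⊆ F} = {F | IsFacet Δ F ∧ v ∈ F} := by
      ext F
      refine and_congr_right fun hF => ⟨fun h => h hve, fun h x hx => ?_⟩
      rw [hemem] at hx
      have hΓ : (⟨F, hF⟩ : Facet Δ) ∈ L := mem_facetsAt.2 h
      exact (mem_facet_iff hξ (Γ := ⟨F, hF⟩) hx.1).2 (hx.2 _ hΓ)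
    rw [hset, ← hLcard] at hcount
    omega

theorem isSimplePolytope_resolution (hΔ : IsDPolytope Δ) (hedge : SimpleInEdges Δ)
    (hcut : IsCut Δ n c) : IsSimplePolytope (resolution Δ n c) := by
  classical
  obtain ⟨ξ, hξ⟩ := exists_isNormalSystem Δ
  have := finite_facet hΔ
  have := finite_isNonsimpleVertex hΔ
  have := Fintype.ofFinite (Facet Δ)
  have := Fintype.ofFinite {v // IsNonsimpleVertex Δ v}
  have hS := isDPolytope_resolution hΔ hcut
  have heq := resolution_eq_hpoly (n := n) (c := c) hΔ hξ
  refine ⟨hS, fun v hv => ?_⟩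
  obtain ⟨A, hA, hcard⟩ := card_active_le hΔ hedge hcut hξ hv
  have hvS := hv.mem
  rw [heq] at hS hv hvS ⊢
  exact (facets_at_vertex hS hvS (pinned_of_isVertex hv) hA hcard).1

/-- A nonempty intersection of the resolution with a cutting hyperplane is an inserted facet. -/
theorem exists_isInserted (hΔ : IsDPolytope Δ) (hedge : SimpleInEdges Δ)
    (hcut : IsCut Δ n c) {p : Fin d → ℝ} (hp : p ∈ resolution Δ n c) {w : Fin d → ℝ}
    (hw : IsNonsimpleVertex Δ w) (hpw : n w ⬝ᵥ p = c w) :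
    ∃ Γ : Facet (resolution Δ n c), IsInserted Δ n c Γ ∧ p ∈ (Γ : Set (Fin d → ℝ)) := by
  classical
  obtain ⟨ξ, hξ⟩ := exists_isNormalSystem Δ
  have := finite_facet hΔ
  have := finite_isNonsimpleVertex hΔ
  have := Fintype.ofFinite (Facet Δ)
  have := Fintype.ofFinite {v // IsNonsimpleVertex Δ v}
  have hS := isDPolytope_resolution hΔ hcut
  have heq := resolution_eq_hpoly (n := n) (c := c) hΔ hξ
  obtain ⟨q, hq, hqv, -⟩ := hS.exists_vertex (n w) 0
  have hpm : p ∈ maxFace (resolution Δ n c) (n w) :=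
    ⟨hp, fun y hy => hpw ▸ hy.2 w hw⟩
  obtain ⟨A, hA, hcard⟩ := card_active_le hΔ hedge hcut hξ hqv
  have hqS := hqv.mem
  have hmem : Sum.inr ⟨w, hw⟩ ∈ A := by
    rw [hA]
    change n w ⬝ᵥ q = c w
    rw [maxFace_const hq hpm, hpw]
  have hfac : IsFacet (resolution Δ n c) {x ∈ resolution Δ n c | n w ⬝ᵥ x = c w} := by
    rw [heq] at hS hqv hqS ⊢
    exact (facets_at_vertex hS hqS (pinned_of_isVertex hqv) hA hcard).2 _ hmem
  exact ⟨⟨_, hfac⟩, ⟨w, hw, rfl⟩, hp, hpw⟩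

theorem exists_isInserted_of_isNonsimpleVertex (hΔ : IsDPolytope Δ) (hedge : SimpleInEdges Δ)
    (hcut : IsCut Δ n c) {v : Fin d → ℝ} (hv : IsNonsimpleVertex Δ v) :
    ∃ Γ : Facet (resolution Δ n c), IsInserted Δ n c Γ := by
  obtain ⟨p, hp, hlt⟩ := exists_mem_lt hΔ hcut
  -- the point of the segment from `p` to `v` on the cutting hyperplane
  set α := c v - n v ⬝ᵥ p with hα
  set β := n v ⬝ᵥ v - c v with hβ
  have hα0 : 0 < α := sub_pos.2 (hlt v hv)
  have hβ0 : 0 < β := sub_pos.2 (hcut.1 v hv).1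
  set t := α / (α + β) with ht
  have ht0 : 0 < t := by positivity
  have ht1 : t < 1 := by rw [ht, div_lt_one (by positivity)]; linarith
  have hmem : p + t • (v - p) ∈ Δ := hΔ.convex.add_smul_sub_mem hp hv.1.mem ⟨ht0.le, ht1.le⟩
  have hon : n v ⬝ᵥ (p + t • (v - p)) = c v := by
    have e1 : n v ⬝ᵥ v - n v ⬝ᵥ p = α + β := by rw [hα, hβ]; ring
    rw [dotProduct_add, dotProduct_smul, dotProduct_sub, e1, smul_eq_mul, ht,
      div_mul_cancel₀ _ (by positivity), hα]
    ring
  have hS : p + t • (v - p) ∈ resolution Δ n c := by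
    refine ⟨hmem, fun w hw => ?_⟩
    by_cases hwv : w = v
    · rw [hwv, hon]
    · exact (hcut.2 v w hv hw (Ne.symm hwv) _ hmem hon.ge).le
  obtain ⟨Γ, hΓ, -⟩ := exists_isInserted hΔ hedge hcut hS hv hon
  exact ⟨Γ, hΓ⟩

/-- The cones of the `d-1`-skeleton of the dual fan of the polytope are the cones of the dual fan
of the resolution that have dimension less than `d` and contain no rays of inserted facets. -/
theorem mem_skeleton_iff (hΔ : IsDPolytope Δ) (hedge : SimpleInEdges Δ) (hcut : IsCut Δ n c)
    [Fintype (Facet (resolution Δ n c))] [DecidableEq (Facet (resolution Δ n c))]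
    (hS : IsSimplePolytope (resolution Δ n c))
    {ξ : Facet (resolution Δ n c) → Fin d → ℝ} (hξ : IsNormalSystem (resolution Δ n c) ξ)
    {C : Set (Fin d → ℝ)} :
    C ∈ skeleton (dualFan Δ) ↔ ∃ K, ((hS.data hξ).IsCone K ∧ K.card < d ∧
      ∀ Γ ∈ K, ¬ IsInserted Δ n c Γ) ∧ C = (hS.data hξ).cone K := by
  classical
  constructor
  · intro hC
    have hdim := hC.2
    obtain ⟨ζ, p, hp, hlt, hCζ⟩ := skeleton_subset hΔ hcut hC
    obtain ⟨v, hvG, hv, -⟩ := hS.1.exists_vertex ζ 0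
    let K : Finset (Facet (resolution Δ n c)) :=
      Finset.univ.filter fun i => maxFace (resolution Δ n c) ζ ⊆ i
    have hK : ∀ i : Facet (resolution Δ n c), i ∈ K ↔
      maxFace (resolution Δ n c) ζ ⊆ (i : Set (Fin d → ℝ)) := by simp [K]
    have hcone : (hS.data hξ).IsCone K := ⟨facetsAt v, (hS.mem_maxl hξ).2 ⟨v, hv, rfl⟩,
      fun i hi => mem_facetsAt.2 ((hK i).1 hi hvG)⟩
    have hCK : C = (hS.data hξ).cone K := by
      rw [hCζ]
      exact hS.normalCone_eq_cone hξ hv hvG (fun x hx => hx.1) hK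
    refine ⟨K, ⟨hcone, ?_, ?_⟩, hCK⟩
    · rwa [hCK, SimpleData.finrank_span_cone hcone] at hdim
    · rintro Γ hΓ ⟨w, hw, hΓw⟩
      have hpΓ := (hK Γ).1 hΓ hp
      rw [hΓw] at hpΓ
      exact (hlt w hw).ne hpΓ.2
  · rintro ⟨K, ⟨⟨I, hI, hKI⟩, hcard, hins⟩, rfl⟩
    obtain ⟨v, hv, rfl⟩ := (hS.mem_maxl hξ).1 hI
    obtain ⟨p, hp, hpK⟩ := hS.exists_mem_face hξ hv hKI
    have hlt : ∀ w, IsNonsimpleVertex Δ w → n w ⬝ᵥ p < c w := by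
      intro w hw
      refine lt_of_le_of_ne (hp.1.2 w hw) fun h => ?_
      obtain ⟨Γ, hΓ, hpΓ⟩ := exists_isInserted hΔ hedge hcut hp.1 hw h
      exact hins Γ (hpK Γ hpΓ) hΓ
    have hpΔ : p ∈ maxFace Δ (∑ i ∈ K, ξ i) := by
      refine ⟨hp.1.1, fun y hy => ?_⟩
      obtain ⟨t, ht, -, hmem⟩ := exists_mem_resolution hΔ hp.1.1 hy hlt
      have h1 := hp.2 _ hmem
      rw [dotProduct_add, dotProduct_smul, smul_eq_mul, dotProduct_sub] at h1
      nlinarith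
    have h := (normalCone_resolution hΔ hpΔ hlt).2
    rw [hS.normalCone_maxFace_sum hξ hv hKI] at h
    refine ⟨⟨_, ⟨⟨p, hpΔ⟩, _, rfl⟩, h⟩, ?_⟩
    rw [SimpleData.finrank_span_cone ⟨_, hI, hKI⟩]
    exact hcard

end Resolution

end EdgeSimple

namespace EdgeSimple

namespace SimpleData

/-- Polynomials that agree on the nonnegative orthant are equal. -/
theorem eq_of_eval_nonneg {ι : Type} {p q : MvPolynomial ι ℝ}
    (h : ∀ c : ι → ℝ, (∀ i, 0 ≤ c i) → MvPolynomial.eval c p = MvPolynomial.eval c q) : p = q :=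
  MvPolynomial.funext_set (s := fun _ => Set.Ici (0 : ℝ)) (fun _ => Set.Ici_infinite 0)
    fun c hc => h c fun i => hc i (Set.mem_univ i)

variable {d : ℕ} {ι : Type} [Fintype ι] [DecidableEq ι] {F : SimpleData d ι}

/-! ### Piecewise polynomial functions on simplicial fans -/

/-- Every functional lies in one of the maximal cones. -/
theorem exists_coord_nonneg (hne : F.maxl.Nonempty) (x : Fin d → ℝ) :
    ∃ I ∈ F.maxl, ∀ i, 0 ≤ F.dualVec I i ⬝ᵥ x := by
  obtain ⟨I₀, hI₀⟩ := hne
  obtain ⟨I, hI, -, hpos⟩ := F.exists_max x ∅ I₀ hI₀ (Finset.empty_subset _)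
  refine ⟨I, hI, fun i => ?_⟩
  by_cases hi : i ∈ I
  · exact hpos i (by simpa using hi)
  · rw [F.dualVec_off I hI i hi, zero_dotProduct]

/-- The coordinates of a functional do not depend on the maximal cone that contains it. -/
theorem coord_eq {I J : Finset ι} (hI : I ∈ F.maxl) (hJ : J ∈ F.maxl) {x : Fin d → ℝ}
    (hIx : ∀ i, 0 ≤ F.dualVec I i ⬝ᵥ x) (hJx : ∀ i, 0 ≤ F.dualVec J i ⬝ᵥ x) (i : ι) :
    F.dualVec J i ⬝ᵥ x = F.dualVec I i ⬝ᵥ x := by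
  have hterm : ∀ {I J : Finset ι}, I ∈ F.maxl → J ∈ F.maxl → (∀ i, 0 ≤ F.dualVec I i ⬝ᵥ x) →
      ∀ i ∈ I, 0 ≤ (F.dualVec I i ⬝ᵥ x) * (F.supp i - F.ray i ⬝ᵥ F.vert F.supp J) :=
    fun _ hJ h i _ => mul_nonneg (h i) (sub_nonneg.2 (good_supp.ray_vert_le hJ i))
  have h1 := dot_vert_sub hI F.supp x (F.vert F.supp J)
  have h2 := dot_vert_sub hJ F.supp x (F.vert F.supp I)
  have h3 := Finset.sum_nonneg (hterm hI hJ hIx)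
  have h4 := Finset.sum_nonneg (hterm hJ hI hJx)
  have h5 : ∑ i ∈ I, (F.dualVec I i ⬝ᵥ x) * (F.supp i - F.ray i ⬝ᵥ F.vert F.supp J) = 0 := by
    linarith
  have hoff : ∀ i ∉ J, F.dualVec I i ⬝ᵥ x = 0 := by
    intro i hi
    by_cases hiI : i ∈ I
    · have := (Finset.sum_eq_zero_iff_of_nonneg (hterm hI hJ hIx)).1 h5 i hiI
      refine (mul_eq_zero.1 this).resolve_right (sub_pos.2 (F.lt_supp J hJ i hi)).ne'
    · rw [F.dualVec_off I hI i hiI, zero_dotProduct]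
  have := dualVec_sum hJ hoff i
  rwa [F.expand I hI x] at this

open Classical in
variable (F) in
/-- The coordinates of `x` in a maximal cone that contains `x`; as functions of `x`, they are the
characteristic functions of the rays. -/
noncomputable def coord (x : Fin d → ℝ) : ι → ℝ :=
  if h : ∃ I ∈ F.maxl, ∀ i, 0 ≤ F.dualVec I i ⬝ᵥ x then fun i => F.dualVec h.choose i ⬝ᵥ x else 0

theorem coord_apply {I : Finset ι} (hI : I ∈ F.maxl) {x : Fin d → ℝ}
    (hx : ∀ i, 0 ≤ F.dualVec I i ⬝ᵥ x) (i : ι) : F.coord x i = F.dualVec I i ⬝ᵥ x := by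
  have h : ∃ I ∈ F.maxl, ∀ i, 0 ≤ F.dualVec I i ⬝ᵥ x := ⟨I, hI, hx⟩
  rw [coord, dif_pos h]
  exact coord_eq hI h.choose_spec.1 hx h.choose_spec.2 i

theorem coord_sum {K : Finset ι} (hK : F.IsCone K) {c : ι → ℝ} (hc : ∀ i, 0 ≤ c i)
    (hcK : ∀ i ∉ K, c i = 0) : F.coord (∑ i, c i • F.ray i) = c := by
  obtain ⟨I, hI, hKI⟩ := hK
  have hoff : ∀ i ∉ I, c i = 0 := fun i hi => hcK i fun h => hi (hKI h)
  ext i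
  rw [coord_apply hI, dualVec_sum hI hoff]
  intro j
  rw [dualVec_sum hI hoff]
  exact hc j

theorem coord_apply_of_mem_cone {I K : Finset ι} (hI : I ∈ F.maxl) (hK : K ⊆ I) {x : Fin d → ℝ}
    (hx : x ∈ F.cone K) (i : ι) : F.coord x i = F.dualVec I i ⬝ᵥ x := by
  obtain ⟨c, hc, hcK, rfl⟩ := hx
  rw [coord_sum ⟨I, hI, hK⟩ hc hcK, dualVec_sum hI fun i hi => hcK i fun h => hi (hK h)]

theorem dot_eq_sum_coord (hne : F.maxl.Nonempty) (a x : Fin d → ℝ) :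
    a ⬝ᵥ x = ∑ i, (a ⬝ᵥ F.ray i) * F.coord x i := by
  obtain ⟨I, hI, hpos⟩ := exists_coord_nonneg hne x
  conv_lhs => rw [← F.expand I hI x]
  rw [dotProduct_sum]
  refine Finset.sum_congr rfl fun i _ => ?_
  rw [dotProduct_smul, coord_apply hI hpos, smul_eq_mul, mul_comm]

theorem continuous_coord (hne : F.maxl.Nonempty) (i : ι) : Continuous fun x => F.coord x i := by
  let S : {I // I ∈ F.maxl} → Set (Fin d → ℝ) := fun I => {x | ∀ i, 0 ≤ F.dualVec I i ⬝ᵥ x}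
  refine (locallyFinite_of_finite S).continuous ?_ (fun I => ?_) fun I => ?_
  · refine Set.eq_univ_of_forall fun x => ?_
    obtain ⟨I, hI, hpos⟩ := exists_coord_nonneg hne x
    exact Set.mem_iUnion.2 ⟨⟨I, hI⟩, hpos⟩
  · simp only [S, Set.ofPred_forall]
    exact isClosed_iInter fun j => isClosed_le continuous_const (continuous_dot _)
  · exact (continuous_dot (F.dualVec I i)).continuousOn.congr fun x hx => coord_apply I.2 hx i

/-- The linear form `a` as a polynomial. -/
noncomputable def dotPoly (a : Fin d → ℝ) : MvPolynomial (Fin d) ℝ :=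
  ∑ k, MvPolynomial.C (a k) * MvPolynomial.X k

theorem eval_dotPoly (a x : Fin d → ℝ) : MvPolynomial.eval x (dotPoly a) = a ⬝ᵥ x := by
  simp [dotPoly, dotProduct]

theorem isHomogeneous_dotPoly (a : Fin d → ℝ) : (dotPoly a).IsHomogeneous 1 :=
  MvPolynomial.IsHomogeneous.sum _ _ _ fun _ _ => MvPolynomial.isHomogeneous_C_mul_X _ _

variable {Θ : Set (Set (Fin d → ℝ))} {T : Finset ι → Prop}

variable (F Θ T) in
/-- `Θ` is the collection of the cones spanned by the sets of rays from the simplicial complex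
`T`. -/
structure IsSubfan : Prop where
  mem_iff : ∀ C, C ∈ Θ ↔ ∃ K, T K ∧ C = F.cone K
  isCone : ∀ K, T K → F.IsCone K
  mono : ∀ K L, T K → L ⊆ K → T L
  nonempty : F.maxl.Nonempty

theorem IsSubfan.exists_poly (hΘ : F.IsSubfan Θ T) (q : MvPolynomial ι ℝ) {C : Set (Fin d → ℝ)}
    (hC : C ∈ Θ) : ∃ p : MvPolynomial (Fin d) ℝ, (∀ k, q.IsHomogeneous k → p.IsHomogeneous k) ∧
      ∀ x ∈ C, MvPolynomial.eval (F.coord x) q = MvPolynomial.eval x p := by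
  obtain ⟨K, hK, rfl⟩ := (hΘ.mem_iff C).1 hC
  obtain ⟨I, hI, hKI⟩ := hΘ.isCone K hK
  refine ⟨MvPolynomial.aeval (fun i => dotPoly (F.dualVec I i)) q, fun k hq => ?_, fun x hx => ?_⟩
  · have := hq.aeval (g := fun i => dotPoly (F.dualVec I i)) (n := 1)
      fun i => isHomogeneous_dotPoly _
    rwa [one_mul] at this
  · have hx' : F.coord x = fun i => MvPolynomial.eval x (dotPoly (F.dualVec I i)) := by
      ext i; rw [eval_dotPoly, coord_apply_of_mem_cone hI hKI hx]
    rw [hx']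
    induction q using MvPolynomial.induction_on with
    | C a => simp
    | add p q hp hq => simp only [map_add, hp, hq]
    | mul_X p i hp => simp only [map_mul, hp, MvPolynomial.aeval_X, MvPolynomial.eval_X]

/-- The polynomials in the characteristic functions of the rays. -/
noncomputable def IsSubfan.toPP (hΘ : F.IsSubfan Θ T) : MvPolynomial ι ℝ →ₐ[ℝ] PP Θ where
  toFun q := ⟨fun x => MvPolynomial.eval (F.coord x) q, by
    refine ⟨?_, fun C hC => ?_⟩
    · have h : Continuous fun x : ⋃₀ Θ => F.coord x :=
        continuous_pi fun i => (continuous_coord hΘ.nonempty i).comp continuous_subtype_val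
      exact (MvPolynomial.continuous_eval q).comp h
    · obtain ⟨p, -, hp⟩ := hΘ.exists_poly q hC
      exact ⟨p, fun x hx => hp x hx⟩⟩
  map_one' := by ext; simp
  map_mul' p q := by ext; simp
  map_zero' := by ext; simp
  map_add' p q := by ext; simp
  commutes' r := by ext; simp [MvPolynomial.algebraMap_eq]

theorem IsSubfan.toPP_apply (hΘ : F.IsSubfan Θ T) (q : MvPolynomial ι ℝ) (x : ⋃₀ Θ) :
    (hΘ.toPP q : ⋃₀ Θ → ℝ) x = MvPolynomial.eval (F.coord x) q := rfl

theorem IsSubfan.isPiecewiseHomogeneous_toPP (hΘ : F.IsSubfan Θ T) {q : MvPolynomial ι ℝ} {k : ℕ}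
    (hq : q.IsHomogeneous k) : IsPiecewiseHomogeneous Θ k (hΘ.toPP q : ⋃₀ Θ → ℝ) := by
  intro C hC
  obtain ⟨p, hp, h⟩ := hΘ.exists_poly q hC
  exact ⟨p, hp k hq, fun x hx => h x hx⟩

theorem sum_mem_cone {K : Finset ι} {c : ι → ℝ} (hc : ∀ i, 0 ≤ c i) :
    ∑ i, (if i ∈ K then c i else 0) • F.ray i ∈ F.cone K :=
  ⟨fun i => if i ∈ K then c i else 0, fun i => by
    dsimp only; split_ifs <;> simp [hc i], fun i hi => if_neg hi, rfl⟩

theorem IsSubfan.mem_sUnion (hΘ : F.IsSubfan Θ T) {K : Finset ι} (hK : T K) {x : Fin d → ℝ}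
    (hx : x ∈ F.cone K) : x ∈ ⋃₀ Θ := ⟨_, (hΘ.mem_iff _).2 ⟨K, hK, rfl⟩, hx⟩

theorem IsSubfan.toPP_eq_zero_iff (hΘ : F.IsSubfan Θ T) {q : MvPolynomial ι ℝ} :
    hΘ.toPP q = 0 ↔ ∀ K, T K → face K q = 0 := by
  constructor
  · intro h K hK
    refine eq_of_eval_nonneg fun c hc => ?_
    rw [eval_face, map_zero]
    have hmem := sum_mem_cone (F := F) (K := K) hc
    have h1 := congrFun (congrArg Subtype.val h) ⟨_, hΘ.mem_sUnion hK hmem⟩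
    rw [hΘ.toPP_apply, coord_sum (hΘ.isCone K hK) (fun i => by split_ifs <;> simp [hc i])
      (fun i hi => if_neg hi)] at h1
    exact h1
  · intro h
    apply Subtype.ext
    funext ⟨x, C, hC, hx⟩
    obtain ⟨K, hK, rfl⟩ := (hΘ.mem_iff C).1 hC
    obtain ⟨c, hc, hcK, rfl⟩ := hx
    have h1 := congrArg (MvPolynomial.eval c) (h K hK)
    have hc' : (fun i => if i ∈ K then c i else 0) = c := by
      ext i; split_ifs with hi
      · rfl
      · exact (hcK i hi).symm
    rw [eval_face, hc', map_zero] at h1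
    rw [hΘ.toPP_apply]
    simp only [coord_sum (hΘ.isCone K hK) hc hcK]
    exact h1

/-- Compatible polynomials on the coordinate subspaces of a simplicial complex extend to a
polynomial: a coefficient can be taken from the smallest subspace that carries its monomial. -/
theorem exists_face_eq (hmono : ∀ K L, T K → L ⊆ K → T L) (g : Finset ι → MvPolynomial ι ℝ)
    (hg : ∀ K L, T K → L ⊆ K → face L (g K) = g L) :
    ∃ Q : MvPolynomial ι ℝ, (∀ K, T K → face K Q = g K) ∧
      ∀ m, Q.coeff m ≠ 0 → T m.support ∧ (g m.support).coeff m ≠ 0 := by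
  classical
  let Q : MvPolynomial ι ℝ := ∑ K with T K, ∑ m ∈ (g K).support with m.support = K,
    MvPolynomial.monomial m ((g K).coeff m)
  have hQ : ∀ m, Q.coeff m = if T m.support then (g m.support).coeff m else 0 := by
    intro m
    have hinner : ∀ K, (∑ m' ∈ (g K).support with m'.support = K,
        MvPolynomial.monomial m' ((g K).coeff m')).coeff m =
        if m.support = K then (g K).coeff m else 0 := by
      intro K
      simp only [MvPolynomial.coeff_sum, MvPolynomial.coeff_monomial, Finset.sum_ite_eq',
        Finset.mem_filter, MvPolynomial.mem_support_iff]
      by_cases h1 : m.support = K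
      · by_cases h2 : (g K).coeff m = 0 <;> simp [h1, h2]
      · simp [h1]
    simp only [Q, MvPolynomial.coeff_sum, hinner]
    rw [Finset.sum_ite_eq]
    simp
  refine ⟨Q, fun K hK => ?_, fun m hm => ?_⟩
  · ext m
    rw [coeff_face, hQ]
    split_ifs with h1 h2
    · rw [← hg K _ hK h1, coeff_face, if_pos (subset_refl _)]
    · exact absurd (hmono K _ hK h1) h2
    · rw [← hg K K hK (subset_refl K), coeff_face, if_neg h1]
  · rw [hQ] at hm
    split_ifs at hm with h
    · exact ⟨h, hm⟩
    · exact absurd rfl hm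

/-- Piecewise polynomial functions on a simplicial fan are polynomials in the characteristic
functions of the rays. The predicate `hom` holds for at most one degree; if it holds for some
degree, then the function is homogeneous of this degree, and so is the polynomial. -/
theorem IsSubfan.exists_toPP_eq (hΘ : F.IsSubfan Θ T) (f : PP Θ) (hom : ℕ → Prop)
    (hhom : ∀ k, hom k → IsPiecewiseHomogeneous Θ k (f : ⋃₀ Θ → ℝ))
    (huniq : ∀ k l, hom k → hom l → k = l) :
    ∃ Q : MvPolynomial ι ℝ, hΘ.toPP Q = f ∧ ∀ k, hom k → Q.IsHomogeneous k := by
  classical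
  have hex : ∀ K, ∃ p : MvPolynomial (Fin d) ℝ, T K → (∀ k, hom k → p.IsHomogeneous k) ∧
      ∀ x : ⋃₀ Θ, (x : Fin d → ℝ) ∈ F.cone K →
        (f : ⋃₀ Θ → ℝ) x = MvPolynomial.eval (x : Fin d → ℝ) p := by
    intro K
    by_cases hK : T K
    · have hC : F.cone K ∈ Θ := (hΘ.mem_iff _).2 ⟨K, hK, rfl⟩
      by_cases h : ∃ k, hom k
      · obtain ⟨k, hk⟩ := h
        obtain ⟨p, hp, hpx⟩ := hhom k hk _ hC
        exact ⟨p, fun _ => ⟨fun l hl => huniq k l hk hl ▸ hp, hpx⟩⟩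
      · obtain ⟨p, hp⟩ := f.2.2 _ hC
        exact ⟨p, fun _ => ⟨fun l hl => absurd ⟨l, hl⟩ h, hp⟩⟩
    · exact ⟨0, fun h => absurd h hK⟩
  choose p hp using hex
  -- the coordinates of `∑ i, X i • ray i`
  let r : Fin d → MvPolynomial ι ℝ := fun k => ∑ i, MvPolynomial.C (F.ray i k) * MvPolynomial.X i
  have hr : ∀ (c : ι → ℝ), (fun k => MvPolynomial.eval c (r k)) = ∑ i, c i • F.ray i := by
    intro c
    ext k
    simp [r, Finset.sum_apply, mul_comm]
  have hrp : ∀ (c : ι → ℝ) (P : MvPolynomial (Fin d) ℝ),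
      MvPolynomial.eval c (MvPolynomial.aeval r P) = MvPolynomial.eval (∑ i, c i • F.ray i) P := by
    intro c P
    rw [← hr c]
    induction P using MvPolynomial.induction_on with
    | C a => simp
    | add p q hp hq => simp only [map_add, hp, hq]
    | mul_X p i hp => simp only [map_mul, hp, MvPolynomial.aeval_X, MvPolynomial.eval_X]
  let g : Finset ι → MvPolynomial ι ℝ := fun K => face K (MvPolynomial.aeval r (p K))
  have hgval : ∀ K (hK : T K) (c : ι → ℝ) (hc : ∀ i, 0 ≤ c i), MvPolynomial.eval c (g K) =
      (f : ⋃₀ Θ → ℝ) ⟨_, hΘ.mem_sUnion hK (sum_mem_cone (K := K) hc)⟩ := by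
    intro K hK c hc
    rw [(hp K hK).2 _ (sum_mem_cone hc), eval_face, hrp]
  have hcompat : ∀ K L, T K → L ⊆ K → face L (g K) = g L := by
    intro K L hK hLK
    refine eq_of_eval_nonneg fun c hc => ?_
    have hc' : ∀ i, 0 ≤ (fun i => if i ∈ L then c i else 0) i := fun i => by
      simp only; split_ifs <;> simp [hc i]
    rw [eval_face, hgval K hK _ hc', hgval L (hΘ.mono K L hK hLK) c hc]
    refine congrArg (f : ⋃₀ Θ → ℝ) (Subtype.ext (Finset.sum_congr rfl fun i _ => ?_))
    by_cases hi : i ∈ L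
    · simp [hi, hLK hi]
    · simp [hi]
  obtain ⟨Q, hQ, hQsupp⟩ := exists_face_eq hΘ.mono g hcompat
  refine ⟨Q, ?_, fun k hk m hm => ?_⟩
  · apply Subtype.ext
    funext ⟨x, C, hC, hx⟩
    obtain ⟨K, hK, rfl⟩ := (hΘ.mem_iff C).1 hC
    obtain ⟨c, hc, hcK, rfl⟩ := hx
    have hc' : (fun i => if i ∈ K then c i else 0) = c := by
      ext i; split_ifs with hi
      · rfl
      · exact (hcK i hi).symm
    have h1 := hgval K hK c hc
    rw [← hQ K hK, eval_face, hc'] at h1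
    rw [hΘ.toPP_apply]
    simp only [coord_sum (hΘ.isCone K hK) hc hcK]
    rw [h1]
    exact congrArg (f : ⋃₀ Θ → ℝ) (Subtype.ext (Finset.sum_congr rfl fun i _ =>
      congrArg (· • F.ray i) (congrFun hc' i)))
  · obtain ⟨hT, hcoeff⟩ := hQsupp m hm
    have hrhom : (MvPolynomial.aeval r (p m.support)).IsHomogeneous k := by
      have := ((hp _ hT).1 k hk).aeval (g := r) (n := 1) fun i =>
        MvPolynomial.IsHomogeneous.sum _ _ _ fun k _ => MvPolynomial.isHomogeneous_C_mul_X _ _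
      rwa [one_mul] at this
    rw [coeff_face, if_pos (subset_refl _)] at hcoeff
    exact hrhom hcoeff

theorem IsSubfan.toPP_surjective (hΘ : F.IsSubfan Θ T) : Function.Surjective hΘ.toPP := fun f => by
  obtain ⟨Q, hQ, -⟩ := hΘ.exists_toPP_eq f (fun _ => False) (fun _ h => h.elim)
    (fun _ _ h => h.elim)
  exact ⟨Q, hQ⟩

theorem IsSubfan.exists_isHomogeneous (hΘ : F.IsSubfan Θ T) {f : PP Θ} {k : ℕ}
    (hf : IsPiecewiseHomogeneous Θ k (f : ⋃₀ Θ → ℝ)) :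
    ∃ Q : MvPolynomial ι ℝ, hΘ.toPP Q = f ∧ Q.IsHomogeneous k := by
  obtain ⟨Q, hQ, h⟩ := hΘ.exists_toPP_eq f (fun l => l = k) (fun _ h => h ▸ hf)
    (fun _ _ h h' => h.trans h'.symm)
  exact ⟨Q, hQ, h k rfl⟩

theorem eval_linForm (hne : F.maxl.Nonempty) (a x : Fin d → ℝ) :
    MvPolynomial.eval (F.coord x) (F.linForm a) = a ⬝ᵥ x := by
  rw [dot_eq_sum_coord hne a x, linForm]
  simp

theorem IsSubfan.plusIdeal_eq (hΘ : F.IsSubfan Θ T) :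
    plusIdeal Θ = F.linIdeal.map hΘ.toPP.toRingHom := by
  rw [plusIdeal, linIdeal, Ideal.map_span]
  congr 1
  ext f
  constructor
  · rintro ⟨a, ha⟩
    refine ⟨F.linForm a, ⟨a, rfl⟩, ?_⟩
    apply Subtype.ext
    funext x
    rw [ha]
    exact eval_linForm hΘ.nonempty a x
  · rintro ⟨_, ⟨a, rfl⟩, rfl⟩
    exact ⟨a, fun x => eval_linForm hΘ.nonempty a x⟩

theorem IsSubfan.toPP_mem_plusIdeal_iff (hΘ : F.IsSubfan Θ T) {q : MvPolynomial ι ℝ} :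
    hΘ.toPP q ∈ plusIdeal Θ ↔ ∃ l ∈ F.linIdeal, ∀ K, T K → face K (q - l) = 0 := by
  rw [hΘ.plusIdeal_eq]
  constructor
  · intro h
    obtain ⟨l, hl, h1⟩ := (Ideal.mem_map_iff_of_surjective hΘ.toPP.toRingHom
      hΘ.toPP_surjective).1 h
    refine ⟨l, hl, hΘ.toPP_eq_zero_iff.1 ?_⟩
    rw [map_sub, sub_eq_zero]
    exact h1.symm
  · rintro ⟨l, hl, h⟩
    have h1 := hΘ.toPP_eq_zero_iff.2 h
    rw [map_sub, sub_eq_zero] at h1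
    rw [h1]
    exact Ideal.mem_map_of_mem _ hl

theorem IsSubfan.toPP_mem_plusIdeal_iff_of_isCone (hΘ : F.IsSubfan Θ F.IsCone)
    {q : MvPolynomial ι ℝ} : hΘ.toPP q ∈ plusIdeal Θ ↔ q ∈ F.srIdeal ⊔ F.linIdeal := by
  rw [hΘ.toPP_mem_plusIdeal_iff, Submodule.mem_sup]
  have hiff : ∀ p : MvPolynomial ι ℝ, (∀ K, F.IsCone K → face K p = 0) ↔ p ∈ F.srIdeal := by
    intro p
    rw [mem_srIdeal]
    constructor
    · exact fun h I hI => h I ⟨I, hI, subset_refl I⟩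
    · rintro h K ⟨I, hI, hKI⟩
      have := congrArg (face K) (h I hI)
      rwa [face_face, Finset.inter_eq_right.2 hKI, map_zero] at this
  simp only [hiff]
  constructor
  · rintro ⟨l, hl, h⟩
    exact ⟨q - l, h, l, hl, sub_add_cancel q l⟩
  · rintro ⟨p, hp, l, hl, rfl⟩
    exact ⟨l, hl, by rwa [add_sub_cancel_right]⟩

/-- The components of an element of the ideal of linear functions belong to this ideal. -/
theorem homogeneousComponent_mem_linIdeal {l : MvPolynomial ι ℝ} (hl : l ∈ F.linIdeal) (k : ℕ) :
    MvPolynomial.homogeneousComponent k l ∈ F.linIdeal := by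
  let _ : GradedAlgebra (MvPolynomial.homogeneousSubmodule ι ℝ) := MvPolynomial.gradedAlgebra
  refine MvPolynomial.homogeneousComponent_mem_of_mem (Ideal.homogeneous_span _ _ ?_) hl k
  rintro _ ⟨a, rfl⟩
  exact ⟨1, MvPolynomial.IsHomogeneous.sum _ _ _ fun k _ => MvPolynomial.isHomogeneous_C_mul_X _ _⟩

end SimpleData

end EdgeSimple

namespace EdgeSimple

/-! ### The identification for a simple polytope -/

section SimplePolytope

variable {d : ℕ} {P : Set (Fin d → ℝ)} [Fintype (Facet P)] [DecidableEq (Facet P)]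
  {ξ : Facet P → (Fin d → ℝ)}

theorem IsSimplePolytope.isVolumePolynomial (hP : IsSimplePolytope P) (hξ : IsNormalSystem P ξ) :
    IsVolumePolynomial P ξ (volumePolynomial P ξ) := by
  have h : ∃ p, IsVolumePolynomial P ξ p := by
    obtain ⟨η, hη⟩ := (hP.data hξ).dense_generic.nonempty
    obtain ⟨t, ht⟩ := SimpleData.exists_volPoly (hP.maxl_nonempty hξ) hη
    exact ⟨_, ht⟩
  rw [volumePolynomial, dif_pos h]
  exact h.choose_spec

/-- The ideal of relations in `A(P)` is generated by the Stanley-Reisner relations and the linear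
relations. -/
theorem IsSimplePolytope.annVol_eq (hP : IsSimplePolytope P) (hξ : IsNormalSystem P ξ) :
    annVol P ξ = (hP.data hξ).srIdeal ⊔ (hP.data hξ).linIdeal := by
  ext q
  exact SimpleData.diffOp_eq_zero_iff (F := hP.data hξ) (hP.maxl_nonempty hξ)
    (hP.isVolumePolynomial hξ) q

theorem IsSimplePolytope.isSubfan_dualFan (hP : IsSimplePolytope P) (hξ : IsNormalSystem P ξ) :
    (hP.data hξ).IsSubfan (dualFan P) (hP.data hξ).IsCone where
  mem_iff _ := hP.mem_dualFan hξ
  isCone _ h := h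
  mono := fun _ _ ⟨I, hI, hK⟩ hL => ⟨I, hI, hL.trans hK⟩
  nonempty := hP.maxl_nonempty hξ

theorem IsSimplePolytope.isCone_singleton (hP : IsSimplePolytope P) (hξ : IsNormalSystem P ξ)
    (Γ : Facet P) : (hP.data hξ).IsCone {Γ} := by
  obtain ⟨v, hv, hvert, -⟩ := hP.1.exists_vertex (ξ Γ) 0
  rw [← hξ Γ] at hv
  exact ⟨facetsAt v, (hP.mem_maxl hξ).2 ⟨v, hvert, rfl⟩,
    Finset.singleton_subset_iff.2 (mem_facetsAt.2 hv)⟩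

theorem IsSimplePolytope.coord_normal (hP : IsSimplePolytope P) (hξ : IsNormalSystem P ξ)
    (Γ : Facet P) : (hP.data hξ).coord (ξ Γ) = Pi.single Γ 1 := by
  have h := SimpleData.coord_sum (hP.isCone_singleton hξ Γ) (c := Pi.single Γ 1)
    (fun i => by by_cases h : i = Γ <;> simp [h])
    (fun i hi => Pi.single_eq_of_ne (by simpa using hi) _)
  have hsum : ∑ i, (Pi.single Γ 1 : Facet P → ℝ) i • (hP.data hξ).ray i = ξ Γ := by
    simp only [Pi.single_apply, ite_smul, one_smul, zero_smul, Finset.sum_ite_eq',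
      Finset.mem_univ, if_true]
    rfl
  rwa [hsum] at h

/-- The characteristic function of a ray exists and is unique. -/
theorem IsSimplePolytope.isCharFun_iff (hP : IsSimplePolytope P) (hξ : IsNormalSystem P ξ)
    {Γ : Facet P} {χ : PP (dualFan P)} :
    IsCharFun P ξ Γ χ ↔ χ = (hP.isSubfan_dualFan hξ).toPP (MvPolynomial.X Γ) := by
  have hΨ := hP.isSubfan_dualFan hξ
  constructor
  · rintro ⟨hhom, hval⟩
    obtain ⟨Q, rfl, hQ⟩ := hΨ.exists_isHomogeneous hhom
    rw [← MvPolynomial.mem_homogeneousSubmodule, MvPolynomial.homogeneousSubmodule_one_eq_span_X,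
      Submodule.mem_span_range_iff_exists_fun] at hQ
    obtain ⟨b, rfl⟩ := hQ
    have hb : ∀ Γ', b Γ' = if Γ' = Γ then 1 else 0 := by
      intro Γ'
      have hmem : ξ Γ' ∈ ⋃₀ dualFan P := hΨ.mem_sUnion (hP.isCone_singleton hξ Γ')
        (SimpleData.ray_mem_cone (F := hP.data hξ) (Finset.mem_singleton_self Γ'))
      have hev : (hΨ.toPP (∑ i, b i • MvPolynomial.X i) : ⋃₀ dualFan P → ℝ) ⟨_, hmem⟩ = b Γ' := by
        rw [hΨ.toPP_apply, hP.coord_normal hξ]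
        simp [MvPolynomial.smul_eval, Pi.single_apply]
      rw [← hev]
      split_ifs with h
      · exact (hval ⟨_, hmem⟩).1 (congrArg ξ h)
      · exact (hval ⟨_, hmem⟩).2 Γ' h rfl
    simp [hb]
  · rintro rfl
    refine ⟨hΨ.isPiecewiseHomogeneous_toPP (MvPolynomial.isHomogeneous_X _ _), fun x =>
      ⟨fun hx => ?_, fun Γ' hΓ' hx => ?_⟩⟩
    · rw [hΨ.toPP_apply, hx, hP.coord_normal hξ]
      simp
    · rw [hΨ.toPP_apply, hx, hP.coord_normal hξ]
      simp [hΓ'.symm]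

/-- A natural isomorphism takes the class of a polynomial in the characteristic functions to the
class of the same polynomial in the operators `∂_Γ`. -/
theorem IsSimplePolytope.isNatural_iff (hP : IsSimplePolytope P) (hξ : IsNormalSystem P ξ)
    {φ : PPbar (dualFan P) ≃ₐ[ℝ] DiffAlg P ξ} :
    IsNatural P ξ φ ↔ ∀ q, φ (Ideal.Quotient.mk (plusIdeal (dualFan P))
      ((hP.isSubfan_dualFan hξ).toPP q)) = Ideal.Quotient.mk (annVol P ξ) q := by
  constructor
  · intro h q
    have halg : (AlgEquiv.toAlgHom φ).comp
        ((Ideal.Quotient.mkₐ ℝ (plusIdeal (dualFan P))).comp (hP.isSubfan_dualFan hξ).toPP) =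
        Ideal.Quotient.mkₐ ℝ (annVol P ξ) := by
      refine MvPolynomial.algHom_ext fun Γ => ?_
      obtain ⟨χ, hχ, h1⟩ := h Γ
      rw [hP.isCharFun_iff hξ] at hχ
      subst hχ
      exact h1
    exact DFunLike.congr_fun halg q
  · exact fun h Γ => ⟨_, (hP.isCharFun_iff hξ).2 rfl, h _⟩

/-- Both algebras are the quotient of the polynomial ring by the same ideal. -/
theorem IsSimplePolytope.existsUnique_isNatural (hP : IsSimplePolytope P)
    (hξ : IsNormalSystem P ξ) :
    ∃! φ : PPbar (dualFan P) ≃ₐ[ℝ] DiffAlg P ξ, IsNatural P ξ φ := by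
  have hΨ := hP.isSubfan_dualFan hξ
  let g : MvPolynomial (Facet P) ℝ →ₐ[ℝ] PPbar (dualFan P) :=
    (Ideal.Quotient.mkₐ ℝ (plusIdeal (dualFan P))).comp hΨ.toPP
  have hg : Function.Surjective g :=
    (Ideal.Quotient.mkₐ_surjective ℝ _).comp hΨ.toPP_surjective
  have hker : annVol P ξ = RingHom.ker g := by
    rw [hP.annVol_eq hξ]
    ext q
    rw [← hΨ.toPP_mem_plusIdeal_iff_of_isCone, RingHom.mem_ker]
    exact Ideal.Quotient.eq_zero_iff_mem.symm
  let e : DiffAlg P ξ ≃ₐ[ℝ] PPbar (dualFan P) :=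
    (Ideal.quotientEquivAlgOfEq ℝ hker).trans (Ideal.quotientKerAlgEquivOfSurjective hg)
  have he : ∀ q, e (Ideal.Quotient.mk _ q) = g q := fun q => rfl
  refine ⟨e.symm, (hP.isNatural_iff hξ).2 fun q => ?_, fun φ hφ => ?_⟩
  · rw [AlgEquiv.symm_apply_eq, he]
    rfl
  · replace hφ := (hP.isNatural_iff hξ).1 hφ
    ext x
    obtain ⟨q, rfl⟩ := hg x
    refine (hφ q).trans ?_
    rw [← he, AlgEquiv.symm_apply_apply]

end SimplePolytope

/-! ### The kernel of the restriction -/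

section Kernel

variable {d : ℕ} {Δ : Set (Fin d → ℝ)} {n : (Fin d → ℝ) → (Fin d → ℝ)} {c : (Fin d → ℝ) → ℝ}

/-- The cones over the sets of rays that do not belong to inserted facets and are not the sets of
all rays of a maximal cone. -/
theorem isSubfan_skeleton (hΔ : IsDPolytope Δ) (hedge : SimpleInEdges Δ) (hcut : IsCut Δ n c)
    [Fintype (Facet (resolution Δ n c))] [DecidableEq (Facet (resolution Δ n c))]
    (hS : IsSimplePolytope (resolution Δ n c)) {ξ : Facet (resolution Δ n c) → Fin d → ℝ}
    (hξ : IsNormalSystem (resolution Δ n c) ξ) :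
    (hS.data hξ).IsSubfan (skeleton (dualFan Δ)) fun K =>
      (hS.data hξ).IsCone K ∧ K.card < d ∧ ∀ Γ ∈ K, ¬ IsInserted Δ n c Γ where
  mem_iff _ := mem_skeleton_iff hΔ hedge hcut hS hξ
  isCone _ h := h.1
  mono := fun _ _ ⟨⟨I, hI, hK⟩, hcard, hins⟩ hL => ⟨⟨I, hI, hL.trans hK⟩,
    (Finset.card_le_card hL).trans_lt hcard, fun Γ hΓ => hins Γ (hL hΓ)⟩
  nonempty := hS.maxl_nonempty hξ

theorem mk_mul_mem_insertedDeg {ξ : Facet (resolution Δ n c) → Fin d → ℝ}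
    {Γ : Facet (resolution Δ n c)} (hΓ : IsInserted Δ n c Γ) {k : ℕ}
    {q : MvPolynomial (Facet (resolution Δ n c)) ℝ} (hq : q.IsHomogeneous k) :
    Ideal.Quotient.mk (annVol (resolution Δ n c) ξ) (MvPolynomial.X Γ * q) ∈
      insertedDeg Δ n c ξ (k + 1) :=
  Submodule.subset_span ⟨Γ, hΓ, k, rfl, _, ⟨q, hq, rfl⟩, map_mul _ _ _⟩

/-- A monomial divisible by the variable of an inserted facet. -/
theorem monomial_mem_insertedDeg {ξ : Facet (resolution Δ n c) → Fin d → ℝ}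
    {Γ : Facet (resolution Δ n c)} (hΓ : IsInserted Δ n c Γ)
    {m : Facet (resolution Δ n c) →₀ ℕ} (hm : Γ ∈ m.support) (a : ℝ) :
    Ideal.Quotient.mk (annVol (resolution Δ n c) ξ) (MvPolynomial.monomial m a) ∈
      insertedDeg Δ n c ξ m.degree := by
  obtain ⟨m', rfl⟩ : ∃ m', m = Finsupp.single Γ 1 + m' := by
    refine ⟨m - Finsupp.single Γ 1, (add_tsub_cancel_of_le ?_).symm⟩
    rw [Finsupp.single_le_iff]
    exact Nat.one_le_iff_ne_zero.2 (Finsupp.mem_support_iff.1 hm)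
  have h := mk_mul_mem_insertedDeg (ξ := ξ) hΓ (MvPolynomial.isHomogeneous_monomial a
    (rfl : m'.degree = m'.degree))
  rwa [MvPolynomial.X, MvPolynomial.monomial_mul, one_mul,
    show m'.degree + 1 = (Finsupp.single Γ 1 + m').degree by
      rw [map_add, Finsupp.degree_single, add_comm]] at h

/-- In degree `d`, all square-free monomials over maximal cones are proportional, so that one
inserted facet suffices for all of them to be multiples of inserted variables. -/
theorem monomial_mem_insertedDeg_of_card_le (hΔ : IsDPolytope Δ) (hedge : SimpleInEdges Δ)
    (hcut : IsCut Δ n c) [Fintype (Facet (resolution Δ n c))]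
    [DecidableEq (Facet (resolution Δ n c))]
    (hS : IsSimplePolytope (resolution Δ n c)) {ξ : Facet (resolution Δ n c) → Fin d → ℝ}
    (hξ : IsNormalSystem (resolution Δ n c) ξ) {m : Facet (resolution Δ n c) →₀ ℕ}
    (hcone : (hS.data hξ).IsCone m.support) (hcard : d ≤ m.support.card)
    (hns : m.degree = d → ∃ v, IsNonsimpleVertex Δ v) (a : ℝ) :
    Ideal.Quotient.mk (annVol (resolution Δ n c) ξ) (MvPolynomial.monomial m a) ∈
      insertedDeg Δ n c ξ m.degree := by
  have hhom := MvPolynomial.isHomogeneous_monomial (σ := Facet (resolution Δ n c)) a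
    (rfl : m.degree = m.degree)
  have hone : ∀ i ∈ m.support, 1 ≤ m i := fun i hi =>
    Nat.one_le_iff_ne_zero.2 (Finsupp.mem_support_iff.1 hi)
  have hle : m.support.card ≤ m.degree := by
    have := Finset.card_nsmul_le_sum m.support m 1 hone
    simpa [Finsupp.degree_apply] using this
  rcases (hcard.trans hle).lt_or_eq with hlt | heq
  · have h0 := SimpleData.mem_sup_of_isHomogeneous (hS.maxl_nonempty hξ) hhom hlt
    rw [← hS.annVol_eq hξ] at h0
    rw [Ideal.Quotient.eq_zero_iff_mem.2 h0]
    exact zero_mem _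
  · obtain ⟨v, hv⟩ := hns heq.symm
    obtain ⟨Γ, hΓ⟩ := exists_isInserted_of_isNonsimpleVertex hΔ hedge hcut hv
    obtain ⟨J, hJ, hΓJ⟩ := hS.isCone_singleton hξ Γ
    obtain ⟨I, hI, hmI⟩ := hcone
    have hIm : m.support = I :=
      Finset.eq_of_subset_of_card_le hmI (((hS.data hξ).card_eq I hI).le.trans hcard)
    have hm1 : ∀ i ∈ I, m i = 1 := by
      intro i hi
      have hsum : ∑ i ∈ m.support, 1 = ∑ i ∈ m.support, m i := by
        have h1 : m.degree = ∑ i ∈ m.support, m i := Finsupp.degree_apply m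
        rw [Finset.sum_const, smul_eq_mul, mul_one, ← h1]
        omega
      exact ((Finset.sum_eq_sum_iff_of_le hone).1 hsum i (hIm ▸ hi)).symm
    have hmon : MvPolynomial.monomial m a = MvPolynomial.C a * ∏ i ∈ I, MvPolynomial.X i := by
      rw [MvPolynomial.monomial_eq, Finsupp.prod, hIm]
      congr 1
      exact Finset.prod_congr rfl fun i hi => by rw [hm1 i hi, pow_one]
    obtain ⟨b, hb⟩ := SimpleData.exists_prod_sub_mem (F := hS.data hξ) I J hI hJ
    rw [← hS.annVol_eq hξ] at hb
    have hmk : Ideal.Quotient.mk (annVol (resolution Δ n c) ξ) (MvPolynomial.monomial m a) =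
        Ideal.Quotient.mk (annVol (resolution Δ n c) ξ)
          (MvPolynomial.X Γ * (MvPolynomial.C (a * b) * ∏ i ∈ J.erase Γ, MvPolynomial.X i)) := by
      rw [Ideal.Quotient.eq, hmon]
      have hprod := Finset.mul_prod_erase J (fun i => (MvPolynomial.X i : MvPolynomial _ ℝ))
        (Finset.singleton_subset_iff.1 hΓJ)
      convert Ideal.mul_mem_left _ (MvPolynomial.C a) hb using 1
      rw [← hprod, MvPolynomial.C_mul]
      ring
    rw [hmk]
    have hdeg : m.degree = (J.erase Γ).card + 1 := by
      rw [Finset.card_erase_add_one (Finset.singleton_subset_iff.1 hΓJ),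
        (hS.data hξ).card_eq J hJ]
      exact heq.symm
    rw [hdeg]
    refine mk_mul_mem_insertedDeg hΓ ?_
    have h1 := MvPolynomial.IsHomogeneous.prod (J.erase Γ)
      (fun i => (MvPolynomial.X i : MvPolynomial (Facet (resolution Δ n c)) ℝ)) (fun _ => 1)
      (fun i _ => MvPolynomial.isHomogeneous_X _ _)
    simpa using (MvPolynomial.isHomogeneous_C _ (a * b)).mul h1

/-- A monomial that vanishes on the skeleton. -/
theorem monomial_mem_insertedDeg_of_not (hΔ : IsDPolytope Δ) (hedge : SimpleInEdges Δ)
    (hcut : IsCut Δ n c) [Fintype (Facet (resolution Δ n c))]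
    [DecidableEq (Facet (resolution Δ n c))]
    (hS : IsSimplePolytope (resolution Δ n c)) {ξ : Facet (resolution Δ n c) → Fin d → ℝ}
    (hξ : IsNormalSystem (resolution Δ n c) ξ) {m : Facet (resolution Δ n c) →₀ ℕ}
    (hm : ¬ ((hS.data hξ).IsCone m.support ∧ m.support.card < d ∧
      ∀ Γ ∈ m.support, ¬ IsInserted Δ n c Γ))
    (hns : m.degree = d → ∃ v, IsNonsimpleVertex Δ v) (a : ℝ) :
    Ideal.Quotient.mk (annVol (resolution Δ n c) ξ) (MvPolynomial.monomial m a) ∈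
      insertedDeg Δ n c ξ m.degree := by
  by_cases hins : ∃ Γ ∈ m.support, IsInserted Δ n c Γ
  · obtain ⟨Γ, hΓm, hΓ⟩ := hins
    exact monomial_mem_insertedDeg hΓ hΓm a
  push Not at hins
  by_cases hcone : (hS.data hξ).IsCone m.support
  · exact monomial_mem_insertedDeg_of_card_le hΔ hedge hcut hS hξ hcone
      (not_lt.1 fun h => hm ⟨hcone, h, hins⟩) hns a
  · have h0 : MvPolynomial.monomial m a ∈ annVol (resolution Δ n c) ξ := by
      rw [hS.annVol_eq hξ]
      refine Ideal.mem_sup_left (SimpleData.mem_srIdeal.2 fun I hI => ?_)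
      rw [face_monomial, if_neg fun h => hcone ⟨I, hI, h⟩]
    rw [Ideal.Quotient.eq_zero_iff_mem.2 h0]
    exact zero_mem _

/-- A homogeneous polynomial that restricts to zero modulo linear functions is, up to a linear
relation of the same degree, a sum of monomials that vanish on the skeleton. -/
theorem map_kerDeg_eq (hΔ : IsDPolytope Δ) (hedge : SimpleInEdges Δ)
    (hcut : IsCut Δ n c) [Fintype (Facet (resolution Δ n c))]
    [DecidableEq (Facet (resolution Δ n c))]
    (hS : IsSimplePolytope (resolution Δ n c)) {ξ : Facet (resolution Δ n c) → Fin d → ℝ}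
    (hξ : IsNormalSystem (resolution Δ n c) ξ)
    (hΥ : skeleton (dualFan Δ) ⊆ dualFan (resolution Δ n c))
    {φ : PPbar (dualFan (resolution Δ n c)) ≃ₐ[ℝ] DiffAlg (resolution Δ n c) ξ}
    (hφ : IsNatural (resolution Δ n c) ξ φ) {k : ℕ}
    (hns : k = d → ∃ v, IsNonsimpleVertex Δ v) :
    (kerDeg hΥ k).map φ.toLinearMap = insertedDeg Δ n c ξ k := by
  have hΨ := hS.isSubfan_dualFan hξ
  have hΘ := isSubfan_skeleton hΔ hedge hcut hS hξ
  rw [hS.isNatural_iff hξ] at hφ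
  have hres : ∀ q, restrictBar hΥ (Ideal.Quotient.mk _ (hΨ.toPP q)) =
      Ideal.Quotient.mk _ (hΘ.toPP q) := fun q => rfl
  apply le_antisymm
  · rintro _ ⟨_, ⟨hker, f, hf, rfl⟩, rfl⟩
    obtain ⟨Q, rfl, hQ⟩ := hΨ.exists_isHomogeneous (k := k) hf
    replace hker : restrictBar hΥ (Ideal.Quotient.mk _ (hΨ.toPP Q)) = 0 := hker
    rw [hres, Ideal.Quotient.eq_zero_iff_mem, hΘ.toPP_mem_plusIdeal_iff] at hker
    obtain ⟨l, hl, hu⟩ := hker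
    -- only the degree `k` part of the linear relation matters
    have hlk : MvPolynomial.homogeneousComponent k l ∈ annVol (resolution Δ n c) ξ := by
      rw [hS.annVol_eq hξ]
      exact Ideal.mem_sup_right (SimpleData.homogeneousComponent_mem_linIdeal hl k)
    have hQk : Q - MvPolynomial.homogeneousComponent k l =
        MvPolynomial.homogeneousComponent k (Q - l) := by
      rw [map_sub, MvPolynomial.homogeneousComponent_of_mem
        ((MvPolynomial.mem_homogeneousSubmodule _ _).2 hQ), if_pos rfl]
    have hmk : Ideal.Quotient.mk (annVol (resolution Δ n c) ξ) Q =
        Ideal.Quotient.mk _ (MvPolynomial.homogeneousComponent k (Q - l)) := by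
      rw [Ideal.Quotient.eq, ← hQk, sub_sub_cancel]
      exact hlk
    change φ (Ideal.Quotient.mk _ (hΨ.toPP Q)) ∈ _
    rw [hφ, hmk, MvPolynomial.homogeneousComponent_apply, map_sum]
    refine Submodule.sum_mem _ fun m hm => ?_
    obtain ⟨hmsupp, rfl⟩ := Finset.mem_filter.1 hm
    refine monomial_mem_insertedDeg_of_not hΔ hedge hcut hS hξ (fun h => ?_) hns _
    exact face_eq_zero_iff.1 (hu m.support h) m hmsupp (subset_refl _)
  · refine Submodule.span_le.2 ?_
    rintro _ ⟨Γ, hΓ, j, rfl, _, ⟨q, hq, rfl⟩, rfl⟩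
    refine ⟨Ideal.Quotient.mk _ (hΨ.toPP (MvPolynomial.X Γ * q)), ⟨?_, ?_⟩, ?_⟩
    · change restrictBar hΥ (Ideal.Quotient.mk _ (hΨ.toPP (MvPolynomial.X Γ * q))) = 0
      rw [hres]
      have h0 : hΘ.toPP (MvPolynomial.X Γ * q) = 0 := by
        refine hΘ.toPP_eq_zero_iff.2 fun K hK => ?_
        rw [map_mul, face_X, if_neg fun h => hK.2.2 Γ h hΓ, zero_mul]
      rw [h0, map_zero]
    · refine ⟨hΨ.toPP (MvPolynomial.X Γ * q), hΨ.isPiecewiseHomogeneous_toPP ?_, rfl⟩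
      rw [add_comm]
      exact (MvPolynomial.isHomogeneous_X _ _).mul hq
    · change φ (Ideal.Quotient.mk _ (hΨ.toPP (MvPolynomial.X Γ * q))) = _
      rw [hφ, map_mul]
      rfl

end Kernel

end EdgeSimple

theorem mainTheorem8 {d : ℕ} (Δ : Set (Fin d → ℝ)) (hΔ : EdgeSimple.IsDPolytope Δ)
    (hedge : EdgeSimple.SimpleInEdges Δ)
    (n : (Fin d → ℝ) → (Fin d → ℝ)) (c : (Fin d → ℝ) → ℝ) (hcut : EdgeSimple.IsCut Δ n c)
    (ξ : EdgeSimple.Facet (EdgeSimple.resolution Δ n c) → (Fin d → ℝ))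
    (hξ : EdgeSimple.IsNormalSystem (EdgeSimple.resolution Δ n c) ξ) :
    EdgeSimple.IsVolumePolynomial (EdgeSimple.resolution Δ n c) ξ
      (EdgeSimple.volumePolynomial (EdgeSimple.resolution Δ n c) ξ) ∧
    (∃! φ : EdgeSimple.PPbar (EdgeSimple.dualFan (EdgeSimple.resolution Δ n c)) ≃ₐ[ℝ]
        EdgeSimple.DiffAlg (EdgeSimple.resolution Δ n c) ξ,
      EdgeSimple.IsNatural (EdgeSimple.resolution Δ n c) ξ φ) ∧
    ∃ hΥ : EdgeSimple.skeleton (EdgeSimple.dualFan Δ) ⊆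
        EdgeSimple.dualFan (EdgeSimple.resolution Δ n c),
      ∀ φ : EdgeSimple.PPbar (EdgeSimple.dualFan (EdgeSimple.resolution Δ n c)) ≃ₐ[ℝ]
          EdgeSimple.DiffAlg (EdgeSimple.resolution Δ n c) ξ,
        EdgeSimple.IsNatural (EdgeSimple.resolution Δ n c) ξ φ →
        ∀ k : ℕ, (k = d → ∃ v, EdgeSimple.IsNonsimpleVertex Δ v) →
          (EdgeSimple.kerDeg hΥ k).map φ.toLinearMap = EdgeSimple.insertedDeg Δ n c ξ k := by
  have hS := EdgeSimple.isSimplePolytope_resolution hΔ hedge hcut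
  have := EdgeSimple.finite_facet hS.1
  let _ := Fintype.ofFinite (EdgeSimple.Facet (EdgeSimple.resolution Δ n c))
  classical
  exact ⟨hS.isVolumePolynomial hξ, hS.existsUnique_isNatural hξ,
    EdgeSimple.skeleton_subset_dualFan hΔ hcut, fun φ hφ k hns =>
      EdgeSimple.map_kerDeg_eq hΔ hedge hcut hS hξ _ hφ hns⟩
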